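/- **Conventions.** All algebras are over $\mathbb Q$, and $m,n\ge 0$ are integers. *Braids.* $B_l$ is the braid group on $l$ strands, given by Artin's generators $\sigma_1,\dots,\sigma_{l-1}$ ($\sigma_k$ is the positive crossing of the strands in positions $k,k+1$) and relations. The mixed pure braid group $P_{m,n}\subset B_{m+n}$ consists of the braids with trivial permutation which become the trivial braid on $m$ strands when the last $n$ strands are erased. The first $m$ strands are called poles. For $1\le p<q\le m+n$ let $$\sigma_{pq}=(\sigma_{p+1}\cdots\sigma_{q-1})^{-1}\,\sigma_p^2\,(\sigma_{p+1}\cdots\sigma_{q-1}),$$ and put $\alpha_{ij}=\sigma_{i,m+j}\in P_{m,n}$ for $1\le i\le m$, $1\le j\le n$ (strand $j$ goes once around pole $i$), and $\tau_{ij}=\sigma_{m+i,m+j}\in P_{m,n}$ for $1\le i<j\le n$ (strand $j$ goes once around strand $i$). Let $I$ be the augmentation ideal of the group algebra $\mathbb Q P_{m,n}$, let $J$ be the two-sided ideal generated by the elements $\tau_{ij}-1$, $1\le i<j\le n$, and let $\bar I$ be the image of $I$ in $\mathbb Q P_{m,n}/J^2$. *Chord algebras.* $\mathsf{dk}_{m,n}$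 is the Lie algebra generated by $a_{ij}$ ($1\le i\le m$, $1\le j\le n$) and $c_{ij}=c_{ji}$ ($1\le i\ne j\le n$) with the following relations, in which different indices of strands, and different indices of poles, stand for distinct elements: $$[a_{ij},a_{kl}]=0,\quad [a_{ij},c_{kl}]=0,\quad [c_{ij},c_{kl}]=0,$$ $$[a_{ij}+c_{jk},a_{ik}]=0,\quad [a_{ij}+a_{ik},c_{jk}]=0,\quad [c_{ij}+c_{jk},c_{ik}]=0.$$ Let $\mathsf c\subset\mathsf{dk}_{m,n}$ be the Lie ideal generated by all $c_{ij}$, and let $\mathsf{edk}_{m,n}=\mathsf{dk}_{m,n}/[\mathsf c,\mathsf c]$. Let $\mathcal A^{\mathrm{em}}_{m,n}$ be the quotient of $U(\mathsf{dk}_{m,n})$ by the span of the monomials in the $a_{ij}$ and $c_{ij}$ which contain at least two factors of type $c_{ij}$. The algebras $U(\mathsf{dk}_{m,n})$ and $\mathcal A^{\mathrm{em}}_{m,n}$ are graded, with all $a_{ij}$ and $c_{ij}$ of degree $1$. The degree completion of a graded algebra $A=\bigoplus_k A_k$ is $\widehat A=\prod_k A_k$, and an isomorphism between such products is called graded if it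 is a product of isomorphisms in each degree. **Proposition.** Let $m,n\ge 0$. 1. There is exactly one isomorphism of graded $\mathbb Q$-algebras $$\prod_{k\ge 0} I^k/I^{k+1}\;\cong\;\widehat{U(\mathsf{dk}_{m,n})}$$ through which the class of $\alpha_{ij}-1$ in $I/I^2$ corresponds to $a_{ij}$ and the class of $\tau_{ij}-1$ in $I/I^2$ corresponds to $c_{ij}$. 2. There is exactly one isomorphism of graded $\mathbb Q$-algebras $$\prod_{k\ge 0}\bar I^k/\bar I^{k+1}\;\cong\;\widehat{\mathcal A^{\mathrm{em}}_{m,n}}$$ through which the class of $\alpha_{ij}-1$ corresponds to $a_{ij}$ and the class of $\tau_{ij}-1$ corresponds to $c_{ij}$. 3. There is exactly one isomorphism of $\mathbb Q$-algebras from the quotient of $U(\mathsf{edk}_{m,n})$ by the span of the monomials in the $a_{ij}$ and $c_{ij}$ with at least two factors of type $c_{ij}$ onto $\mathcal A^{\mathrm{em}}_{m,n}$ which sends each $a_{ij}$ to $a_{ij}$ and each $c_{ij}$ to $c_{ij}$. -/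

import Mathlib

namespace MixedBraid

/-! ### Braid groups and mixed pure braid groups -/

/-- Artin's relations for the braid group on `l` strands; the generator with index `k` is the
positive crossing of the strands in positions `k` and `k + 1` (positions are counted from `0`). -/
def braidRels (l : ℕ) : Set (FreeGroup (Fin (l - 1))) :=
  {r | (∃ i j : Fin (l - 1), i.val + 1 = j.val ∧
          r = .of i * .of j * .of i * (.of j * .of i * .of j)⁻¹) ∨
       (∃ i j : Fin (l - 1), i.val + 2 ≤ j.val ∧ r = .of i * .of j * (.of j * .of i)⁻¹)}

/-- Artin's braid group `B_l` on `l` strands. A product `β * β'` is read from the bottom to the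
top: `β'` is placed above `β`. -/
def BraidGroup (l : ℕ) : Type := PresentedGroup (braidRels l)

instance (l : ℕ) : Group (BraidGroup l) := inferInstanceAs (Group (PresentedGroup (braidRels l)))

/-- The positive crossing of the strands in positions `k` and `k + 1`; it is only meaningful for
`k + 1 < l`, and set to `1` otherwise. -/
def sigma {l : ℕ} (k : ℕ) : BraidGroup l :=
  if h : k < l - 1 then PresentedGroup.of ⟨k, h⟩ else 1

theorem sigma_of_lt {l k : ℕ} (h : k < l - 1) :
    (sigma k : BraidGroup l) = PresentedGroup.of ⟨k, h⟩ := dif_pos h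

theorem sigma_braid {l k : ℕ} (h : k + 2 < l) :
    (sigma k * sigma (k + 1) * sigma k : BraidGroup l) =
      sigma (k + 1) * sigma k * sigma (k + 1) := by
  have h1 : k < l - 1 := by omega
  have h2 : k + 1 < l - 1 := by omega
  rw [sigma_of_lt h1, sigma_of_lt h2, ← mul_inv_eq_one]
  exact PresentedGroup.one_of_mem (rels := braidRels l) (Or.inl ⟨⟨k, h1⟩, ⟨k + 1, h2⟩, rfl, rfl⟩)

theorem sigma_comm {l i j : ℕ} (hij : i + 2 ≤ j) :
    (sigma i * sigma j : BraidGroup l) = sigma j * sigma i := by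
  by_cases h2 : j < l - 1
  · have h1 : i < l - 1 := by omega
    rw [sigma_of_lt h1, sigma_of_lt h2, ← mul_inv_eq_one]
    exact PresentedGroup.one_of_mem (rels := braidRels l) (Or.inr ⟨⟨i, h1⟩, ⟨j, h2⟩, hij, rfl⟩)
  · simp [sigma, h2]

/-- The transposition of the positions `k` and `k + 1`. -/
def posSwap {l : ℕ} (k : Fin (l - 1)) : Equiv.Perm (Fin l) :=
  Equiv.swap ⟨k, by omega⟩ ⟨k + 1, by omega⟩

/-- A colouring of `l` positions with exactly `m` red positions (`true` is red, `false` is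
blue). -/
structure Coloring (m l : ℕ) where
  /-- Whether a position is red. -/
  red : Fin l → Bool
  card_red : (Finset.univ.filter fun x => red x = true).card = m

namespace Coloring

variable {m l : ℕ}

/-- The colouring above a braid with permutation `p`, when `c` is the colouring below it. -/
def act (c : Coloring m l) (p : Equiv.Perm (Fin l)) : Coloring m l :=
  ⟨fun x => c.red (p x), (Finset.card_equiv p (by simp)).trans c.card_red⟩

@[simp] theorem act_one (c : Coloring m l) : c.act 1 = c := rfl

theorem act_mul (c : Coloring m l) (p q : Equiv.Perm (Fin l)) :
    c.act (p * q) = (c.act p).act q := rfl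

/-- The number of red positions among the first `k` positions. -/
def redBefore (c : Coloring m l) (k : ℕ) : ℕ :=
  (Finset.univ.filter fun x : Fin l => x.val < k ∧ c.red x = true).card

theorem redBefore_succ (c : Coloring m l) (k : Fin l) :
    c.redBefore (k + 1) = c.redBefore k + if c.red k = true then 1 else 0 := by
  unfold redBefore
  split_ifs with h
  · rw [← Finset.card_insert_of_notMem (a := k) (by simp)]
    congr 1
    ext x
    simp only [Finset.mem_filter, Finset.mem_univ, true_and, Finset.mem_insert, Fin.ext_iff]
    constructor
    · rintro ⟨h1, h2⟩
      by_cases hx : x.val = k.val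
      · exact Or.inl hx
      · exact Or.inr ⟨by omega, h2⟩
    · rintro (h1 | ⟨h1, h2⟩)
      · have : x = k := Fin.ext h1
        subst this
        exact ⟨by omega, h⟩
      · exact ⟨by omega, h2⟩
  · rw [add_zero]
    congr 1
    ext x
    simp only [Finset.mem_filter, Finset.mem_univ, true_and]
    constructor
    · rintro ⟨h1, h2⟩
      have : x ≠ k := by rintro rfl; exact h h2
      have : x.val ≠ k.val := fun h => this (Fin.ext h)
      exact ⟨by omega, h2⟩
    · rintro ⟨h1, h2⟩
      exact ⟨by omega, h2⟩

theorem redBefore_le (c : Coloring m l) (k : ℕ) : c.redBefore k ≤ m :=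
  (Finset.card_le_card (fun x => by simp +contextual)).trans_eq c.card_red

theorem redBefore_act (c : Coloring m l) (p : Equiv.Perm (Fin l)) (k : ℕ)
    (hp : ∀ x, (p x).val < k ↔ x.val < k) : (c.act p).redBefore k = c.redBefore k := by
  unfold redBefore
  exact Finset.card_equiv p (fun x => by
    rw [Finset.mem_filter, Finset.mem_filter]
    simp [act, hp])

end Coloring

/-- What remains of the positive crossing of the positions `k` and `k + 1` after the blue strands
are erased, when `c` is the colouring below the crossing: nothing, unless both strands are red, and
then the crossing of the corresponding red strands. -/
def crossingTrace {m l : ℕ} (k : Fin (l - 1)) (c : Coloring m l) : BraidGroup m :=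
  bif c.red ⟨k, by omega⟩ && c.red ⟨k + 1, by omega⟩ then sigma (c.redBefore k) else 1

/-- Permutations of the positions act on functions of a colouring. -/
def coloringAut (m l : ℕ) : Equiv.Perm (Fin l) →* MulAut (Coloring m l → BraidGroup m) where
  toFun p :=
    { toFun := fun f c => f (c.act p)
      invFun := fun f c => f (c.act p⁻¹)
      left_inv := fun f => by
        funext c
        show f ((c.act p⁻¹).act p) = f c
        rw [← Coloring.act_mul, inv_mul_cancel, Coloring.act_one]
      right_inv := fun f => by
        funext c
        show f ((c.act p).act p⁻¹) = f c
        rw [← Coloring.act_mul, mul_inv_cancel, Coloring.act_one]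
      map_mul' := fun _ _ => rfl }
  map_one' := rfl
  map_mul' _ _ := rfl

@[simp] theorem coloringAut_apply {m l : ℕ} (p : Equiv.Perm (Fin l))
    (f : Coloring m l → BraidGroup m) (c : Coloring m l) :
    coloringAut m l p f c = f (c.act p) := rfl

/-- The target of the erasing map: functions from colourings to the braid group on the red strands,
extended by the permutations of the positions. -/
abbrev TraceGroup (m l : ℕ) : Type :=
  (Coloring m l → BraidGroup m) ⋊[coloringAut m l] Equiv.Perm (Fin l)

/-- The value of the erasing map on a positive crossing. -/
def traceGen (m l : ℕ) (k : Fin (l - 1)) : TraceGroup m l :=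
  ⟨crossingTrace k, posSwap k⟩

theorem act_posSwap_left {m l : ℕ} (c : Coloring m l) (k : ℕ) (h : k < l - 1) :
    (c.act (posSwap ⟨k, h⟩)).red ⟨k, by omega⟩ = c.red ⟨k + 1, by omega⟩ := by
  simp [Coloring.act, posSwap]

theorem act_posSwap_right {m l : ℕ} (c : Coloring m l) (k : ℕ) (h : k < l - 1) :
    (c.act (posSwap ⟨k, h⟩)).red ⟨k + 1, by omega⟩ = c.red ⟨k, by omega⟩ := by
  simp [Coloring.act, posSwap]

theorem act_posSwap_of_ne {m l : ℕ} (c : Coloring m l) (k : ℕ) (h : k < l - 1) (x : ℕ) (hx : x < l)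
    (h1 : x ≠ k) (h2 : x ≠ k + 1) :
    (c.act (posSwap ⟨k, h⟩)).red ⟨x, hx⟩ = c.red ⟨x, hx⟩ := by
  simp only [Coloring.act, posSwap]
  rw [Equiv.swap_apply_of_ne_of_ne] <;> simpa [Fin.ext_iff]

theorem redBefore_posSwap {m l : ℕ} (c : Coloring m l) (k : ℕ) (h : k < l - 1) (x : ℕ)
    (hx : x ≠ k + 1) : (c.act (posSwap ⟨k, h⟩)).redBefore x = c.redBefore x := by
  apply Coloring.redBefore_act
  intro y
  simp only [posSwap, Equiv.swap_apply_def, Fin.ext_iff]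
  split_ifs <;> simp <;> omega

theorem redBefore_succ' {m l : ℕ} (c : Coloring m l) (k : ℕ) (h : k < l) :
    c.redBefore (k + 1) = c.redBefore k + if c.red ⟨k, h⟩ = true then 1 else 0 :=
  c.redBefore_succ ⟨k, h⟩

theorem posSwap_braid {l k : ℕ} (h1 : k < l - 1) (h2 : k + 1 < l - 1) :
    posSwap (l := l) ⟨k, h1⟩ * posSwap ⟨k + 1, h2⟩ * posSwap ⟨k, h1⟩ =
      posSwap ⟨k + 1, h2⟩ * posSwap ⟨k, h1⟩ * posSwap ⟨k + 1, h2⟩ := by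
  ext x
  simp only [posSwap, Equiv.Perm.mul_apply, Equiv.swap_apply_def, Fin.ext_iff]
  grind

theorem posSwap_comm {l i j : ℕ} (h1 : i < l - 1) (h2 : j < l - 1) (hij : i + 2 ≤ j) :
    posSwap (l := l) ⟨i, h1⟩ * posSwap ⟨j, h2⟩ = posSwap ⟨j, h2⟩ * posSwap ⟨i, h1⟩ := by
  ext x
  simp only [posSwap, Equiv.Perm.mul_apply, Equiv.swap_apply_def, Fin.ext_iff]
  grind

theorem traceGen_braid (m : ℕ) {l k : ℕ} (h1 : k < l - 1) (h2 : k + 1 < l - 1) :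
    traceGen m l ⟨k, h1⟩ * traceGen m l ⟨k + 1, h2⟩ * traceGen m l ⟨k, h1⟩ =
      traceGen m l ⟨k + 1, h2⟩ * traceGen m l ⟨k, h1⟩ * traceGen m l ⟨k + 1, h2⟩ := by
  refine SemidirectProduct.ext ?_ (posSwap_braid h1 h2)
  funext c
  simp only [SemidirectProduct.mul_left, SemidirectProduct.mul_right, Pi.mul_apply,
    coloringAut_apply, traceGen, Coloring.act_mul, crossingTrace]
  have e1 := act_posSwap_left c k h1
  have e2 := act_posSwap_right c k h1
  have e3 := act_posSwap_of_ne c k h1 (k + 2) (by omega) (by omega) (by omega)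
  have f1 := act_posSwap_left c (k + 1) h2
  have f2 := act_posSwap_right c (k + 1) h2
  have f3 := act_posSwap_of_ne c (k + 1) h2 k (by omega) (by omega) (by omega)
  set d := c.act (posSwap ⟨k, h1⟩) with hd
  set e := c.act (posSwap ⟨k + 1, h2⟩) with he
  have e4 := act_posSwap_left d (k + 1) h2
  have e5 := act_posSwap_right d (k + 1) h2
  have e6 := act_posSwap_of_ne d (k + 1) h2 k (by omega) (by omega) (by omega)
  have f4 := act_posSwap_left e k h1
  have f5 := act_posSwap_right e k h1
  have f6 := act_posSwap_of_ne e k h1 (k + 2) (by omega) (by omega) (by omega)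
  have r1 : d.redBefore k = c.redBefore k := redBefore_posSwap c k h1 k (by omega)
  have r2 : e.redBefore k = c.redBefore k := redBefore_posSwap c (k + 1) h2 k (by omega)
  have r3 := redBefore_posSwap d (k + 1) h2 k (by omega)
  have r4 := redBefore_posSwap e k h1 k (by omega)
  have s1 := redBefore_succ' c k (by omega)
  have s2 := redBefore_succ' d k (by omega)
  have s3 := redBefore_succ' (e.act (posSwap ⟨k, h1⟩)) k (by omega)
  have s4 := redBefore_succ' c (k + 1) (by omega)
  have s5 := redBefore_succ' c (k + 2) (by omega)
  have hm := c.redBefore_le (k + 3)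
  simp only [show k + 1 + 1 = k + 2 from rfl] at *
  rw [s1, s2, s3, e6, e4, f4, f5, f6, r3, r4, r1, r2, e1, e2, e3, f1, f2, f3]
  cases hx : c.red ⟨k, by omega⟩ <;> cases hy : c.red ⟨k + 1, by omega⟩ <;>
    cases hz : c.red ⟨k + 2, by omega⟩ <;> simp_all
  exact sigma_braid (by omega)

theorem traceGen_comm (m : ℕ) {l i j : ℕ} (h1 : i < l - 1) (h2 : j < l - 1) (hij : i + 2 ≤ j) :
    traceGen m l ⟨i, h1⟩ * traceGen m l ⟨j, h2⟩ =
      traceGen m l ⟨j, h2⟩ * traceGen m l ⟨i, h1⟩ := by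
  refine SemidirectProduct.ext ?_ (posSwap_comm h1 h2 hij)
  funext c
  simp only [SemidirectProduct.mul_left, Pi.mul_apply, coloringAut_apply, traceGen, crossingTrace]
  rw [act_posSwap_of_ne c i h1 j (by omega) (by omega) (by omega),
    act_posSwap_of_ne c i h1 (j + 1) (by omega) (by omega) (by omega),
    act_posSwap_of_ne c j h2 i (by omega) (by omega) (by omega),
    act_posSwap_of_ne c j h2 (i + 1) (by omega) (by omega) (by omega),
    redBefore_posSwap c i h1 j (by omega), redBefore_posSwap c j h2 i (by omega)]
  by_cases hi : (c.red ⟨i, by omega⟩ && c.red ⟨i + 1, by omega⟩) = true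
  · by_cases hj : (c.red ⟨j, by omega⟩ && c.red ⟨j + 1, by omega⟩) = true
    · rw [hi, hj]; simp only [cond_true]
      apply sigma_comm
      have s1 := redBefore_succ' c i (by omega)
      have s2 := redBefore_succ' c (i + 1) (by omega)
      have s3 : c.redBefore (i + 2) ≤ c.redBefore j :=
        Finset.card_le_card (fun x => by
          simp only [Finset.mem_filter, Finset.mem_univ, true_and]
          exact fun h => ⟨by omega, h.2⟩)
      rw [if_pos (by simp_all)] at s1
      rw [if_pos (by simp_all)] at s2
      simp only [show i + 1 + 1 = i + 2 from rfl] at s2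
      omega
    · simp [hi, hj]
  · simp [hi]

/-- The erasing map. Its right component is the permutation of a braid, and its left component
sends a colouring `c` of the bottom of the braid, with `m` red strands, to the `m`-strand braid
that is left when the blue strands are erased. -/
def trace (m l : ℕ) : BraidGroup l →* TraceGroup m l :=
  PresentedGroup.toGroup (rels := braidRels l) (f := traceGen m l) (by
    rintro r (⟨⟨i, hi⟩, ⟨j, hj⟩, hij, rfl⟩ | ⟨⟨i, hi⟩, ⟨j, hj⟩, hij, rfl⟩)
    · obtain rfl : i + 1 = j := hij
      simp only [map_mul, map_inv, FreeGroup.lift_apply_of, mul_inv_eq_one]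
      exact traceGen_braid m hi hj
    · simp only [map_mul, map_inv, FreeGroup.lift_apply_of, mul_inv_eq_one]
      exact traceGen_comm m hi hj hij)

theorem trace_sigma (m : ℕ) {l k : ℕ} (h : k < l - 1) :
    trace m l (sigma k) = traceGen m l ⟨k, h⟩ := by
  rw [sigma_of_lt h]
  exact PresentedGroup.toGroup.of _

/-- The standard colouring of `m + n` positions: the first `m` are red and the last `n` are
blue. -/
def stdColoring (m n : ℕ) : Coloring m (m + n) :=
  ⟨fun x => decide (x.val < m), by
    simp [Fin.card_filter_val_lt]⟩

/-- The mixed pure braid group `P_{m,n}`: the braids on `m + n` strands with trivial permutation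
which become the trivial braid on `m` strands when the last `n` strands are erased. -/
def MixedPureBraidGroup (m n : ℕ) : Subgroup (BraidGroup (m + n)) where
  carrier := {β | (trace m (m + n) β).right = 1 ∧ (trace m (m + n) β).left (stdColoring m n) = 1}
  one_mem' := by simp
  mul_mem' := by
    rintro a b ⟨ha, ha'⟩ ⟨hb, hb'⟩
    refine ⟨by simp [ha, hb], ?_⟩
    simp [ha, ha', hb']
  inv_mem' := by
    rintro a ⟨ha, ha'⟩
    refine ⟨by simp [ha], ?_⟩
    simp [ha, ha']

/-- The pure braid in which the strand in position `q` passes over the strands in the positions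
`p + 1, …, q - 1`, encircles the strand in position `p` once in the positive direction, and returns
over the same strands; here `p < q < l`. -/
def pureGen (l p q : ℕ) : BraidGroup l :=
  (((List.range' (p + 1) (q - (p + 1))).map sigma).prod)⁻¹ * sigma p ^ 2 *
    ((List.range' (p + 1) (q - (p + 1))).map sigma).prod

theorem trace_pureGen (m : ℕ) {l : ℕ} (p d : ℕ) (hd : p + 1 + d < l) :
    (trace m l (pureGen l p (p + 1 + d))).right = 1 ∧
    ∀ c : Coloring m l, c.red ⟨p + 1 + d, hd⟩ = false →
      (trace m l (pureGen l p (p + 1 + d))).left c = 1 := by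
  induction d with
  | zero =>
    have hp : p < l - 1 := by omega
    have e : pureGen l p (p + 1 + 0) = sigma p * sigma p := by simp [pureGen, pow_two]
    rw [e, map_mul, trace_sigma m hp]
    refine ⟨by simp [traceGen, posSwap], fun c hc => ?_⟩
    have h1 := act_posSwap_left c p hp
    simp only [add_zero] at hc
    simp [traceGen, crossingTrace, hc, h1]
  | succ d ih =>
    obtain ⟨ih1, ih2⟩ := ih (by omega)
    have hp : p + 1 + d < l - 1 := by omega
    have e : pureGen l p (p + 1 + (d + 1)) =
        (sigma (p + 1 + d))⁻¹ * pureGen l p (p + 1 + d) * sigma (p + 1 + d) := by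
      simp only [pureGen, show p + 1 + (d + 1) - (p + 1) = d + 1 by omega,
        show p + 1 + d - (p + 1) = d by omega, List.range'_1_concat, List.map_append,
        List.prod_append, List.map_cons, List.map_nil, List.prod_singleton, mul_inv_rev, mul_assoc]
    rw [e, map_mul, map_mul, map_inv]
    refine ⟨by simp [ih1], fun c hc => ?_⟩
    have h3 := ih2 (c.act (posSwap ⟨p + 1 + d, hp⟩)) (by
      rw [act_posSwap_left c _ hp]; exact hc)
    rw [trace_sigma m hp]
    have h4 : (posSwap (l := l) ⟨p + 1 + d, hp⟩)⁻¹ = posSwap ⟨p + 1 + d, hp⟩ :=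
      Equiv.swap_inv _ _
    simp [ih1, traceGen, h4, h3]

theorem pureGen_mem (m n p q : ℕ) (hpq : p < q) (hq : q < m + n) (hm : m ≤ q) :
    pureGen (m + n) p q ∈ MixedPureBraidGroup m n := by
  obtain ⟨d, rfl⟩ : ∃ d, q = p + 1 + d := ⟨q - (p + 1), by omega⟩
  obtain ⟨h1, h2⟩ := trace_pureGen m p d hq
  exact ⟨h1, h2 _ (by simpa [stdColoring] using hm)⟩

/-- The generator `α_{ij}`: strand `j` encircles pole `i`. -/
def alpha {m n : ℕ} (i : Fin m) (j : Fin n) : MixedPureBraidGroup m n :=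
  ⟨pureGen (m + n) i (m + j), pureGen_mem m n _ _ (by omega) (by omega) (by omega)⟩

/-- The generator `τ_{ij}`, for `i < j`: strand `j` encircles strand `i`. -/
def tau {m n : ℕ} (i j : Fin n) (h : i < j) : MixedPureBraidGroup m n :=
  ⟨pureGen (m + n) (m + i) (m + j), pureGen_mem m n _ _
    (Nat.add_lt_add_left h m) (by omega) (by omega)⟩

end MixedBraid

namespace MixedBraid
open scoped DirectSum

/-! ### Completions of graded algebras -/

/-- The degree completion `∏ k, A k` of a graded algebra `⨁ k, A k`. -/
def DegreeCompletion (A : ℕ → Type*) : Type _ := ∀ k, A k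

namespace DegreeCompletion

variable {A : ℕ → Type*}

instance [∀ k, AddCommGroup (A k)] : AddCommGroup (DegreeCompletion A) :=
  inferInstanceAs (AddCommGroup (∀ k, A k))

noncomputable instance [∀ k, AddCommGroup (A k)] [∀ k, Module ℚ (A k)] :
    Module ℚ (DegreeCompletion A) :=
  inferInstanceAs (Module ℚ (∀ k, A k))

/-- The element of the completion which is `x` in degree `k` and `0` in all other degrees. -/
def single [∀ k, AddCommGroup (A k)] (k : ℕ) (x : A k) : DegreeCompletion A := Pi.single k x

section Mul

variable [∀ k, AddCommGroup (A k)]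

theorem ext_of {x y : DegreeCompletion A}
    (h : ∀ k, DirectSum.of A k (x k) = DirectSum.of A k (y k)) : x = y :=
  funext fun k => DirectSum.of_injective k (h k)

theorem of_add_apply (x y : DegreeCompletion A) (k : ℕ) :
    DirectSum.of A k ((x + y) k) = DirectSum.of A k (x k) + DirectSum.of A k (y k) :=
  map_add _ _ _

theorem of_smul_apply [∀ k, Module ℚ (A k)] (c : ℚ) (x : DegreeCompletion A) (k : ℕ) :
    DirectSum.of A k ((c • x) k) = c • DirectSum.of A k (x k) :=
  (DirectSum.lof ℚ ℕ A k).map_smul c (x k)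

variable [DirectSum.GSemiring A]

/-- The Cauchy product: the component of `x * y` in degree `k` is the sum of the products
`x i * y j` with `i + j = k`. -/
instance : Mul (DegreeCompletion A) :=
  ⟨fun x y k => (∑ p ∈ Finset.HasAntidiagonal.antidiagonal k,
    DirectSum.of A p.1 (x p.1) * DirectSum.of A p.2 (y p.2) : ⨁ i, A i) k⟩

instance : One (DegreeCompletion A) := ⟨single 0 GradedMonoid.GOne.one⟩

theorem of_mul_apply (x y : DegreeCompletion A) (k : ℕ) :
    DirectSum.of A k ((x * y) k) = ∑ p ∈ Finset.HasAntidiagonal.antidiagonal k,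
      DirectSum.of A p.1 (x p.1) * DirectSum.of A p.2 (y p.2) := by
  have key : ∀ p ∈ Finset.HasAntidiagonal.antidiagonal k, DirectSum.of A k
      ((DirectSum.of A p.1 (x p.1) * DirectSum.of A p.2 (y p.2) : ⨁ i, A i) k) =
      DirectSum.of A p.1 (x p.1) * DirectSum.of A p.2 (y p.2) := by
    rintro ⟨i, j⟩ hp
    obtain rfl : i + j = k := by simpa using hp
    rw [DirectSum.of_mul_of, DirectSum.of_eq_same]
  change DirectSum.of A k ((∑ p ∈ Finset.HasAntidiagonal.antidiagonal k,
    DirectSum.of A p.1 (x p.1) * DirectSum.of A p.2 (y p.2) : ⨁ i, A i) k) = _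
  rw [DFinsupp.finsetSum_apply, map_sum]
  exact Finset.sum_congr rfl key

theorem of_one_apply (k : ℕ) :
    DirectSum.of A k ((1 : DegreeCompletion A) k) = if k = 0 then 1 else 0 := by
  split_ifs with h
  · subst h
    change DirectSum.of A 0 (Pi.single (M := A) 0 GradedMonoid.GOne.one 0) = 1
    rw [Pi.single_eq_same]; rfl
  · change DirectSum.of A k (Pi.single (M := A) 0 GradedMonoid.GOne.one k) = 0
    rw [Pi.single_eq_of_ne h, map_zero]

instance : Ring (DegreeCompletion A) where
  __ := (inferInstance : AddCommGroup (DegreeCompletion A))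
  left_distrib x y z := ext_of fun k => by
    simp only [of_mul_apply, of_add_apply, mul_add, Finset.sum_add_distrib]
  right_distrib x y z := ext_of fun k => by
    simp only [of_mul_apply, of_add_apply, add_mul, Finset.sum_add_distrib]
  zero_mul x := ext_of fun k => by
    rw [of_mul_apply]
    change ∑ p ∈ Finset.HasAntidiagonal.antidiagonal k, DirectSum.of A p.1 (0 : A p.1) * _ =
      DirectSum.of A k (0 : A k)
    simp
  mul_zero x := ext_of fun k => by
    rw [of_mul_apply]
    change ∑ p ∈ Finset.HasAntidiagonal.antidiagonal k, _ * DirectSum.of A p.2 (0 : A p.2) =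
      DirectSum.of A k (0 : A k)
    simp
  mul_assoc x y z := ext_of fun k => by
    simp only [of_mul_apply, Finset.sum_mul, Finset.mul_sum]
    rw [Finset.sum_sigma', Finset.sum_sigma']
    refine Finset.sum_nbij' (fun ⟨⟨_, j⟩, ⟨k, l⟩⟩ ↦ ⟨(k, l + j), (l, j)⟩)
      (fun ⟨⟨i, _⟩, ⟨k, l⟩⟩ ↦ ⟨(i + k, l), (i, k)⟩) ?_ ?_ ?_ ?_ ?_
    · rintro ⟨⟨a, b⟩, c, d⟩ h
      simp only [Finset.mem_sigma, Finset.HasAntidiagonal.mem_antidiagonal] at h ⊢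
      exact ⟨by omega, trivial⟩
    · rintro ⟨⟨a, b⟩, c, d⟩ h
      simp only [Finset.mem_sigma, Finset.HasAntidiagonal.mem_antidiagonal] at h ⊢
      exact ⟨by omega, trivial⟩
    · rintro ⟨⟨a, b⟩, c, d⟩ h
      simp only [Finset.mem_sigma, Finset.HasAntidiagonal.mem_antidiagonal] at h
      obtain ⟨-, rfl⟩ := h
      rfl
    · rintro ⟨⟨a, b⟩, c, d⟩ h
      simp only [Finset.mem_sigma, Finset.HasAntidiagonal.mem_antidiagonal] at h
      obtain ⟨-, rfl⟩ := h
      rfl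
    · simp [mul_assoc]
  one_mul x := ext_of fun k => by
    rw [of_mul_apply, Finset.sum_eq_single (0, k)]
    · simp [of_one_apply]
    · rintro ⟨i, j⟩ hp hne
      have : i ≠ 0 := by
        rintro rfl
        simp_all
      simp [of_one_apply, this]
    · simp
  mul_one x := ext_of fun k => by
    rw [of_mul_apply, Finset.sum_eq_single (k, 0)]
    · simp [of_one_apply]
    · rintro ⟨i, j⟩ hp hne
      have : j ≠ 0 := by
        rintro rfl
        simp_all
      simp [of_one_apply, this]
    · simp

variable [∀ k, Module ℚ (A k)] [DirectSum.GAlgebra ℚ A]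

noncomputable instance : Algebra ℚ (DegreeCompletion A) :=
  Algebra.ofModule
    (fun c x y => ext_of fun k => by
      simp only [of_mul_apply, of_smul_apply, Finset.smul_sum, smul_mul_assoc])
    (fun c x y => ext_of fun k => by
      simp only [of_mul_apply, of_smul_apply, Finset.smul_sum, mul_smul_comm])

end Mul

end DegreeCompletion

/-- A map between completions of graded algebras is degreewise if the degree `k` component of the
image depends only on the degree `k` component of the argument, for every `k`. A degreewise
isomorphism of algebras is the same as an isomorphism of graded algebras. -/
def IsDegreewise {A B : ℕ → Type*} (f : DegreeCompletion A → DegreeCompletion B) : Prop :=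
  ∀ (k : ℕ) (x y : DegreeCompletion A), x k = y k → f x k = f y k

/-! ### The associated graded algebra of an ideal -/

section AssociatedGraded

variable {A : Type*} [Ring A] (I : Ideal A)

/-- The piece `I ^ k / I ^ (k + 1)` of the associated graded algebra of the `I`-adic filtration. -/
abbrev GradedPiece (k : ℕ) : Type _ := ↥(I ^ k) ⧸ (I ^ (k + 1)).submoduleOf (I ^ k)

variable {I}

/-- The class in `I ^ k / I ^ (k + 1)` of an element of `I ^ k`. -/
def GradedPiece.mk (k : ℕ) (x : ↥(I ^ k)) : GradedPiece I k := Submodule.Quotient.mk x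

theorem GradedPiece.mk_eq_mk {k : ℕ} {x y : ↥(I ^ k)} :
    GradedPiece.mk k x = GradedPiece.mk k y ↔ (x : A) - y ∈ I ^ (k + 1) :=
  Submodule.Quotient.eq _

theorem GradedPiece.mk_surjective (k : ℕ) : Function.Surjective (GradedPiece.mk (I := I) k) :=
  Submodule.Quotient.mk_surjective _

theorem mem_pow_zero (x : A) : x ∈ I ^ 0 := by
  rw [Submodule.pow_zero, Ideal.one_eq_top]
  trivial

theorem GradedPiece.sigma_ext {i j : ℕ} (h : i = j) {x : ↥(I ^ i)} {y : ↥(I ^ j)}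
    (hxy : (x : A) = y) :
    (⟨i, GradedPiece.mk i x⟩ : GradedMonoid (GradedPiece I)) = ⟨j, GradedPiece.mk j y⟩ := by
  subst h
  obtain rfl : x = y := Subtype.ext hxy
  rfl

/-- The class of `1` in degree `0`. -/
def GradedPiece.one : GradedPiece I 0 := GradedPiece.mk 0 ⟨1, mem_pow_zero 1⟩

variable [I.IsTwoSided]

theorem mul_mem_pow_add {i j : ℕ} {x y : A} (hx : x ∈ I ^ i) (hy : y ∈ I ^ j) :
    x * y ∈ I ^ (i + j) := by
  rw [Ideal.IsTwoSided.pow_add]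
  exact Ideal.mul_mem_mul hx hy

/-- The product `I ^ i / I ^ (i + 1) × I ^ j / I ^ (j + 1) → I ^ (i + j) / I ^ (i + j + 1)` induced
by the product of the algebra. -/
def GradedPiece.mul {i j : ℕ} : GradedPiece I i → GradedPiece I j → GradedPiece I (i + j) :=
  Quotient.map₂ (fun x y => ⟨(x : A) * y, mul_mem_pow_add x.2 y.2⟩) (by
    intro x x' hx y y' hy
    have hx : (x : A) - x' ∈ I ^ (i + 1) := GradedPiece.mk_eq_mk.1 (Quotient.sound hx)
    have hy : (y : A) - y' ∈ I ^ (j + 1) := GradedPiece.mk_eq_mk.1 (Quotient.sound hy)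
    refine Quotient.exact (GradedPiece.mk_eq_mk.2 ?_)
    have h1 : ((x : A) - x') * y ∈ I ^ (i + 1 + j) := mul_mem_pow_add hx y.2
    have h2 : (x' : A) * (y - y') ∈ I ^ (i + (j + 1)) := mul_mem_pow_add x'.2 hy
    rw [show i + 1 + j = i + j + 1 by omega] at h1
    have h3 := Ideal.add_mem _ h1 h2
    convert h3 using 1
    simp only [sub_mul, mul_sub]
    abel)

theorem GradedPiece.mk_mul_mk {i j : ℕ} (x : ↥(I ^ i)) (y : ↥(I ^ j)) :
    GradedPiece.mul (GradedPiece.mk i x) (GradedPiece.mk j y) =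
      GradedPiece.mk (i + j) ⟨(x : A) * y, mul_mem_pow_add x.2 y.2⟩ := rfl

instance : GradedMonoid.GOne (GradedPiece I) := ⟨GradedPiece.one⟩

instance : GradedMonoid.GMul (GradedPiece I) := ⟨GradedPiece.mul⟩

instance : GradedMonoid.GMonoid (GradedPiece I) where
  one_mul := by
    rintro ⟨i, x⟩
    obtain ⟨x, rfl⟩ := GradedPiece.mk_surjective i x
    exact GradedPiece.sigma_ext (zero_add i) (one_mul _)
  mul_one := by
    rintro ⟨i, x⟩
    obtain ⟨x, rfl⟩ := GradedPiece.mk_surjective i x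
    exact GradedPiece.sigma_ext (add_zero i) (mul_one _)
  mul_assoc := by
    rintro ⟨i, x⟩ ⟨j, y⟩ ⟨k, z⟩
    obtain ⟨x, rfl⟩ := GradedPiece.mk_surjective i x
    obtain ⟨y, rfl⟩ := GradedPiece.mk_surjective j y
    obtain ⟨z, rfl⟩ := GradedPiece.mk_surjective k z
    exact GradedPiece.sigma_ext (add_assoc i j k) (mul_assoc _ _ _)

instance : DirectSum.GSemiring (GradedPiece I) where
  mul_zero := by
    intro i j x
    obtain ⟨x, rfl⟩ := GradedPiece.mk_surjective i x
    exact GradedPiece.mk_eq_mk.2 (by simp)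
  zero_mul := by
    intro i j x
    obtain ⟨x, rfl⟩ := GradedPiece.mk_surjective j x
    exact GradedPiece.mk_eq_mk.2 (by simp)
  mul_add := by
    intro i j x y z
    obtain ⟨x, rfl⟩ := GradedPiece.mk_surjective i x
    obtain ⟨y, rfl⟩ := GradedPiece.mk_surjective j y
    obtain ⟨z, rfl⟩ := GradedPiece.mk_surjective j z
    exact GradedPiece.mk_eq_mk.2 (by simp [mul_add])
  add_mul := by
    intro i j x y z
    obtain ⟨x, rfl⟩ := GradedPiece.mk_surjective i x
    obtain ⟨y, rfl⟩ := GradedPiece.mk_surjective i y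
    obtain ⟨z, rfl⟩ := GradedPiece.mk_surjective j z
    exact GradedPiece.mk_eq_mk.2 (by simp [add_mul])
  natCast n := GradedPiece.mk 0 ⟨n, mem_pow_zero _⟩
  natCast_zero := GradedPiece.mk_eq_mk.2 (by simp)
  natCast_succ n := GradedPiece.mk_eq_mk.2 (by simp)

noncomputable instance [Algebra ℚ A] : DirectSum.GAlgebra ℚ (GradedPiece I) where
  toFun :=
    { toFun := fun c => GradedPiece.mk 0 ⟨algebraMap ℚ A c, mem_pow_zero _⟩
      map_zero' := GradedPiece.mk_eq_mk.2 (by simp)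
      map_add' := fun c d => GradedPiece.mk_eq_mk.2 (by simp) }
  map_one := GradedPiece.mk_eq_mk.2 (by simp)
  map_mul c d := GradedPiece.sigma_ext (zero_add 0).symm (by simp)
  commutes := by
    rintro c ⟨i, x⟩
    obtain ⟨x, rfl⟩ := GradedPiece.mk_surjective i x
    exact GradedPiece.sigma_ext (show 0 + i = i + 0 by omega) (Algebra.commutes c (x : A))
  smul_def := by
    rintro c ⟨i, x⟩
    obtain ⟨x, rfl⟩ := GradedPiece.mk_surjective i x
    exact GradedPiece.sigma_ext (zero_add i).symm (Algebra.smul_def c (x : A))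

end AssociatedGraded

end MixedBraid

namespace MixedBraid
open scoped DirectSum

/-! ### The mixed Drinfeld–Kohno Lie algebras -/

section Lie

/-- The chords: `a i j` connects pole `i` to strand `j`, and `c i j` connects the different strands
`i` and `j`. -/
inductive Chord (m n : ℕ) : Type
  | a (i : Fin m) (j : Fin n)
  | c (i j : Fin n) (h : i ≠ j)

/-- A chord that connects two strands. -/
def Chord.IsStrandChord {m n : ℕ} : Chord m n → Prop
  | .a _ _ => False
  | .c _ _ _ => True

/-- The free generators. -/
noncomputable abbrev freeA {m n : ℕ} (i : Fin m) (j : Fin n) : FreeLieAlgebra ℚ (Chord m n) :=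
  FreeLieAlgebra.of ℚ (.a i j)

/-- The free generators. -/
noncomputable abbrev freeC {m n : ℕ} (i j : Fin n) (h : i ≠ j) : FreeLieAlgebra ℚ (Chord m n) :=
  FreeLieAlgebra.of ℚ (.c i j h)

/-- The relations of `dk_{m,n}`: the symmetry `c_{ij} = c_{ji}`, and, with `a_{ij} = t_{i(m+j)}` and
`c_{ij} = t_{(m+i)(m+j)}`, all commutation relations `[t_{pq}, t_{rs}] = 0` and all 4T relations
`[t_{pq} + t_{qr}, t_{pr}] = 0`, for distinct indices, in which only these generators occur. -/
inductive DKRel (m n : ℕ) : FreeLieAlgebra ℚ (Chord m n) → Prop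
  | symm (i j : Fin n) (h : i ≠ j) : DKRel m n (freeC i j h - freeC j i h.symm)
  | comm_aa (i k : Fin m) (j l : Fin n) (hik : i ≠ k) (hjl : j ≠ l) :
      DKRel m n ⁅freeA (n := n) i j, freeA k l⁆
  | comm_ac (i : Fin m) (j k l : Fin n) (hjk : j ≠ k) (hjl : j ≠ l) (hkl : k ≠ l) :
      DKRel m n ⁅freeA i j, freeC k l hkl⁆
  | comm_cc (i j k l : Fin n) (hij : i ≠ j) (hik : i ≠ k) (hil : i ≠ l) (hjk : j ≠ k)
      (hjl : j ≠ l) (hkl : k ≠ l) :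
      DKRel m n ⁅freeC (m := m) i j hij, freeC k l hkl⁆
  | fourT_a (i : Fin m) (j k : Fin n) (hjk : j ≠ k) :
      DKRel m n ⁅freeA i j + freeC j k hjk, freeA i k⁆
  | fourT_c (i : Fin m) (j k : Fin n) (hjk : j ≠ k) :
      DKRel m n ⁅freeA i j + freeA i k, freeC j k hjk⁆
  | fourT_ccc (i j k : Fin n) (hij : i ≠ j) (hjk : j ≠ k) (hik : i ≠ k) :
      DKRel m n ⁅freeC (m := m) i j hij + freeC j k hjk, freeC i k hik⁆

/-- The Lie ideal of the relations. -/
noncomputable abbrev dkIdeal (m n : ℕ) : LieIdeal ℚ (FreeLieAlgebra ℚ (Chord m n)) :=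
  LieSubmodule.lieSpan ℚ (FreeLieAlgebra ℚ (Chord m n)) {x | DKRel m n x}

/-- The mixed Drinfeld–Kohno Lie algebra `dk_{m,n}`. -/
noncomputable abbrev DK (m n : ℕ) : Type := FreeLieAlgebra ℚ (Chord m n) ⧸ dkIdeal m n

/-- The generators `a_{ij}` and `c_{ij}` of `dk_{m,n}`. -/
noncomputable def dkGen {m n : ℕ} (x : Chord m n) : DK m n :=
  LieSubmodule.Quotient.mk (FreeLieAlgebra.of ℚ x)

/-- The Lie ideal `c` of `dk_{m,n}` generated by all `c_{ij}`. -/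
noncomputable def strandIdeal (m n : ℕ) : LieIdeal ℚ (DK m n) :=
  LieSubmodule.lieSpan ℚ (DK m n) {x | ∃ g : Chord m n, g.IsStrandChord ∧ x = dkGen g}

/-- The emergent Drinfeld–Kohno Lie algebra `edk_{m,n} = dk_{m,n} / [c, c]`. -/
noncomputable abbrev EDK (m n : ℕ) : Type := DK m n ⧸ ⁅strandIdeal m n, strandIdeal m n⁆

/-- The generators of `edk_{m,n}`. -/
noncomputable def edkGen {m n : ℕ} (x : Chord m n) : EDK m n := LieSubmodule.Quotient.mk (dkGen x)

end Lie

/-! ### Their enveloping algebras and the algebra of emergent chord diagrams -/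

/-- The algebra `A_{m,n} = U(dk_{m,n})`. -/
abbrev ChordAlgebra (m n : ℕ) : Type := UniversalEnvelopingAlgebra ℚ (DK m n)

/-- The generators `a_{ij}` and `c_{ij}` of `A_{m,n}`. -/
noncomputable def chord {m n : ℕ} (x : Chord m n) : ChordAlgebra m n :=
  UniversalEnvelopingAlgebra.ι ℚ (dkGen x)

/-- The two-sided ideal generated by (equivalently, when the elements `u x` generate the algebra,
the linear span of) the monomials in the elements `u x`, for all chords `x`, which contain at least
two factors `u x` with `x` a strand chord. -/
def doubleStrandIdeal {m n : ℕ} {A : Type*} [Ring A] (u : Chord m n → A) : Ideal A :=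
  (TwoSidedIdeal.span {y : A | ∃ (w₁ w₂ w₃ : List (Chord m n)) (x₁ x₂ : Chord m n),
    x₁.IsStrandChord ∧ x₂.IsStrandChord ∧
      y = ((w₁ ++ x₁ :: w₂ ++ x₂ :: w₃).map u).prod}).asIdeal

instance {m n : ℕ} {A : Type*} [Ring A] (u : Chord m n → A) :
    (doubleStrandIdeal u).IsTwoSided :=
  inferInstanceAs (TwoSidedIdeal.asIdeal _).IsTwoSided

/-- The algebra `A^em_{m,n}` of emergent chord diagrams: the quotient of `A_{m,n}` by the span of
the monomials with at least two factors of the form `c_{ij}`. -/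
abbrev EmergentChordAlgebra (m n : ℕ) : Type :=
  ChordAlgebra m n ⧸ doubleStrandIdeal (chord (m := m) (n := n))

/-- The generators of `A^em_{m,n}`. -/
noncomputable def emChord {m n : ℕ} (x : Chord m n) : EmergentChordAlgebra m n :=
  Ideal.Quotient.mk _ (chord x)

section Grading

variable {X A : Type*} [Ring A] [Algebra ℚ A]

/-- The span of the monomials of length `k` in the elements `u x`. -/
def monomialDegree (u : X → A) (k : ℕ) : Submodule ℚ A := Submodule.span ℚ (Set.range u) ^ k

instance (u : X → A) : SetLike.GradedMonoid (monomialDegree u) :=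
  inferInstanceAs (SetLike.GradedMonoid (fun k : ℕ => Submodule.span ℚ (Set.range u) ^ k))

theorem mem_monomialDegree_one (u : X → A) (x : X) : u x ∈ monomialDegree u 1 := by
  rw [monomialDegree, pow_one]
  exact Submodule.subset_span ⟨x, rfl⟩

/-- The element `u x`, in degree one. -/
def degreeOne (u : X → A) (x : X) : monomialDegree u 1 := ⟨u x, mem_monomialDegree_one u x⟩

/-- An algebra with generators `u x` is graded by the length of the monomials in the generators as
soon as it maps to the direct sum of the spans of the monomials of given length. -/
@[reducible]
noncomputable def gradedAlgebraOfLift (u : X → A) (hu : Algebra.adjoin ℚ (Set.range u) = ⊤)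
    (f : A →ₐ[ℚ] ⨁ k, monomialDegree u k)
    (hf : ∀ x, f (u x) = DirectSum.of (fun k => monomialDegree u k) 1 (degreeOne u x)) :
    GradedAlgebra (monomialDegree u) :=
  GradedAlgebra.ofAlgHom _ f
    (by
      refine AlgHom.ext_of_adjoin_eq_top hu ?_
      rintro _ ⟨x, rfl⟩
      rw [AlgHom.comp_apply, hf, DirectSum.coeAlgHom_of]
      rfl)
    (by
      rintro i ⟨y, hy⟩
      dsimp only
      induction hy using Submodule.pow_induction_on_left' with
      | algebraMap r =>
        rw [AlgHom.commutes, DirectSum.algebraMap_apply]; rfl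
      | add x y i hx hy ihx ihy =>
        rw [map_add, ihx, ihy, ← map_add]
        rfl
      | mem_mul y hy i z hz ih =>
        rw [map_mul, ih]
        have h : f y = DirectSum.of (fun k => monomialDegree u k) 1
            ⟨y, by rw [monomialDegree, pow_one]; exact hy⟩ := by
          induction hy using Submodule.span_induction with
          | mem y hy => obtain ⟨x, rfl⟩ := hy; exact hf x
          | zero => rw [map_zero]; exact (map_zero _).symm
          | add y z hy hz ihy ihz => rw [map_add, ihy, ihz, ← map_add]; rfl
          | smul c y hy ihy =>
            rw [map_smul, ihy]
            exact ((DirectSum.lof ℚ ℕ (fun k => monomialDegree u k) 1).map_smul c _).symm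
        rw [h, DirectSum.of_mul_of]
        exact DirectSum.of_eq_of_gradedMonoid_eq (Sigma.subtype_ext (add_comm _ _) rfl))

end Grading

section Lift

attribute [local instance] LieRing.ofAssociativeRing LieAlgebra.ofAssociativeAlgebra

/-- Lie algebra homomorphisms out of a quotient. -/
def lieQuotientLift {L L' : Type*} [LieRing L] [LieAlgebra ℚ L] [LieRing L'] [LieAlgebra ℚ L']
    (I : LieIdeal ℚ L) (f : L →ₗ⁅ℚ⁆ L') (h : I ≤ f.ker) : L ⧸ I →ₗ⁅ℚ⁆ L' :=
  { I.toSubmodule.liftQ f.toLinearMap (fun x hx => (LieHom.mem_ker).1 (h hx)) with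
    map_lie' := by
      intro x y
      obtain ⟨x, rfl⟩ := LieSubmodule.Quotient.surjective_mk' I x
      obtain ⟨y, rfl⟩ := LieSubmodule.Quotient.surjective_mk' I y
      exact f.map_lie x y }

/-- The relations of `dk_{m,n}` for elements `v x` of an algebra, with the commutator as the
bracket. -/
structure SatisfiesDK {m n : ℕ} {A : Type*} [Ring A] (v : Chord m n → A) : Prop where
  symm (i j : Fin n) (h : i ≠ j) : v (.c i j h) = v (.c j i h.symm)
  comm_aa (i k : Fin m) (j l : Fin n) (hik : i ≠ k) (hjl : j ≠ l) :
    ⁅v (.a i j), v (.a k l)⁆ = 0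
  comm_ac (i : Fin m) (j k l : Fin n) (hjk : j ≠ k) (hjl : j ≠ l) (hkl : k ≠ l) :
    ⁅v (.a i j), v (.c k l hkl)⁆ = 0
  comm_cc (i j k l : Fin n) (hij : i ≠ j) (hik : i ≠ k) (hil : i ≠ l) (hjk : j ≠ k)
    (hjl : j ≠ l) (hkl : k ≠ l) : ⁅v (.c i j hij), v (.c k l hkl)⁆ = 0
  fourT_a (i : Fin m) (j k : Fin n) (hjk : j ≠ k) :
    ⁅v (.a i j) + v (.c j k hjk), v (.a i k)⁆ = 0
  fourT_c (i : Fin m) (j k : Fin n) (hjk : j ≠ k) :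
    ⁅v (.a i j) + v (.a i k), v (.c j k hjk)⁆ = 0
  fourT_ccc (i j k : Fin n) (hij : i ≠ j) (hjk : j ≠ k) (hik : i ≠ k) :
    ⁅v (.c i j hij) + v (.c j k hjk), v (.c i k hik)⁆ = 0

variable {m n : ℕ} {A : Type*} [Ring A] [Algebra ℚ A]

/-- The universal property of `A_{m,n}`. -/
noncomputable def chordLift (v : Chord m n → A) (hv : SatisfiesDK v) : ChordAlgebra m n →ₐ[ℚ] A :=
  UniversalEnvelopingAlgebra.lift ℚ (lieQuotientLift (dkIdeal m n) (FreeLieAlgebra.lift ℚ v) (by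
    rw [LieSubmodule.lieSpan_le]
    intro x hx
    rw [SetLike.mem_coe, LieHom.mem_ker]
    cases hx <;>
      simp only [map_sub, map_add, LieHom.map_lie, FreeLieAlgebra.lift_of_apply, sub_eq_zero]
    · exact hv.symm _ _ _
    · exact hv.comm_aa _ _ _ _ ‹_› ‹_›
    · exact hv.comm_ac _ _ _ _ ‹_› ‹_› _
    · exact hv.comm_cc _ _ _ _ _ ‹_› ‹_› ‹_› ‹_› _
    · exact hv.fourT_a _ _ _ _
    · exact hv.fourT_c _ _ _ _
    · exact hv.fourT_ccc _ _ _ _ _ _))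

theorem chordLift_chord (v : Chord m n → A) (hv : SatisfiesDK v) (x : Chord m n) :
    chordLift v hv (chord x) = v x := by
  rw [chordLift, chord, UniversalEnvelopingAlgebra.lift_ι_apply]
  exact FreeLieAlgebra.lift_of_apply _ _

theorem mk_lie (x y : FreeLieAlgebra ℚ (Chord m n)) :
    UniversalEnvelopingAlgebra.ι ℚ (LieSubmodule.Quotient.mk ⁅x, y⁆ : DK m n) =
      ⁅UniversalEnvelopingAlgebra.ι ℚ (LieSubmodule.Quotient.mk x : DK m n),
        UniversalEnvelopingAlgebra.ι ℚ (LieSubmodule.Quotient.mk y : DK m n)⁆ := by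
  rw [LieSubmodule.Quotient.mk_bracket, LieHom.map_lie]

theorem mk_eq_zero_of_rel {x : FreeLieAlgebra ℚ (Chord m n)} (hx : DKRel m n x) :
    UniversalEnvelopingAlgebra.ι ℚ (LieSubmodule.Quotient.mk x : DK m n) = 0 := by
  have : (LieSubmodule.Quotient.mk x : DK m n) = 0 :=
    LieSubmodule.Quotient.mk_eq_zero'.2 (LieSubmodule.subset_lieSpan hx)
  rw [this, map_zero]

theorem satisfiesDK_chord : SatisfiesDK (chord (m := m) (n := n)) where
  symm i j h := sub_eq_zero.1 ((map_sub _ _ _).symm.trans (mk_eq_zero_of_rel (.symm i j h)))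
  comm_aa i k j l h1 h2 := (mk_lie _ _).symm.trans (mk_eq_zero_of_rel (.comm_aa i k j l h1 h2))
  comm_ac i j k l h1 h2 h3 :=
    (mk_lie _ _).symm.trans (mk_eq_zero_of_rel (.comm_ac i j k l h1 h2 h3))
  comm_cc i j k l h1 h2 h3 h4 h5 h6 :=
    (mk_lie _ _).symm.trans (mk_eq_zero_of_rel (.comm_cc i j k l h1 h2 h3 h4 h5 h6))
  fourT_a i j k h := by
    refine Eq.trans ?_ ((mk_lie (freeA i j + freeC j k h) (freeA i k)).symm.trans
      (mk_eq_zero_of_rel (.fourT_a i j k h)))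
    congr 1
    exact (map_add (UniversalEnvelopingAlgebra.ι ℚ) _ _).symm
  fourT_c i j k h := by
    refine Eq.trans ?_ ((mk_lie (freeA i j + freeA i k) (freeC j k h)).symm.trans
      (mk_eq_zero_of_rel (.fourT_c i j k h)))
    congr 1
    exact (map_add (UniversalEnvelopingAlgebra.ι ℚ) _ _).symm
  fourT_ccc i j k h1 h2 h3 := by
    refine Eq.trans ?_ ((mk_lie (freeC i j h1 + freeC j k h2) (freeC i k h3)).symm.trans
      (mk_eq_zero_of_rel (.fourT_ccc i j k h1 h2 h3)))
    congr 1
    exact (map_add (UniversalEnvelopingAlgebra.ι ℚ) _ _).symm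

theorem SatisfiesDK.map {B : Type*} [Ring B] {v : Chord m n → A} (hv : SatisfiesDK v)
    (f : A →+* B) : SatisfiesDK (fun x => f (v x)) where
  symm i j h := congrArg f (hv.symm i j h)
  comm_aa i k j l h1 h2 := by
    simpa [Ring.lie_def] using congrArg f (hv.comm_aa i k j l h1 h2)
  comm_ac i j k l h1 h2 h3 := by
    simpa [Ring.lie_def] using congrArg f (hv.comm_ac i j k l h1 h2 h3)
  comm_cc i j k l h1 h2 h3 h4 h5 h6 := by
    simpa [Ring.lie_def] using congrArg f (hv.comm_cc i j k l h1 h2 h3 h4 h5 h6)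
  fourT_a i j k h := by simpa [Ring.lie_def] using congrArg f (hv.fourT_a i j k h)
  fourT_c i j k h := by simpa [Ring.lie_def] using congrArg f (hv.fourT_c i j k h)
  fourT_ccc i j k h1 h2 h3 := by
    simpa [Ring.lie_def] using congrArg f (hv.fourT_ccc i j k h1 h2 h3)

theorem lie_of_one (u : Chord m n → A) (y z : monomialDegree u 1) (h : ⁅(y : A), (z : A)⁆ = 0) :
    ⁅DirectSum.of (fun k => monomialDegree u k) 1 y,
      DirectSum.of (fun k => monomialDegree u k) 1 z⁆ = 0 := by
  rw [Ring.lie_def, DirectSum.of_mul_of, DirectSum.of_mul_of, sub_eq_zero]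
  exact DirectSum.of_eq_of_gradedMonoid_eq
    (Sigma.subtype_ext rfl (sub_eq_zero.1 ((Ring.lie_def _ _).symm.trans h)))

theorem satisfiesDK_of (u : Chord m n → A) (hu : SatisfiesDK u) :
    SatisfiesDK (fun x => DirectSum.of (fun k => monomialDegree u k) 1 (degreeOne u x)) where
  symm i j h := congrArg _ (Subtype.ext (hu.symm i j h))
  comm_aa i k j l h1 h2 := lie_of_one u _ _ (hu.comm_aa i k j l h1 h2)
  comm_ac i j k l h1 h2 h3 := lie_of_one u _ _ (hu.comm_ac i j k l h1 h2 h3)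
  comm_cc i j k l h1 h2 h3 h4 h5 h6 := lie_of_one u _ _ (hu.comm_cc i j k l h1 h2 h3 h4 h5 h6)
  fourT_a i j k h := by
    rw [← map_add]
    exact lie_of_one u _ _ (hu.fourT_a i j k h)
  fourT_c i j k h := by
    rw [← map_add]
    exact lie_of_one u _ _ (hu.fourT_c i j k h)
  fourT_ccc i j k h1 h2 h3 := by
    rw [← map_add]
    exact lie_of_one u _ _ (hu.fourT_ccc i j k h1 h2 h3)

/-- The projection to a quotient of a Lie algebra. -/
def lieQuotientMk {L : Type*} [LieRing L] [LieAlgebra ℚ L] (I : LieIdeal ℚ L) : L →ₗ⁅ℚ⁆ L ⧸ I :=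
  { (LieSubmodule.Quotient.mk' I : L →ₗ[ℚ] L ⧸ I) with
    map_lie' := fun {x y} => LieSubmodule.Quotient.mk_bracket I x y }

theorem chordAlgebra_hom_ext {B : Type*} [Ring B] [Algebra ℚ B] {f g : ChordAlgebra m n →ₐ[ℚ] B}
    (h : ∀ x, f (chord x) = g (chord x)) : f = g := by
  apply UniversalEnvelopingAlgebra.hom_ext
  refine LieHom.ext fun y => ?_
  obtain ⟨y, rfl⟩ := LieSubmodule.Quotient.surjective_mk' _ y
  have key : (f.toLieHom.comp (UniversalEnvelopingAlgebra.ι ℚ)).comp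
      (lieQuotientMk (dkIdeal m n)) =
    (g.toLieHom.comp (UniversalEnvelopingAlgebra.ι ℚ)).comp
      (lieQuotientMk (dkIdeal m n)) := FreeLieAlgebra.hom_ext fun x => h x
  exact LieHom.congr_fun key y

theorem SatisfiesDK.of_injective {B : Type*} [Ring B] {v : Chord m n → A} (f : A →+* B)
    (hf : Function.Injective f) (hv : SatisfiesDK (fun x => f (v x))) : SatisfiesDK v where
  symm i j h := hf (hv.symm i j h)
  comm_aa i k j l h1 h2 := hf (by simpa [Ring.lie_def] using hv.comm_aa i k j l h1 h2)
  comm_ac i j k l h1 h2 h3 := hf (by simpa [Ring.lie_def] using hv.comm_ac i j k l h1 h2 h3)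
  comm_cc i j k l h1 h2 h3 h4 h5 h6 :=
    hf (by simpa [Ring.lie_def] using hv.comm_cc i j k l h1 h2 h3 h4 h5 h6)
  fourT_a i j k h := hf (by simpa [Ring.lie_def] using hv.fourT_a i j k h)
  fourT_c i j k h := hf (by simpa [Ring.lie_def] using hv.fourT_c i j k h)
  fourT_ccc i j k h1 h2 h3 := hf (by simpa [Ring.lie_def] using hv.fourT_ccc i j k h1 h2 h3)

theorem adjoin_chord : Algebra.adjoin ℚ (Set.range (chord (m := m) (n := n))) = ⊤ := by
  let B := Algebra.adjoin ℚ (Set.range (chord (m := m) (n := n)))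
  let v : Chord m n → B := fun x => ⟨chord x, Algebra.subset_adjoin ⟨x, rfl⟩⟩
  have hv : SatisfiesDK v :=
    SatisfiesDK.of_injective (B.val : B →+* ChordAlgebra m n) Subtype.val_injective
      satisfiesDK_chord
  have key : B.val.comp (chordLift v hv) = AlgHom.id ℚ _ :=
    chordAlgebra_hom_ext fun x => by
      rw [AlgHom.comp_apply, chordLift_chord]
      rfl
  refine eq_top_iff.2 fun y _ => ?_
  have h := DFunLike.congr_fun key y
  rw [AlgHom.comp_apply, AlgHom.id_apply] at h
  rw [← h]
  exact (chordLift v hv y).2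

theorem adjoin_emChord : Algebra.adjoin ℚ (Set.range (emChord (m := m) (n := n))) = ⊤ := by
  have h : Set.range (emChord (m := m) (n := n)) =
      Ideal.Quotient.mkₐ ℚ (doubleStrandIdeal (chord (m := m) (n := n))) '' Set.range chord := by
    rw [← Set.range_comp]
    rfl
  rw [h, ← AlgHom.map_adjoin, adjoin_chord, Algebra.map_top]
  exact (AlgHom.range_eq_top _).2 (Ideal.Quotient.mkₐ_surjective _ _)

theorem prod_of_degreeOne (u : Chord m n → A) (w : List (Chord m n)) :
    ∃ h : (w.map u).prod ∈ monomialDegree u w.length,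
      (w.map fun x => DirectSum.of (fun k => monomialDegree u k) 1 (degreeOne u x)).prod =
        DirectSum.of (fun k => monomialDegree u k) w.length ⟨(w.map u).prod, h⟩ := by
  induction w with
  | nil => exact ⟨SetLike.GradedOne.one_mem, rfl⟩
  | cons x w ih =>
    obtain ⟨h, ih⟩ := ih
    have h' : ((x :: w).map u).prod ∈ monomialDegree u (x :: w).length := by
      rw [List.map_cons, List.prod_cons, List.length_cons, add_comm]
      exact SetLike.GradedMul.mul_mem (mem_monomialDegree_one u x) h
    refine ⟨h', ?_⟩
    rw [List.map_cons, List.prod_cons, ih, DirectSum.of_mul_of]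
    exact DirectSum.of_eq_of_gradedMonoid_eq
      (Sigma.subtype_ext (add_comm _ _) (List.prod_cons (a := u x) (l := w.map u)).symm)

theorem prod_of_degreeOne_eq_zero (u : Chord m n → A) (w : List (Chord m n))
    (hw : (w.map u).prod = 0) :
    (w.map fun x => DirectSum.of (fun k => monomialDegree u k) 1 (degreeOne u x)).prod = 0 := by
  obtain ⟨h, h'⟩ := prod_of_degreeOne u w
  rw [h']
  have e : (⟨(w.map u).prod, h⟩ : monomialDegree u w.length) = 0 := Subtype.ext hw
  rw [e, map_zero]

theorem satisfiesDK_emChord : SatisfiesDK (emChord (m := m) (n := n)) :=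
  satisfiesDK_chord.map (Ideal.Quotient.mk _)

theorem prod_emChord (w : List (Chord m n)) :
    (w.map emChord).prod = Ideal.Quotient.mk _ ((w.map chord).prod) := by
  rw [map_list_prod, List.map_map]
  rfl

theorem prod_emChord_eq_zero (w₁ w₂ w₃ : List (Chord m n)) (x₁ x₂ : Chord m n)
    (h₁ : x₁.IsStrandChord) (h₂ : x₂.IsStrandChord) :
    ((w₁ ++ x₁ :: w₂ ++ x₂ :: w₃).map emChord).prod = 0 := by
  rw [prod_emChord]
  exact Ideal.Quotient.eq_zero_iff_mem.2 (TwoSidedIdeal.mem_asIdeal.2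
    (TwoSidedIdeal.subset_span ⟨w₁, w₂, w₃, x₁, x₂, h₁, h₂, rfl⟩))

/-- Algebra homomorphisms out of `A_{m,n}` that vanish on the monomials with two strand chords. -/
theorem doubleStrandIdeal_le {B : Type*} [Ring B] [Algebra ℚ B] (f : ChordAlgebra m n →ₐ[ℚ] B)
    (hf : ∀ (w₁ w₂ w₃ : List (Chord m n)) (x₁ x₂ : Chord m n),
      x₁.IsStrandChord → x₂.IsStrandChord →
        ((w₁ ++ x₁ :: w₂ ++ x₂ :: w₃).map fun x => f (chord x)).prod = 0)
    (y : ChordAlgebra m n) (hy : y ∈ doubleStrandIdeal (chord (m := m) (n := n))) : f y = 0 := by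
  rw [doubleStrandIdeal, TwoSidedIdeal.mem_asIdeal] at hy
  refine (TwoSidedIdeal.mem_ker _).1
    ((TwoSidedIdeal.span_le (I := TwoSidedIdeal.ker f)).2 ?_ hy)
  rintro _ ⟨w₁, w₂, w₃, x₁, x₂, h₁, h₂, rfl⟩
  rw [SetLike.mem_coe, TwoSidedIdeal.mem_ker, map_list_prod, List.map_map]
  exact hf w₁ w₂ w₃ x₁ x₂ h₁ h₂

/-- The algebra `A_{m,n}` is graded, with all generators in degree one. -/
noncomputable instance : GradedAlgebra (monomialDegree (chord (m := m) (n := n))) :=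
  gradedAlgebraOfLift chord adjoin_chord (chordLift _ (satisfiesDK_of _ satisfiesDK_chord))
    (chordLift_chord _ _)

/-- The homomorphism that sorts the elements of `A_{m,n}` by degree, read in `A^em_{m,n}`. -/
noncomputable def emSortAux (m n : ℕ) :
    ChordAlgebra m n →ₐ[ℚ] ⨁ k, monomialDegree (emChord (m := m) (n := n)) k :=
  chordLift _ (satisfiesDK_of _ satisfiesDK_emChord)

theorem emSortAux_chord (x : Chord m n) :
    emSortAux m n (chord x) =
      DirectSum.of (fun k => monomialDegree (emChord (m := m) (n := n)) k) 1
        (degreeOne emChord x) :=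
  chordLift_chord _ (satisfiesDK_of _ satisfiesDK_emChord) x

theorem emSortAux_eq_zero (y : ChordAlgebra m n)
    (hy : y ∈ doubleStrandIdeal (chord (m := m) (n := n))) : emSortAux m n y = 0 := by
  refine doubleStrandIdeal_le (B := ⨁ k, monomialDegree (emChord (m := m) (n := n)) k)
    (emSortAux m n) (fun w₁ w₂ w₃ x₁ x₂ h₁ h₂ => ?_) y hy
  have e : (fun x => emSortAux m n (chord x)) = fun x =>
      DirectSum.of (fun k => monomialDegree (emChord (m := m) (n := n)) k) 1
        (degreeOne emChord x) := funext emSortAux_chord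
  rw [e]
  exact prod_of_degreeOne_eq_zero _ _ (prod_emChord_eq_zero w₁ w₂ w₃ x₁ x₂ h₁ h₂)

/-- The homomorphism that sorts the elements of `A^em_{m,n}` by degree. -/
noncomputable def emSort (m n : ℕ) :
    EmergentChordAlgebra m n →ₐ[ℚ] ⨁ k, monomialDegree (emChord (m := m) (n := n)) k :=
  Ideal.Quotient.liftₐ (doubleStrandIdeal (chord (m := m) (n := n))) (emSortAux m n)
    emSortAux_eq_zero

theorem emSort_emChord (x : Chord m n) :
    emSort m n (emChord x) = DirectSum.of (fun k => monomialDegree (emChord (m := m) (n := n)) k) 1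
      (degreeOne emChord x) :=
  emSortAux_chord x

/-- The algebra `A^em_{m,n}` is graded, with all generators in degree one. -/
noncomputable instance : GradedAlgebra (monomialDegree (emChord (m := m) (n := n))) :=
  gradedAlgebraOfLift emChord adjoin_emChord (emSort m n) emSort_emChord

end Lift

end MixedBraid

namespace MixedBraid

noncomputable section

/-! ### Group algebras of mixed pure braid groups -/

/-- The augmentation `ℚ[G] → ℚ`, sending each group element to `1`. -/
def augmentation (G : Type*) [Group G] : MonoidAlgebra ℚ G →ₐ[ℚ] ℚ :=
  MonoidAlgebra.lift ℚ ℚ G 1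

/-- The augmentation ideal of `ℚ[G]`. -/
def augmentationIdeal (G : Type*) [Group G] : Ideal (MonoidAlgebra ℚ G) :=
  RingHom.ker (augmentation G)

instance (G : Type*) [Group G] : (augmentationIdeal G).IsTwoSided :=
  inferInstanceAs (RingHom.ker (augmentation G)).IsTwoSided

theorem of_sub_one_mem {G : Type*} [Group G] (g : G) :
    MonoidAlgebra.of ℚ G g - 1 ∈ augmentationIdeal G ^ 1 := by
  rw [Submodule.pow_one, augmentationIdeal, RingHom.mem_ker, map_sub, map_one, augmentation]
  simp

/-- The group algebra `ℚ P_{m,n}`. -/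
abbrev MixedGroupAlgebra (m n : ℕ) : Type := MonoidAlgebra ℚ (MixedPureBraidGroup m n)

/-- The augmentation ideal `I` of `ℚ P_{m,n}`. -/
abbrev mixedI (m n : ℕ) : Ideal (MixedGroupAlgebra m n) :=
  augmentationIdeal (MixedPureBraidGroup m n)

/-- The two-sided ideal `J` of `ℚ P_{m,n}` generated by the elements `τ_{ij} - 1`. -/
def mixedJ (m n : ℕ) : Ideal (MixedGroupAlgebra m n) :=
  (TwoSidedIdeal.span {y : MixedGroupAlgebra m n | ∃ (i j : Fin n) (h : i < j),
    y = MonoidAlgebra.of ℚ (MixedPureBraidGroup m n) (tau i j h) - 1}).asIdeal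

instance (m n : ℕ) : (mixedJ m n).IsTwoSided :=
  inferInstanceAs (TwoSidedIdeal.asIdeal _).IsTwoSided

/-- The algebra of emergent pure braids `ℚ P_{m,n} / J ^ 2`. -/
abbrev EmergentGroupAlgebra (m n : ℕ) : Type := MixedGroupAlgebra m n ⧸ mixedJ m n ^ 2

/-- The image of the augmentation ideal `I` in `ℚ P_{m,n} / J ^ 2`. -/
abbrev emergentI (m n : ℕ) : Ideal (EmergentGroupAlgebra m n) :=
  (mixedI m n).map (Ideal.Quotient.mk (mixedJ m n ^ 2))

/-- The class of `g - 1` in `I / I ^ 2`. -/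
def groupClass {m n : ℕ} (g : MixedPureBraidGroup m n) : GradedPiece (mixedI m n) 1 :=
  GradedPiece.mk 1 ⟨MonoidAlgebra.of ℚ _ g - 1, of_sub_one_mem g⟩

theorem emergent_of_sub_one_mem {m n : ℕ} (g : MixedPureBraidGroup m n) :
    Ideal.Quotient.mk (mixedJ m n ^ 2) (MonoidAlgebra.of ℚ _ g - 1) ∈ emergentI m n ^ 1 := by
  rw [Submodule.pow_one]
  refine Ideal.mem_map_of_mem _ ?_
  have h := of_sub_one_mem g
  rwa [Submodule.pow_one] at h

/-- The class of the image of `g - 1` in the first graded piece for `ℚ P_{m,n} / J ^ 2`. -/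
def emergentClass {m n : ℕ} (g : MixedPureBraidGroup m n) : GradedPiece (emergentI m n) 1 :=
  GradedPiece.mk 1 ⟨Ideal.Quotient.mk (mixedJ m n ^ 2) (MonoidAlgebra.of ℚ _ g - 1),
    emergent_of_sub_one_mem g⟩

/-- The completed associated graded algebra `∏ I ^ k / I ^ (k + 1)` of `ℚ P_{m,n}`. -/
abbrev GrMixed (m n : ℕ) : Type := DegreeCompletion (GradedPiece (mixedI m n))

/-- The completed associated graded algebra of `ℚ P_{m,n} / J ^ 2`. -/
abbrev GrEmergent (m n : ℕ) : Type := DegreeCompletion (GradedPiece (emergentI m n))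

/-- The degree completion of `A_{m,n} = U(dk_{m,n})`. -/
abbrev CompletedChord (m n : ℕ) : Type :=
  DegreeCompletion fun k => monomialDegree (chord (m := m) (n := n)) k

/-- The degree completion of `A^em_{m,n}`. -/
abbrev CompletedEmergentChord (m n : ℕ) : Type :=
  DegreeCompletion fun k => monomialDegree (emChord (m := m) (n := n)) k

/-- The generators `a_{ij}` and `c_{ij}` of `U(edk_{m,n})`. -/
def edkChord {m n : ℕ} (x : Chord m n) : UniversalEnvelopingAlgebra ℚ (EDK m n) :=
  UniversalEnvelopingAlgebra.ι ℚ (edkGen x)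

end

end MixedBraid

/-! The proof is an induction on the number `n` of strands by combing. Every element of `P_{m,n+1}`
is uniquely a product `w * g` with `w` in the free group `F` on `m + n` letters (the loops of the
last strand) and `g` in `P_{m,n}`, which acts on `F` by Artin's action:
`freeHom_mul_stabHom_bijective`. Braid groups are given by a presentation, so uniqueness is proved
algebraically: `B_{l+1}` is made to act on `ℕ × (F ⋊ B_l)`, the set of its would-be cosets, and the
orbit of the base point determines both factors.

A pure generator conjugates each letter of `F` by an element whose class in the abelianization is
read off from linking numbers (`artin_pureGen`). This has two consequences. The group `P_{m,n}` acts
unipotently on the augmentation filtration of `ℚF`, so the powers of the augmentation ideal of the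
product are spanned by products of powers for the two factors (`groupIdeal_pow_le_combFiltration`).
And the relations of `dk_{m,n}` hold for the elements `s - 1` modulo `I ^ 3`
(`satisfiesDK_mk_cube`), which yields a homomorphism `θ` from `U(dk_{m,n})` to the associated graded
algebra. It hits every graded piece, because `I ^ k` is spanned modulo `I ^ (k + 1)` by products of
`k` elements `s - 1`.

Injectivity needs no multiplicative universal invariant. A merely linear map `L` to power series in
one variable `t` over `U(dk_{m,n})` is built recursively by `L (w * g) = M w * L g`, where `M` is
the Magnus expansion sending a letter to `1 + t * chord`. It maps `I ^ k` to series of order at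
least `k`, and the coefficient of `t ^ (k + 1)` in `L ((s - 1) * z)` is the chord of `s` times the
coefficient of `t ^ k` in `L z`. This works because, to leading order, a braid acts on `F` as the
commutator with its chord, which is what the commutation and 4T relations say
(`coeff_magnus_autMap_sub`, `isExpansion_combExpansion`). So the coefficient of `t ^ k` in `L`
inverts `θ` in degree `k`.

For emergent braids the same `L` maps `J ^ k` to series with coefficients in the `k`-th power of the
ideal of the `c_{ij}`: the `τ_{ij}` act unipotently on the powers of the ideal of the strand
letters, so `J ^ k` splits as `I ^ k` does. Hence the coefficients of `L` descend to maps from `ℚ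
P_{m,n} / J ^ 2` to the emergent chord algebra. Both cases are instances of `IsGradedComparison`,
and `existsUnique_equiv` turns this into the unique graded isomorphism.

For the third claim, a product of two elements of the ideal of the `c_{ij}` lies in the ideal of
monomials with two strand chords (`mul_mem_doubleStrandIdeal`). So `[c, c]` dies in the emergent
chord algebra, and the universal properties give homomorphisms in both directions that are inverse
on generators. -/

namespace MixedBraid

/-! ### Homomorphisms out of braid groups -/

section BraidLift

variable {l : ℕ} {G : Type*} [Group G]

/-- The homomorphism out of the braid group on `l` strands with prescribed values on Artin's
generators. -/
def braidLift (f : ℕ → G)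
    (h1 : ∀ k, k + 2 < l → f k * f (k + 1) * f k = f (k + 1) * f k * f (k + 1))
    (h2 : ∀ i j, i + 2 ≤ j → j + 1 < l → f i * f j = f j * f i) : BraidGroup l →* G :=
  PresentedGroup.toGroup (rels := braidRels l) (f := fun k => f k.val) (by
    rintro r (⟨⟨i, hi⟩, ⟨j, hj⟩, hij, rfl⟩ | ⟨⟨i, hi⟩, ⟨j, hj⟩, hij, rfl⟩)
    · obtain rfl : i + 1 = j := hij
      simp only [map_mul, map_inv, FreeGroup.lift_apply_of, mul_inv_eq_one]
      exact h1 i (by omega)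
    · simp only [map_mul, map_inv, FreeGroup.lift_apply_of, mul_inv_eq_one]
      exact h2 i j hij (by omega))

theorem braidLift_sigma (f : ℕ → G) (h1) (h2) {k : ℕ} (h : k + 1 < l) :
    braidLift (l := l) f h1 h2 (sigma k) = f k := by
  rw [sigma_of_lt (by omega)]
  exact PresentedGroup.toGroup.of _

theorem closure_sigma (l : ℕ) :
    Subgroup.closure {β : BraidGroup l | ∃ k, k + 1 < l ∧ β = sigma k} = ⊤ := by
  refine eq_top_iff.2 ?_
  have h := PresentedGroup.closure_range_of (braidRels l)
  intro β _
  have hβ : β ∈ Subgroup.closure (Set.range (PresentedGroup.of (rels := braidRels l))) := by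
    rw [h]; trivial
  refine (Subgroup.closure_mono (G := PresentedGroup (braidRels l)) ?_) hβ
  rintro _ ⟨⟨k, hk⟩, rfl⟩
  exact ⟨k, by omega, (sigma_of_lt hk).symm⟩

theorem braid_induction {p : BraidGroup l → Prop} (h1 : p 1)
    (hσ : ∀ k, k + 1 < l → p (sigma k)) (hmul : ∀ a b, p a → p b → p (a * b))
    (hinv : ∀ a, p a → p a⁻¹) (β : BraidGroup l) : p β := by
  have hβ : β ∈ Subgroup.closure {β : BraidGroup l | ∃ k, k + 1 < l ∧ β = sigma k} := by
    rw [closure_sigma]; trivial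
  induction hβ using Subgroup.closure_induction with
  | mem x hx => obtain ⟨k, hk, rfl⟩ := hx; exact hσ k hk
  | one => exact h1
  | mul x y _ _ hx hy => exact hmul x y hx hy
  | inv x _ hx => exact hinv x hx

end BraidLift

/-- Adding a strand on the right. -/
def addStrand (l : ℕ) : BraidGroup l →* BraidGroup (l + 1) :=
  braidLift sigma (fun _ h => sigma_braid (by omega)) (fun _ _ h _ => sigma_comm h)

theorem addStrand_sigma {l k : ℕ} (h : k + 1 < l) : addStrand l (sigma k) = sigma k :=
  braidLift_sigma _ _ _ h

theorem addStrand_pureGen {l p q : ℕ} (hpq : p < q) (h : q < l) :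
    addStrand l (pureGen l p q) = pureGen (l + 1) p q := by
  have e : addStrand l ((List.range' (p + 1) (q - (p + 1))).map sigma).prod =
      ((List.range' (p + 1) (q - (p + 1))).map sigma).prod := by
    rw [map_list_prod, List.map_map]
    congr 1
    refine List.map_congr_left fun k hk => ?_
    rw [List.mem_range'_1] at hk
    exact addStrand_sigma (by omega)
  simp only [pureGen, map_mul, map_inv, map_pow, e]
  rw [addStrand_sigma (by omega)]

/-! ### Artin's action on free groups -/

/-- The generator of the free group with index `k`, set to `1` if there is none. -/
def freeVar {l : ℕ} (k : ℕ) : FreeGroup (Fin l) :=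
  if h : k < l then FreeGroup.of ⟨k, h⟩ else 1

theorem freeVar_of_lt {l k : ℕ} (h : k < l) : (freeVar k : FreeGroup (Fin l)) = .of ⟨k, h⟩ :=
  dif_pos h

theorem freeVar_fin {l : ℕ} (k : Fin l) : freeVar k.val = FreeGroup.of k := freeVar_of_lt k.2

theorem freeGroup_hom_ext {l : ℕ} {G : Type*} [Group G] {f g : FreeGroup (Fin l) →* G}
    (h : ∀ k, k < l → f (freeVar k) = g (freeVar k)) : f = g :=
  FreeGroup.ext_hom _ _ fun k => by rw [← freeVar_fin]; exact h k k.2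

/-- The endomorphism of the free group that sends the variable with index `k` to `f k`. -/
def freeEnd (l : ℕ) {G : Type*} [Group G] (f : ℕ → G) : FreeGroup (Fin l) →* G :=
  FreeGroup.lift fun k => f k.val

theorem freeEnd_freeVar {l : ℕ} {G : Type*} [Group G] (f : ℕ → G) {k : ℕ} (h : k < l) :
    freeEnd l f (freeVar k) = f k := by
  rw [freeVar_of_lt h, freeEnd, FreeGroup.lift_apply_of]

/-- The images of the variables under Artin's action of the crossing with index `k`. -/
def artinVal (l k p : ℕ) : FreeGroup (Fin l) :=
  if p = k then (freeVar k)⁻¹ * freeVar (k + 1) * freeVar k else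
    if p = k + 1 then freeVar k else freeVar p

/-- The images of the variables under Artin's action of the inverse of the crossing with
index `k`. -/
def artinInvVal (l k p : ℕ) : FreeGroup (Fin l) :=
  if p = k then freeVar (k + 1) else
    if p = k + 1 then freeVar (k + 1) * freeVar k * (freeVar (k + 1))⁻¹ else freeVar p

theorem artinVal_self (l k : ℕ) :
    artinVal l k k = (freeVar k)⁻¹ * freeVar (k + 1) * freeVar k := if_pos rfl

theorem artinVal_succ (l k : ℕ) : artinVal l k (k + 1) = freeVar k := by simp [artinVal]

theorem artinVal_of_ne {l k p : ℕ} (h : p ≠ k) (h' : p ≠ k + 1) : artinVal l k p = freeVar p := by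
  simp [artinVal, h, h']

theorem artinInvVal_self (l k : ℕ) : artinInvVal l k k = freeVar (k + 1) := if_pos rfl

theorem artinInvVal_succ (l k : ℕ) :
    artinInvVal l k (k + 1) = freeVar (k + 1) * freeVar k * (freeVar (k + 1))⁻¹ := by
  simp [artinInvVal]

theorem artinInvVal_of_ne {l k p : ℕ} (h : p ≠ k) (h' : p ≠ k + 1) :
    artinInvVal l k p = freeVar p := by
  simp [artinInvVal, h, h']

/-- Artin's automorphism of the free group, for the crossing with index `k`. -/
def artinGen (l k : ℕ) : MulAut (FreeGroup (Fin l)) :=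
  if h : k + 1 < l then
    MonoidHom.toMulEquiv (freeEnd l (artinVal l k)) (freeEnd l (artinInvVal l k))
      (freeGroup_hom_ext fun p hp => by
        have h0 : k < l := by omega
        simp only [MonoidHom.comp_apply, MonoidHom.id_apply, freeEnd_freeVar _ hp]
        by_cases h1 : p = k
        · subst h1
          simp only [artinVal_self, map_mul, map_inv, freeEnd_freeVar _ h, freeEnd_freeVar _ h0,
            artinInvVal_self, artinInvVal_succ]
          group
        by_cases h2 : p = k + 1
        · subst h2
          rw [artinVal_succ, freeEnd_freeVar _ h0, artinInvVal_self]
        · rw [artinVal_of_ne h1 h2, freeEnd_freeVar _ hp, artinInvVal_of_ne h1 h2])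
      (freeGroup_hom_ext fun p hp => by
        have h0 : k < l := by omega
        simp only [MonoidHom.comp_apply, MonoidHom.id_apply, freeEnd_freeVar _ hp]
        by_cases h1 : p = k
        · subst h1
          rw [artinInvVal_self, freeEnd_freeVar _ h, artinVal_succ]
        by_cases h2 : p = k + 1
        · subst h2
          simp only [artinInvVal_succ, map_mul, map_inv, freeEnd_freeVar _ h,
            freeEnd_freeVar _ h0, artinVal_self, artinVal_succ]
          group
        · rw [artinInvVal_of_ne h1 h2, freeEnd_freeVar _ hp, artinVal_of_ne h1 h2])
  else 1

theorem artinGen_freeVar {l k : ℕ} (h : k + 1 < l) (p : ℕ) :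
    artinGen l k (freeVar p) = artinVal l k p := by
  by_cases hp : p < l
  · rw [artinGen, dif_pos h]
    exact freeEnd_freeVar _ hp
  -- Beyond `l` both sides are the default value `1`. So the formula needs no bound on `p`, and the
  -- braid relations can be checked without one.
  · have e : (freeVar p : FreeGroup (Fin l)) = 1 := dif_neg hp
    rw [e, map_one, artinVal, if_neg (by omega), if_neg (by omega), e]

theorem mulAut_free_ext {l : ℕ} {f g : MulAut (FreeGroup (Fin l))}
    (h : ∀ k, f (freeVar k) = g (freeVar k)) : f = g := by
  have e : f.toMonoidHom = g.toMonoidHom := freeGroup_hom_ext fun k _ => h k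
  exact MulEquiv.ext fun x => DFunLike.congr_fun e x

/-- Artin's action of the braid group on the free group. -/
def artin (l : ℕ) : BraidGroup l →* MulAut (FreeGroup (Fin l)) :=
  braidLift (artinGen l)
    (fun k h => mulAut_free_ext fun p => by
      have h1 : k + 1 < l := by omega
      have h2 : k + 1 + 1 < l := by omega
      have n1 : k + 1 + 1 ≠ k := by omega
      have n2 : k + 1 + 1 ≠ k + 1 := by omega
      have n3 : k ≠ k + 1 := by omega
      simp only [MulAut.mul_apply, artinGen_freeVar h1, artinGen_freeVar h2]
      by_cases e0 : p = k
      · subst e0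
        simp only [artinVal_self, artinVal_succ, artinVal_of_ne n1 n2, map_mul, map_inv,
          artinGen_freeVar h1, artinGen_freeVar h2, artinVal_of_ne n3 n1.symm, mul_assoc,
          mul_inv_rev, inv_inv]
        group
      by_cases e1 : p = k + 1
      · subst e1
        simp only [artinVal_self, artinVal_succ, artinVal_of_ne n1 n2, map_mul, map_inv,
          artinGen_freeVar h1, artinGen_freeVar h2, artinVal_of_ne n3 n1.symm]
      by_cases e2 : p = k + 1 + 1
      · subst e2
        simp only [artinVal_succ, artinVal_of_ne n1 n2,
          artinGen_freeVar h1, artinGen_freeVar h2, artinVal_of_ne n3 n1.symm]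
      simp only [artinVal_of_ne e0 e1, artinVal_of_ne e1 e2, artinGen_freeVar h1,
        artinGen_freeVar h2])
    (fun i j hij h => mulAut_free_ext fun p => by
      have h1 : i + 1 < l := by omega
      have a1 : i ≠ j := by omega
      have a2 : i ≠ j + 1 := by omega
      have a3 : i + 1 ≠ j := by omega
      have a4 : i + 1 ≠ j + 1 := by omega
      simp only [MulAut.mul_apply, artinGen_freeVar h1, artinGen_freeVar h]
      by_cases e0 : p = i
      · subst e0
        simp only [artinVal_self, artinVal_of_ne a1 a2, map_mul, map_inv, artinGen_freeVar h1,
          artinGen_freeVar h, artinVal_of_ne a3 a4]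
      by_cases e1 : p = i + 1
      · subst e1
        simp only [artinVal_succ, artinVal_of_ne a1 a2, artinGen_freeVar h1,
          artinGen_freeVar h, artinVal_of_ne a3 a4]
      rw [artinVal_of_ne e0 e1, artinGen_freeVar h]
      by_cases e2 : p = j
      · subst e2
        simp only [artinVal_self, map_mul, map_inv, artinGen_freeVar h1,
          artinVal_of_ne e0 e1, artinVal_of_ne a2.symm a4.symm]
      by_cases e3 : p = j + 1
      · subst e3
        simp only [artinVal_succ, artinGen_freeVar h1, artinVal_of_ne a1.symm a3.symm]
      rw [artinVal_of_ne e2 e3, artinGen_freeVar h1, artinVal_of_ne e0 e1])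

theorem artin_sigma {l k : ℕ} (h : k + 1 < l) (p : ℕ) :
    artin l (sigma k) (freeVar p) = artinVal l k p := by
  rw [artin, braidLift_sigma _ _ _ h, artinGen_freeVar h]

theorem artin_sigma_inv {l k : ℕ} (h : k + 1 < l) (p : ℕ) :
    artin l (sigma k)⁻¹ (freeVar p) = artinInvVal l k p := by
  rw [map_inv]
  refine (MulEquiv.symm_apply_eq _).2 ?_
  by_cases h1 : p = k
  · subst h1
    rw [artinInvVal_self, artin_sigma h, artinVal_succ]
  by_cases h2 : p = k + 1
  · subst h2
    simp only [artinInvVal_succ, map_mul, map_inv, artin_sigma h, artinVal_self, artinVal_succ]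
    group
  · rw [artinInvVal_of_ne h1 h2, artin_sigma h, artinVal_of_ne h1 h2]

/-! ### The action of the braid group on the cosets of `FreeBraid` -/

/-- The semidirect product of the free group on `l` letters with the braid group on `l` strands. -/
abbrev FreeBraid (l : ℕ) : Type := FreeGroup (Fin l) ⋊[artin l] BraidGroup l

/-- The element of `FreeBraid l` by which the crossing with index `k` acts when the marked strand
is in position `c`. -/
def markVal (l k c : ℕ) : FreeBraid l :=
  if c = k then SemidirectProduct.inl (freeVar k) else if c = k + 1 then 1 else
    -- The values are read off from `sigma k * cosetRep l c`, rewritten as a coset representative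
    -- times an element of the subgroup. Positions beyond `l` are meaningless and must get `1`:
    -- there `sigma k` with `k = l - 1` would be the default `1` of `B_l`, and the braid relation
    -- with its neighbour would fail.
    if k < c then if c ≤ l then SemidirectProduct.inr (sigma k) else 1
    else SemidirectProduct.inr (sigma (k - 1))

/-- The permutation by which the crossing with index `k` acts. -/
def markGen (l k : ℕ) : Equiv.Perm (ℕ × FreeBraid l) where
  toFun x := (Equiv.swap k (k + 1) x.1, markVal l k x.1 * x.2)
  invFun x := (Equiv.swap k (k + 1) x.1, (markVal l k (Equiv.swap k (k + 1) x.1))⁻¹ * x.2)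
  left_inv x := by simp
  right_inv x := by simp

theorem inr_mul_inl {l : ℕ} (β : BraidGroup l) (w : FreeGroup (Fin l)) :
    (SemidirectProduct.inr β * SemidirectProduct.inl w : FreeBraid l) =
      SemidirectProduct.inl (artin l β w) * SemidirectProduct.inr β := by
  rw [SemidirectProduct.inl_aut, mul_assoc, ← map_mul, inv_mul_cancel, map_one, mul_one]

theorem inr_sigma_mul_freeVar {l k : ℕ} (h : k + 1 < l) (p : ℕ) :
    (SemidirectProduct.inr (sigma k) * SemidirectProduct.inl (freeVar p) : FreeBraid l) =
      SemidirectProduct.inl (artinVal l k p) * SemidirectProduct.inr (sigma k) := by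
  rw [inr_mul_inl, artin_sigma h]

theorem markGen_self (l k : ℕ) (x : FreeBraid l) :
    markGen l k (k, x) = (k + 1, SemidirectProduct.inl (freeVar k) * x) := by
  simp [markGen, markVal]

theorem markGen_succ (l k : ℕ) (x : FreeBraid l) : markGen l k (k + 1, x) = (k, x) := by
  simp [markGen, markVal]

theorem markGen_of_gt {l k c : ℕ} (h : k + 1 < c) (hc : c ≤ l) (x : FreeBraid l) :
    markGen l k (c, x) = (c, SemidirectProduct.inr (sigma k) * x) := by
  have h1 : c ≠ k := by omega
  have h2 : c ≠ k + 1 := by omega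
  have h3 : k < c := by omega
  simp [markGen, markVal, Equiv.swap_apply_of_ne_of_ne, h1, h2, h3, hc]

theorem markGen_of_out {l k c : ℕ} (h : k + 1 < c) (hc : l < c) (x : FreeBraid l) :
    markGen l k (c, x) = (c, x) := by
  have h1 : c ≠ k := by omega
  have h2 : c ≠ k + 1 := by omega
  have h3 : k < c := by omega
  simp [markGen, markVal, Equiv.swap_apply_of_ne_of_ne, h1, h2, h3, hc.not_ge]

theorem markGen_of_lt {l k c : ℕ} (h : c < k) (x : FreeBraid l) :
    markGen l k (c, x) = (c, SemidirectProduct.inr (sigma (k - 1)) * x) := by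
  have h1 : c ≠ k := by omega
  have h2 : c ≠ k + 1 := by omega
  have h3 : ¬ k < c := by omega
  simp [markGen, markVal, Equiv.swap_apply_of_ne_of_ne, h1, h2, h3]

/-- The action of the braid group on `l + 1` strands on its cosets modulo the image of
`FreeBraid l`; the first component is the position of the marked strand. -/
def markAction (l : ℕ) : BraidGroup (l + 1) →* Equiv.Perm (ℕ × FreeBraid l) :=
  braidLift (markGen l)
    (fun k h => Equiv.ext fun ⟨c, x⟩ => by
      have hk : k + 1 < l := by omega
      simp only [Equiv.Perm.mul_apply]
      rcases lt_or_ge l c with hc | hc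
      · simp only [markGen_of_out (show k + 1 < c by omega) hc,
          markGen_of_out (show k + 1 + 1 < c by omega) hc]
      rcases lt_or_ge c k with e | e
      · obtain ⟨k, rfl⟩ : ∃ j, k = j + 1 := ⟨k - 1, by omega⟩
        simp only [markGen_of_lt e, markGen_of_lt (Nat.lt_succ_of_lt e), Nat.add_sub_cancel,
          ← mul_assoc, ← map_mul, Nat.succ_eq_add_one]
        rw [sigma_braid (by omega)]
      obtain ⟨d, rfl⟩ : ∃ d, c = k + d := ⟨c - k, by omega⟩
      match d with
      -- The marked strand crosses both others. The relation to check is that `sigma k` commutes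
      -- with the product of the letters `k + 1` and `k`, in this order, which Artin's automorphism
      -- fixes.
      | 0 =>
        simp only [add_zero, markGen_self,
          markGen_of_gt (show k + 1 < k + 1 + 1 by omega) (show k + 1 + 1 ≤ l by omega),
          markGen_of_lt (Nat.lt_succ_self k), ← mul_assoc, Nat.succ_eq_add_one,
          Nat.add_sub_cancel, inr_sigma_mul_freeVar hk, artinVal_succ]
        rw [mul_assoc (SemidirectProduct.inl (freeVar k)), inr_sigma_mul_freeVar hk,
          artinVal_self, ← mul_assoc, ← map_mul, ← map_mul]
        congr 4
        group
      -- The marked strand starts in the middle. The relation becomes the value of Artin's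
      -- automorphism on the letter `k + 1`.
      | 1 =>
        simp only [markGen_self, markGen_succ,
          markGen_of_gt (show k + 1 < k + 1 + 1 by omega) (show k + 1 + 1 ≤ l by omega),
          markGen_of_lt (Nat.lt_succ_self k), ← mul_assoc, Nat.succ_eq_add_one,
          Nat.add_sub_cancel, inr_sigma_mul_freeVar hk, artinVal_succ]
      | 2 =>
        simp only [show k + 2 = k + 1 + 1 from rfl, markGen_succ,
          markGen_of_gt (show k + 1 < k + 1 + 1 by omega) (show k + 1 + 1 ≤ l by omega),
          markGen_of_lt (Nat.lt_succ_self k),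
          Nat.succ_eq_add_one, Nat.add_sub_cancel]
      | d + 3 =>
        simp only [markGen_of_gt (show k + 1 < k + (d + 3) by omega) hc,
          markGen_of_gt (show k + 1 + 1 < k + (d + 3) by omega) hc, ← mul_assoc, ← map_mul]
        rw [sigma_braid (by omega)])
    (fun i j hij h => Equiv.ext fun ⟨c, x⟩ => by
      have hi : i + 1 < l := by omega
      simp only [Equiv.Perm.mul_apply]
      rcases lt_or_ge l c with hc | hc
      · simp only [markGen_of_out (show i + 1 < c by omega) hc,
          markGen_of_out (show j + 1 < c by omega) hc]
      have key (a b : ℕ) (hab : a + 2 ≤ b ∨ b + 2 ≤ a) :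
          (SemidirectProduct.inr (sigma a) * SemidirectProduct.inr (sigma b) : FreeBraid l) =
            SemidirectProduct.inr (sigma b) * SemidirectProduct.inr (sigma a) := by
        rw [← map_mul, ← map_mul]
        rcases hab with hab | hab
        · rw [sigma_comm hab]
        · rw [sigma_comm hab]
      have key' (a p : ℕ) (ha : a + 1 < l) (h1 : p ≠ a) (h2 : p ≠ a + 1) :
          (SemidirectProduct.inr (sigma a) * SemidirectProduct.inl (freeVar p) : FreeBraid l) =
            SemidirectProduct.inl (freeVar p) * SemidirectProduct.inr (sigma a) := by
        rw [inr_sigma_mul_freeVar ha, artinVal_of_ne h1 h2]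
      rcases lt_trichotomy c i with e | rfl | e
      · rw [markGen_of_lt (show c < j by omega), markGen_of_lt e, markGen_of_lt e,
          markGen_of_lt (show c < j by omega), ← mul_assoc, ← mul_assoc, key _ _ (by omega)]
      · rw [markGen_of_lt (show c < j by omega), markGen_self, markGen_self,
          markGen_of_lt (show c + 1 < j by omega), ← mul_assoc, ← mul_assoc,
          key' _ _ (by omega) (by omega) (by omega)]
      rcases Nat.lt_or_eq_of_le (Nat.succ_le_of_lt e) with e | rfl
      swap
      · rw [Nat.succ_eq_add_one, markGen_of_lt (show i + 1 < j by omega), markGen_succ,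
          markGen_succ, markGen_of_lt (show i < j by omega)]
      rcases lt_trichotomy c j with e' | rfl | e'
      · rw [markGen_of_lt e', markGen_of_gt e hc, markGen_of_gt e hc, markGen_of_lt e', ← mul_assoc,
          ← mul_assoc, key _ _ (by omega)]
      · rw [markGen_self, markGen_of_gt e hc,
        markGen_of_gt (show i + 1 < c + 1 by omega) (show c + 1 ≤ l by omega),
          markGen_self, ← mul_assoc, ← mul_assoc, key' _ _ (by omega) (by omega) (by omega)]
      rcases Nat.lt_or_eq_of_le (Nat.succ_le_of_lt e') with e' | rfl
      · rw [markGen_of_gt e' hc, markGen_of_gt e hc, markGen_of_gt e hc, markGen_of_gt e' hc,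
        ← mul_assoc,
          ← mul_assoc, key _ _ (by omega)]
      · rw [Nat.succ_eq_add_one, markGen_succ, markGen_of_gt e hc, markGen_succ,
          markGen_of_gt (show i + 1 < j by omega) (show j ≤ l by omega)])

theorem markAction_sigma {l k : ℕ} (h : k < l) (x : ℕ × FreeBraid l) :
    markAction l (sigma k) x = (Equiv.swap k (k + 1) x.1, markVal l k x.1 * x.2) := by
  rw [markAction, braidLift_sigma _ _ _ (by omega)]
  rfl

end MixedBraid

namespace MixedBraid

/-! ### The stabiliser of the last strand -/

/-- This identity and the next one live in the braid group on three strands. Conjugated by the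
common tail `cosetRep l (p + 2)`, they become the formulas by which `sigma p` conjugates the loops
of the last strand. -/
theorem conj_sq_of_braid {G : Type*} [Group G] {a b : G} (h : a * b * a = b * a * b) :
    b⁻¹ * a ^ 2 * b = a * b ^ 2 * a⁻¹ := by
  have h1 : b⁻¹ * a * b = a * b * a⁻¹ := by
    rw [eq_mul_inv_iff_mul_eq, mul_assoc, mul_assoc, inv_mul_eq_iff_eq_mul, ← mul_assoc, h]
    group
  calc b⁻¹ * a ^ 2 * b = (b⁻¹ * a * b) * (b⁻¹ * a * b) := by rw [pow_two]; group
    _ = a * b ^ 2 * a⁻¹ := by rw [h1, pow_two]; group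

theorem conj_conj_sq_of_braid {G : Type*} [Group G] {a b : G} (h : a * b * a = b * a * b) :
    a * (b⁻¹ * a ^ 2 * b) * a⁻¹ = (b⁻¹ * a ^ 2 * b)⁻¹ * b ^ 2 * (b⁻¹ * a ^ 2 * b) := by
  have h1 := conj_sq_of_braid h
  have h2 := conj_sq_of_braid h.symm
  calc a * (b⁻¹ * a ^ 2 * b) * a⁻¹
      = a * (b⁻¹ * b⁻¹ * (b * a ^ 2 * b⁻¹) * b ^ 2) * a⁻¹ := by group
    _ = a * (b⁻¹ * b⁻¹ * (a⁻¹ * b ^ 2 * a) * b ^ 2) * a⁻¹ := by rw [h2]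
    _ = (a * b ^ 2 * a⁻¹)⁻¹ * b ^ 2 * (a * b ^ 2 * a⁻¹) := by group
    _ = _ := by rw [h1]

/-- The braid that moves the last strand to position `c`. -/
def cosetRep (l c : ℕ) : BraidGroup (l + 1) := ((List.range' c (l - c)).map sigma).prod

theorem cosetRep_of_le {l c : ℕ} (h : l ≤ c) : cosetRep l c = 1 := by
  rw [cosetRep, Nat.sub_eq_zero_of_le h]
  rfl

theorem cosetRep_of_lt {l c : ℕ} (h : c < l) : cosetRep l c = sigma c * cosetRep l (c + 1) := by
  rw [cosetRep, cosetRep, ← List.prod_cons, ← List.map_cons, show l - c = l - (c + 1) + 1 by omega,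
    List.range'_succ]

theorem sigma_mul_cosetRep_of_gt {l k c : ℕ} (h : k + 1 < c) :
    sigma k * cosetRep l c = cosetRep l c * sigma k := by
  by_cases hc : c < l
  · rw [cosetRep_of_lt hc, ← mul_assoc, sigma_comm h, mul_assoc,
      sigma_mul_cosetRep_of_gt (show k + 1 < c + 1 by omega), mul_assoc]
  · rw [cosetRep_of_le (not_lt.1 hc), mul_one, one_mul]
termination_by l - c

/-- The crossing commutes with the factors of index below `k - 1`, turns into `sigma (k - 1)` by the
braid relation at the factors `k - 1` and `k`, and commutes with the rest. -/
theorem sigma_mul_cosetRep_of_lt {l k c : ℕ} (h : c < k) (hk : k < l) :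
    sigma k * cosetRep l c = cosetRep l c * sigma (k - 1) := by
  obtain ⟨k, rfl⟩ : ∃ j, k = j + 1 := ⟨k - 1, by omega⟩
  rw [Nat.add_sub_cancel]
  rcases Nat.lt_or_eq_of_le (Nat.le_of_lt_succ h) with e | rfl
  · rw [cosetRep_of_lt (show c < l by omega), ← mul_assoc,
    ← sigma_comm (show c + 2 ≤ k + 1 by omega),
      mul_assoc, sigma_mul_cosetRep_of_lt (show c + 1 < k + 1 by omega) hk, mul_assoc,
      Nat.add_sub_cancel]
  · rw [cosetRep_of_lt (show c < l by omega), cosetRep_of_lt hk, ← mul_assoc, ← mul_assoc,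
      ← sigma_braid (by omega), mul_assoc, sigma_mul_cosetRep_of_gt (by omega)]
    simp only [mul_assoc]
termination_by l - c

theorem pureGen_last (l p : ℕ) :
    pureGen (l + 1) p l = (cosetRep l (p + 1))⁻¹ * sigma p ^ 2 * cosetRep l (p + 1) := rfl

theorem pureGen_last' {l p : ℕ} (h : p < l) :
    pureGen (l + 1) p l = (cosetRep l (p + 1))⁻¹ * (sigma p * cosetRep l p) := by
  rw [pureGen_last, cosetRep_of_lt h, pow_two]
  simp only [mul_assoc]

theorem sigma_conj_pureGen_succ {l p : ℕ} (h : p + 1 < l) :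
    sigma p * pureGen (l + 1) (p + 1) l * (sigma p)⁻¹ = pureGen (l + 1) p l := by
  have hw := sigma_mul_cosetRep_of_gt (l := l) (show p + 1 < p + 2 by omega)
  have hw' : sigma p * (cosetRep l (p + 2))⁻¹ = (cosetRep l (p + 2))⁻¹ * sigma p :=
    (show Commute _ _ from hw).inv_right
  have hw'' : cosetRep l (p + 2) * (sigma p)⁻¹ = (sigma p)⁻¹ * cosetRep l (p + 2) :=
    ((show Commute _ _ from hw).inv_left).symm
  rw [pureGen_last, pureGen_last, cosetRep_of_lt h, mul_inv_rev]
  calc _ = (sigma p * (cosetRep l (p + 2))⁻¹) * sigma (p + 1) ^ 2 *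
        (cosetRep l (p + 2) * (sigma p)⁻¹) := by simp only [mul_assoc]
    _ = (cosetRep l (p + 2))⁻¹ * (sigma p * sigma (p + 1) ^ 2 * (sigma p)⁻¹) *
        cosetRep l (p + 2) := by rw [hw', hw'']; simp only [mul_assoc]
    _ = _ := by rw [← conj_sq_of_braid (sigma_braid (by omega))]; simp only [mul_assoc]

theorem sigma_conj_pureGen {l p : ℕ} (h : p + 1 < l) :
    sigma p * pureGen (l + 1) p l * (sigma p)⁻¹ = (pureGen (l + 1) p l)⁻¹ *
      pureGen (l + 1) (p + 1) l * pureGen (l + 1) p l := by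
  have hw := sigma_mul_cosetRep_of_gt (l := l) (show p + 1 < p + 2 by omega)
  have hw' : sigma p * (cosetRep l (p + 2))⁻¹ = (cosetRep l (p + 2))⁻¹ * sigma p :=
    (show Commute _ _ from hw).inv_right
  have hw'' : cosetRep l (p + 2) * (sigma p)⁻¹ = (sigma p)⁻¹ * cosetRep l (p + 2) :=
    ((show Commute _ _ from hw).inv_left).symm
  rw [pureGen_last, pureGen_last, cosetRep_of_lt h, mul_inv_rev]
  calc _ = (sigma p * (cosetRep l (p + 2))⁻¹) *
        ((sigma (p + 1))⁻¹ * sigma p ^ 2 * sigma (p + 1)) *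
        (cosetRep l (p + 2) * (sigma p)⁻¹) := by simp only [mul_assoc]
    _ = (cosetRep l (p + 2))⁻¹ * (sigma p * ((sigma (p + 1))⁻¹ * sigma p ^ 2 * sigma (p + 1)) *
        (sigma p)⁻¹) * cosetRep l (p + 2) := by rw [hw', hw'']; simp only [mul_assoc]
    _ = _ := by rw [conj_conj_sq_of_braid (sigma_braid (by omega))]; group

theorem sigma_mul_pureGen_of_ne {l k p : ℕ} (hk : k + 1 < l) (h1 : p ≠ k) (h2 : p ≠ k + 1) :
    sigma k * pureGen (l + 1) p l = pureGen (l + 1) p l * sigma k := by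
  suffices Commute (sigma k) (pureGen (l + 1) p l) from this
  rw [pureGen_last]
  rcases Nat.lt_or_gt_of_ne h1 with h | h
  · have e1 : sigma (k + 1) * cosetRep l (p + 1) = cosetRep l (p + 1) * sigma k :=
      sigma_mul_cosetRep_of_lt (show p + 1 < k + 1 by omega) hk
    have e2 : Commute (sigma (k + 1) : BraidGroup (l + 1)) (sigma p ^ 2) :=
      Commute.pow_right (show Commute _ _ from (sigma_comm (by omega)).symm) 2
    -- Written as a conjugate of `sigma (k + 1)` by `cosetRep l (p + 1)`, the crossing meets the
    -- core `sigma p ^ 2` of the loop as a distant generator.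
    have e3 : (sigma k : BraidGroup (l + 1)) =
        (cosetRep l (p + 1))⁻¹ * sigma (k + 1) * cosetRep l (p + 1) := by
      rw [mul_assoc, e1, inv_mul_cancel_left]
    rw [e3]
    have e4 := e2.eq
    show _ * _ = _ * _
    calc _ = (cosetRep l (p + 1))⁻¹ * (sigma (k + 1) * sigma p ^ 2) * cosetRep l (p + 1) := by
          group
      _ = _ := by rw [e4]; group
  · have e1 : Commute (sigma k) (cosetRep l (p + 1)) :=
      sigma_mul_cosetRep_of_gt (show k + 1 < p + 1 by omega)
    have e2 : Commute (sigma k : BraidGroup (l + 1)) (sigma p ^ 2) :=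
      Commute.pow_right (show Commute _ _ from (sigma_comm (by omega))) 2
    exact (e1.inv_right.mul_right e2).mul_right e1

/-! ### The semidirect product inside the braid group with one more strand -/

/-- The homomorphism from the free group on `l` letters that sends the variables to the pure braids
in which the last strand encircles another one. -/
def freeInc (l : ℕ) : FreeGroup (Fin l) →* BraidGroup (l + 1) :=
  freeEnd l fun p => pureGen (l + 1) p l

theorem freeInc_freeVar {l p : ℕ} (h : p < l) : freeInc l (freeVar p) = pureGen (l + 1) p l :=
  freeEnd_freeVar _ h

/-- Artin's values on the letters are the conjugation formulas for the loops of the last strand: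
`sigma_conj_pureGen`, `sigma_conj_pureGen_succ` and `sigma_mul_pureGen_of_ne`. -/
theorem freeInc_artin_sigma {l k : ℕ} (hk : k + 1 < l) (w : FreeGroup (Fin l)) :
    freeInc l (artin l (sigma k) w) = sigma k * freeInc l w * (sigma k)⁻¹ := by
  have key : (freeInc l).comp (artin l (sigma k)).toMonoidHom =
      (MulAut.conj (sigma k)).toMonoidHom.comp (freeInc l) :=
    freeGroup_hom_ext fun p hp => by
      change freeInc l (artin l (sigma k) (freeVar p)) =
        sigma k * freeInc l (freeVar p) * (sigma k)⁻¹
      rw [artin_sigma hk, freeInc_freeVar hp]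
      by_cases h1 : p = k
      · subst h1
        rw [artinVal_self, map_mul, map_mul, map_inv, freeInc_freeVar hp, freeInc_freeVar hk,
          sigma_conj_pureGen hk]
      by_cases h2 : p = k + 1
      · subst h2
        rw [artinVal_succ, freeInc_freeVar (by omega), sigma_conj_pureGen_succ hk]
      · rw [artinVal_of_ne h1 h2, freeInc_freeVar hp, sigma_mul_pureGen_of_ne hk h1 h2,
          mul_inv_cancel_right]
  exact DFunLike.congr_fun key w

theorem freeInc_artin {l : ℕ} (β : BraidGroup l) (w : FreeGroup (Fin l)) :
    freeInc l (artin l β w) = addStrand l β * freeInc l w * (addStrand l β)⁻¹ := by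
  induction β using braid_induction generalizing w with
  | h1 => simp
  | hσ k hk => rw [addStrand_sigma hk, freeInc_artin_sigma hk]
  | hmul a b ha hb =>
    rw [map_mul, MulAut.mul_apply, ha, hb, map_mul]
    group
  | hinv a ha =>
    have := ha ((artin l a)⁻¹ w)
    rw [MulAut.apply_inv_self] at this
    rw [map_inv, map_inv, this]
    group

/-- The homomorphism from the semidirect product of a free group and a braid group to the braid
group with one more strand. -/
def freeBraidInc (l : ℕ) : FreeBraid l →* BraidGroup (l + 1) :=
  SemidirectProduct.lift (freeInc l) (addStrand l) fun β =>
    MonoidHom.ext fun w => freeInc_artin β w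

theorem freeBraidInc_inl {l : ℕ} (w : FreeGroup (Fin l)) :
    freeBraidInc l (SemidirectProduct.inl w) = freeInc l w :=
  SemidirectProduct.lift_inl _ _ _ _

theorem freeBraidInc_inr {l : ℕ} (β : BraidGroup l) :
    freeBraidInc l (SemidirectProduct.inr β) = addStrand l β :=
  SemidirectProduct.lift_inr _ _ _ _

theorem markAction_sigma' {l k : ℕ} (h : k < l) : markAction l (sigma k) = markGen l k :=
  braidLift_sigma _ _ _ (by omega)

theorem perm_apply_inv {X : Type*} (f : Equiv.Perm X) (x : X) : f (f⁻¹ x) = x :=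
  Equiv.apply_symm_apply f x

/-- The pair `(c, x)` stands for the braid `cosetRep l c * freeBraidInc l x`, and the action was
designed to be left multiplication on these braids. Since this reading fails beyond position `l`,
the invariance of the range up to `l` is carried through the induction. -/
theorem markAction_equivariant (l : ℕ) (β : BraidGroup (l + 1)) (x : ℕ × FreeBraid l) :
    (x.1 ≤ l ↔ (markAction l β x).1 ≤ l) ∧
      (x.1 ≤ l → cosetRep l (markAction l β x).1 * freeBraidInc l (markAction l β x).2 =
        β * (cosetRep l x.1 * freeBraidInc l x.2)) := by
  induction β using braid_induction generalizing x with
  | h1 => simp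
  | hσ k hk =>
    obtain ⟨c, x⟩ := x
    have hk : k < l := by omega
    rw [markAction_sigma' hk]
    rcases lt_or_ge c k with h | h
    · rw [markGen_of_lt h]
      refine ⟨Iff.rfl, fun hc => ?_⟩
      dsimp only
      rw [map_mul, freeBraidInc_inr, addStrand_sigma (by omega), ← mul_assoc, ← mul_assoc,
        sigma_mul_cosetRep_of_lt h hk]
    rcases Nat.eq_or_lt_of_le h with rfl | h
    · rw [markGen_self]
      refine ⟨⟨fun _ => hk, fun _ => hk.le⟩, fun _ => ?_⟩
      dsimp only
      rw [map_mul, freeBraidInc_inl, freeInc_freeVar hk, pureGen_last' hk]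
      group
    rcases Nat.eq_or_lt_of_le (Nat.succ_le_of_lt h) with rfl | h
    · rw [Nat.succ_eq_add_one, markGen_succ]
      refine ⟨⟨fun _ => hk.le, fun _ => hk⟩, fun _ => ?_⟩
      dsimp only
      rw [cosetRep_of_lt hk, mul_assoc]
    rcases le_or_gt c l with hc | hc
    · rw [markGen_of_gt h hc]
      refine ⟨Iff.rfl, fun hc => ?_⟩
      dsimp only
      rw [map_mul, freeBraidInc_inr, addStrand_sigma (by omega), ← mul_assoc, ← mul_assoc,
        sigma_mul_cosetRep_of_gt h]
    · rw [markGen_of_out h hc]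
      exact ⟨Iff.rfl, fun hc' => absurd hc' hc.not_ge⟩
  | hmul a b ha hb =>
    rw [map_mul, Equiv.Perm.mul_apply]
    refine ⟨(hb x).1.trans (ha _).1, fun hx => ?_⟩
    rw [(ha _).2 ((hb x).1.1 hx), (hb x).2 hx, mul_assoc]
  | hinv a ha =>
    have h := ha ((markAction l a)⁻¹ x)
    rw [perm_apply_inv] at h
    rw [map_inv]
    exact ⟨h.1.symm, fun hx => by rw [h.2 (h.1.2 hx), inv_mul_cancel_left]⟩

/-- The marked strand moves by the permutation of the braid; a pure braid therefore returns it to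
its place. -/
theorem markAction_fst (m l : ℕ) (β : BraidGroup (l + 1)) (x : ℕ × FreeBraid l)
    (y : Fin (l + 1)) :
    x.1 = y.val ↔ (markAction l β x).1 = ((trace m (l + 1) β).right y).val := by
  induction β using braid_induction generalizing x y with
  | h1 => simp
  | hσ k hk =>
    rw [markAction_sigma (by omega), trace_sigma m (by omega)]
    have e : (posSwap (l := l + 1) ⟨k, by omega⟩ y).val = Equiv.swap k (k + 1) y.val := by
      simp only [posSwap, Equiv.swap_apply_def, Fin.ext_iff]
      split_ifs <;> rfl
    simp only [traceGen]
    rw [e, (Equiv.injective _).eq_iff]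
  | hmul a b ha hb =>
    rw [map_mul, Equiv.Perm.mul_apply, map_mul, SemidirectProduct.mul_right,
      Equiv.Perm.mul_apply, hb, ha]
  | hinv a ha =>
    have h := ha ((markAction l a)⁻¹ x) ((trace m (l + 1) a).right⁻¹ y)
    rw [perm_apply_inv, perm_apply_inv] at h
    rw [map_inv, map_inv, SemidirectProduct.inv_right]
    exact h.symm

theorem markAction_cosetRep {l c : ℕ} (h : c ≤ l) (x : FreeBraid l) :
    markAction l (cosetRep l c) (l, x) = (c, x) := by
  rcases Nat.eq_or_lt_of_le h with rfl | h
  · rw [cosetRep_of_le le_rfl, map_one, Equiv.Perm.one_apply]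
  · rw [cosetRep_of_lt h, map_mul, Equiv.Perm.mul_apply, markAction_cosetRep (by omega),
      markAction_sigma' h, markGen_succ]
termination_by l - c

/-- A loop is `(cosetRep l (p + 1))⁻¹ * (sigma p * cosetRep l p)`. It carries the marked strand from
`l` to `p`, picks up the letter `p` on the way from `p` to `p + 1`, and brings the strand back to
`l`. -/
theorem markAction_freeInc {l : ℕ} (w : FreeGroup (Fin l)) (x : FreeBraid l) :
    markAction l (freeInc l w) (l, x) = (l, SemidirectProduct.inl w * x) := by
  have hinv (w : FreeGroup (Fin l)) (hw : ∀ x, markAction l (freeInc l w) (l, x) =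
      (l, SemidirectProduct.inl w * x)) (x) : markAction l (freeInc l w⁻¹) (l, x) =
      (l, SemidirectProduct.inl w⁻¹ * x) := by
    rw [map_inv, map_inv, Equiv.Perm.inv_eq_iff_eq, hw, map_inv, mul_inv_cancel_left]
  have hpure (i : Fin l) (x) : markAction l (freeInc l (FreeGroup.of i)) (l, x) =
      (l, SemidirectProduct.inl (FreeGroup.of i) * x) := by
    rw [← freeVar_fin, freeInc_freeVar i.2, pureGen_last' i.2, map_mul, map_mul, map_inv,
      Equiv.Perm.mul_apply, Equiv.Perm.mul_apply, markAction_cosetRep i.2.le,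
      markAction_sigma' i.2, markGen_self, Equiv.Perm.inv_eq_iff_eq, markAction_cosetRep i.2]
  induction w using FreeGroup.induction_on generalizing x with
  | C1 => simp
  | of i => exact hpure i x
  | inv_of i _ => exact hinv _ (hpure i) x
  | mul a b ha hb => rw [map_mul, map_mul, Equiv.Perm.mul_apply, hb, ha, map_mul, mul_assoc]

theorem markAction_addStrand {l : ℕ} (β : BraidGroup l) (x : FreeBraid l) :
    markAction l (addStrand l β) (l, x) = (l, SemidirectProduct.inr β * x) := by
  induction β using braid_induction generalizing x with
  | h1 => simp
  | hσ k hk => rw [addStrand_sigma hk, markAction_sigma' (by omega), markGen_of_gt hk le_rfl]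
  | hmul a b ha hb => rw [map_mul, map_mul, Equiv.Perm.mul_apply, hb, ha, map_mul, mul_assoc]
  | hinv a ha => rw [map_inv, map_inv, Equiv.Perm.inv_eq_iff_eq, ha, map_inv, mul_inv_cancel_left]

/-- The image of the base point `(l, 1)` is the product of both factors inside the semidirect
product, where they can be separated. This is where freeness of the loops comes from. -/
theorem freeInc_mul_addStrand_injective {l : ℕ} {w w' : FreeGroup (Fin l)} {β β' : BraidGroup l}
    (h : freeInc l w * addStrand l β = freeInc l w' * addStrand l β') : w = w' ∧ β = β' := by
  have key (w : FreeGroup (Fin l)) (β : BraidGroup l) :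
      markAction l (freeInc l w * addStrand l β) (l, 1) =
        (l, SemidirectProduct.inl w * SemidirectProduct.inr β) := by
    rw [map_mul, Equiv.Perm.mul_apply, markAction_addStrand, markAction_freeInc, mul_one]
  have h' : (SemidirectProduct.inl w * SemidirectProduct.inr β : FreeBraid l) =
      SemidirectProduct.inl w' * SemidirectProduct.inr β' := by
    have := key w β
    rw [h, key] at this
    exact (congrArg Prod.snd this).symm
  exact ⟨by simpa using congrArg SemidirectProduct.left h',
    by simpa using congrArg SemidirectProduct.right h'⟩

/-- A pure braid keeps the marked strand in position `l`, whose coset representative is `1`.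
Equivariance at `(l, 1)` then displays the braid as an element of the image of `FreeBraid l`. -/
theorem exists_freeInc_mul_addStrand {m l : ℕ} {γ : BraidGroup (l + 1)}
    (h : (trace m (l + 1) γ).right = 1) : ∃ w β, γ = freeInc l w * addStrand l β := by
  have h1 := (markAction_fst m l γ (l, 1) (Fin.last l)).1 rfl
  rw [h, Equiv.Perm.one_apply, Fin.val_last] at h1
  have h2 := (markAction_equivariant l γ (l, 1)).2 le_rfl
  rw [h1, cosetRep_of_le le_rfl, one_mul, one_mul, map_one, mul_one,
    ← SemidirectProduct.inl_left_mul_inr_right (markAction l γ (l, 1)).2, map_mul,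
    freeBraidInc_inl, freeBraidInc_inr] at h2
  exact ⟨_, _, h2.symm⟩

end MixedBraid

namespace MixedBraid

/-! ### The structure of mixed pure braid groups -/

/-- Adding a blue position on the right. -/
def Coloring.addBlue {m l : ℕ} (c : Coloring m l) : Coloring m (l + 1) :=
  ⟨fun x => if h : x.val < l then c.red ⟨x, h⟩ else false, by
    rw [Finset.card_filter, Fin.sum_univ_castSucc]
    simpa [← Finset.card_filter] using c.card_red⟩

theorem Coloring.addBlue_red {m l : ℕ} (c : Coloring m l) {x : ℕ} (h : x < l) :
    c.addBlue.red ⟨x, by omega⟩ = c.red ⟨x, h⟩ := dif_pos h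

theorem Coloring.addBlue_redBefore {m l : ℕ} (c : Coloring m l) (k : ℕ) :
    c.addBlue.redBefore k = c.redBefore k := by
  unfold Coloring.redBefore
  rw [Finset.card_filter, Finset.card_filter, Fin.sum_univ_castSucc]
  simp [Coloring.addBlue]

theorem Coloring.ext_red {m l : ℕ} {c d : Coloring m l} (h : c.red = d.red) : c = d := by
  cases c; cases d; cases h; rfl

theorem Coloring.addBlue_act {m l : ℕ} (c : Coloring m l) {p : Equiv.Perm (Fin l)}
    {q : Equiv.Perm (Fin (l + 1))} (h : ∀ x : Fin l, q x.castSucc = (p x).castSucc)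
    (h' : q (Fin.last l) = Fin.last l) : (c.act p).addBlue = c.addBlue.act q := by
  refine Coloring.ext_red (funext fun x => ?_)
  induction x using Fin.lastCases with
  | last => simp [Coloring.addBlue, Coloring.act, h']
  | cast x => simp [Coloring.addBlue, Coloring.act, h]

/-- The crossings of the enlarged braid stay among the first `l` positions, so the new blue strand
is never moved and changes no count of red strands. -/
theorem trace_addStrand (m : ℕ) {l : ℕ} (β : BraidGroup l) :
    (∀ x : Fin l, (trace m (l + 1) (addStrand l β)).right x.castSucc =
        ((trace m l β).right x).castSucc) ∧
      (trace m (l + 1) (addStrand l β)).right (Fin.last l) = Fin.last l ∧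
      ∀ c : Coloring m l,
        (trace m (l + 1) (addStrand l β)).left c.addBlue = (trace m l β).left c := by
  induction β using braid_induction with
  | h1 => simp
  | hσ k hk =>
    rw [addStrand_sigma hk, trace_sigma m (show k < l + 1 - 1 by omega),
      trace_sigma m (show k < l - 1 by omega)]
    refine ⟨fun x => ?_, ?_, fun c => ?_⟩
    · apply Fin.ext
      simp only [traceGen, posSwap, Equiv.swap_apply_def, Fin.ext_iff, Fin.val_castSucc]
      split_ifs <;> rfl
    · simp only [traceGen, posSwap]
      refine Equiv.swap_apply_of_ne_of_ne ?_ ?_ <;> simp [Fin.ext_iff] <;> omega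
    · simp only [traceGen, crossingTrace]
      rw [c.addBlue_redBefore, c.addBlue_red (by omega), c.addBlue_red hk]
  | hmul a b ha hb =>
    simp only [map_mul, SemidirectProduct.mul_right, SemidirectProduct.mul_left,
      Equiv.Perm.mul_apply, Pi.mul_apply, coloringAut_apply]
    refine ⟨fun x => by rw [hb.1, ha.1], by rw [hb.2.1, ha.2.1], fun c => ?_⟩
    rw [ha.2.2, ← Coloring.addBlue_act c ha.1 ha.2.1, hb.2.2]
  | hinv a ha =>
    have h1 (x : Fin l) : (trace m (l + 1) (addStrand l a)).right⁻¹ x.castSucc =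
        ((trace m l a).right⁻¹ x).castSucc := by
      rw [Equiv.Perm.inv_eq_iff_eq, ha.1, perm_apply_inv]
    have h2 : (trace m (l + 1) (addStrand l a)).right⁻¹ (Fin.last l) = Fin.last l := by
      rw [Equiv.Perm.inv_eq_iff_eq, ha.2.1]
    simp only [map_inv, SemidirectProduct.inv_right]
    refine ⟨h1, h2, fun c => ?_⟩
    change ((trace m (l + 1) (addStrand l a)).left
      (c.addBlue.act (trace m (l + 1) (addStrand l a)).right⁻¹))⁻¹ =
        ((trace m l a).left (c.act (trace m l a).right⁻¹))⁻¹
    rw [← Coloring.addBlue_act c h1 h2, ha.2.2]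

theorem stdColoring_succ (m n : ℕ) : stdColoring m (n + 1) = (stdColoring m n).addBlue := by
  refine Coloring.ext_red (funext fun x => ?_)
  induction x using Fin.lastCases with
  | last => simp [Coloring.addBlue, stdColoring]
  | cast x => simp [Coloring.addBlue, stdColoring]

theorem addStrand_mem_iff {m n : ℕ} (β : BraidGroup (m + n)) :
    addStrand (m + n) β ∈ MixedPureBraidGroup m (n + 1) ↔ β ∈ MixedPureBraidGroup m n := by
  obtain ⟨h1, h2, h3⟩ := trace_addStrand m β
  change (_ = _ ∧ _ = _) ↔ (_ = _ ∧ _ = _)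
  rw [stdColoring_succ]
  refine and_congr ⟨fun h => ?_, fun h => ?_⟩ (Eq.congr_left (h3 _))
  · refine Equiv.ext fun x => Fin.castSucc_injective _ ?_
    rw [← h1, Equiv.Perm.one_apply]
    exact DFunLike.congr_fun h _
  · refine Equiv.ext fun x => ?_
    induction x using Fin.lastCases with
    | last => exact h2
    | cast x => exact (h1 x).trans (by rw [h]; rfl)

theorem freeInc_mem (m n : ℕ) (w : FreeGroup (Fin (m + n))) :
    freeInc (m + n) w ∈ MixedPureBraidGroup m (n + 1) := by
  have h (i : Fin (m + n)) : freeInc (m + n) (FreeGroup.of i) ∈ MixedPureBraidGroup m (n + 1) := by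
    rw [← freeVar_fin, freeInc_freeVar i.2]
    exact pureGen_mem m (n + 1) _ _ i.2 (by omega) (by omega)
  induction w using FreeGroup.induction_on with
  | C1 => rw [map_one]; exact one_mem _
  | of i => exact h i
  | inv_of i _ => rw [map_inv]; exact inv_mem (h i)
  | mul a b ha hb => rw [map_mul]; exact mul_mem ha hb

/-- The inclusion of the free group of the last strand. -/
def freeHom (m n : ℕ) : FreeGroup (Fin (m + n)) →* MixedPureBraidGroup m (n + 1) :=
  (freeInc (m + n)).codRestrict _ (freeInc_mem m n)

/-- Adding a strand to a mixed pure braid. -/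
def stabHom (m n : ℕ) : MixedPureBraidGroup m n →* MixedPureBraidGroup m (n + 1) :=
  ((addStrand (m + n)).comp (Subgroup.subtype _)).codRestrict _ fun β =>
    (addStrand_mem_iff _).2 β.2

/-- The action of mixed pure braids on the free group of a further strand. -/
def mixedArtin (m n : ℕ) : MixedPureBraidGroup m n →* MulAut (FreeGroup (Fin (m + n))) :=
  (artin (m + n)).comp (Subgroup.subtype _)

theorem freeHom_mixedArtin {m n : ℕ} (g : MixedPureBraidGroup m n)
    (w : FreeGroup (Fin (m + n))) :
    freeHom m n (mixedArtin m n g w) = stabHom m n g * freeHom m n w * (stabHom m n g)⁻¹ :=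
  Subtype.ext (freeInc_artin _ _)

/-- The last strand of a mixed pure braid can be combed. -/
theorem freeHom_mul_stabHom_bijective (m n : ℕ) :
    Function.Bijective fun x : FreeGroup (Fin (m + n)) × MixedPureBraidGroup m n =>
      freeHom m n x.1 * stabHom m n x.2 := by
  constructor
  · rintro ⟨w, β⟩ ⟨w', β'⟩ h
    obtain ⟨h1, h2⟩ := freeInc_mul_addStrand_injective (congrArg Subtype.val h)
    exact Prod.ext h1 (Subtype.ext h2)
  · rintro ⟨γ, hγ⟩
    obtain ⟨w, β, rfl⟩ := exists_freeInc_mul_addStrand hγ.1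
    -- The loops are mixed pure braids themselves, so cancelling `w` leaves a mixed pure braid with
    -- an idle last strand.
    have hβ : β ∈ MixedPureBraidGroup m n :=
      (addStrand_mem_iff β).1 ((Subgroup.mul_mem_cancel_left _ (freeInc_mem m n w)).1 hγ)
    exact ⟨(w, ⟨β, hβ⟩), rfl⟩

/-- The decomposition of mixed pure braids. -/
noncomputable def combEquiv (m n : ℕ) :
    FreeGroup (Fin (m + n)) × MixedPureBraidGroup m n ≃ MixedPureBraidGroup m (n + 1) :=
  Equiv.ofBijective _ (freeHom_mul_stabHom_bijective m n)

theorem combEquiv_apply {m n : ℕ} (w : FreeGroup (Fin (m + n))) (g : MixedPureBraidGroup m n) :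
    combEquiv m n (w, g) = freeHom m n w * stabHom m n g := rfl

theorem coloring_self_red {m : ℕ} (c : Coloring m m) (x : Fin m) : c.red x = true := by
  have h : (Finset.univ.filter fun x => c.red x = true) = Finset.univ :=
    Finset.eq_univ_of_card _ (by rw [c.card_red, Fintype.card_fin])
  have hx := Finset.mem_univ x
  rw [← h] at hx
  exact (Finset.mem_filter.1 hx).2

theorem coloring_self_redBefore {m : ℕ} (c : Coloring m m) {k : ℕ} (h : k ≤ m) :
    c.redBefore k = k := by
  simp [Coloring.redBefore, coloring_self_red, Fin.card_filter_val_lt, h]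

/-- When the number of red strands equals the number of all strands, nothing is erased. -/
theorem trace_self_left {m : ℕ} (β : BraidGroup m) (c : Coloring m m) :
    (trace m m β).left c = β := by
  induction β using braid_induction generalizing c with
  | h1 => simp
  | hσ k hk =>
    rw [trace_sigma m (by omega)]
    simp [traceGen, crossingTrace, coloring_self_red,
      coloring_self_redBefore c (show k ≤ m by omega)]
  | hmul a b ha hb => simp [ha, hb]
  | hinv a ha =>
    rw [map_inv]
    exact congrArg _ (ha (c.act (trace m m a).right⁻¹))

/-- Without strands to erase, the erasing condition says that the braid itself is trivial. This
starts the induction in `closure_chordBraid`. -/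
instance (m : ℕ) : Subsingleton (MixedPureBraidGroup m 0) :=
  ⟨fun a b => by
    have h (a : MixedPureBraidGroup m 0) : a = 1 :=
      Subtype.ext ((trace_self_left a.1 (stdColoring m 0)).symm.trans a.2.2)
    rw [h a, h b]⟩

/-! ### Generators -/

/-- The pure braid that corresponds to a chord. -/
def chordBraid {m n : ℕ} : Chord m n → MixedPureBraidGroup m n
  | .a i j => alpha i j
  -- The last default never occurs, as the endpoints differ.
  | .c i j _ => if h : i < j then tau i j h else if h' : j < i then tau j i h' else 1

theorem chordBraid_c_of_lt {m n : ℕ} {i j : Fin n} (h : i < j) (h' : i ≠ j) :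
    (chordBraid (.c i j h') : MixedPureBraidGroup m n) = tau i j h := dif_pos h

theorem chordBraid_c_of_gt {m n : ℕ} {i j : Fin n} (h : j < i) (h' : i ≠ j) :
    (chordBraid (.c i j h') : MixedPureBraidGroup m n) = tau j i h := by
  rw [chordBraid, dif_neg (by omega), dif_pos h]

theorem chordBraid_symm {m n : ℕ} (i j : Fin n) (h : i ≠ j) :
    (chordBraid (.c i j h) : MixedPureBraidGroup m n) = chordBraid (.c j i h.symm) := by
  rcases lt_or_gt_of_ne h with h' | h'
  · rw [chordBraid_c_of_lt h', chordBraid_c_of_gt h']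
  · rw [chordBraid_c_of_lt h', chordBraid_c_of_gt h']

/-- Adding a strand to a chord diagram. -/
def Chord.castSucc {m n : ℕ} : Chord m n → Chord m (n + 1)
  | .a i j => .a i j.castSucc
  | .c i j h => .c i.castSucc j.castSucc (fun e => h (Fin.castSucc_injective _ e))

/-- The chord that connects the last strand to the pole or strand in position `p`. -/
def Chord.last {m n : ℕ} (p : Fin (m + n)) : Chord m (n + 1) :=
  if h : p.val < m then .a ⟨p, h⟩ (Fin.last n)
  else .c (Fin.castSucc ⟨p - m, by omega⟩) (Fin.last n) (Fin.castSucc_lt_last _).ne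

theorem Chord.last_of_lt {m n : ℕ} {p : Fin (m + n)} (h : p.val < m) :
    (Chord.last p : Chord m (n + 1)) = .a ⟨p, h⟩ (Fin.last n) := dif_pos h

theorem Chord.last_of_ge {m n : ℕ} {p : Fin (m + n)} (h : m ≤ p.val) :
    (Chord.last p : Chord m (n + 1)) =
      .c (Fin.castSucc ⟨p - m, by omega⟩) (Fin.last n) (Fin.castSucc_lt_last _).ne :=
  dif_neg h.not_gt

theorem stabHom_alpha {m n : ℕ} (i : Fin m) (j : Fin n) :
    stabHom m n (alpha i j) = alpha i j.castSucc :=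
  Subtype.ext (addStrand_pureGen (by omega) (by omega))

theorem stabHom_tau {m n : ℕ} (i j : Fin n) (h : i < j) :
    stabHom m n (tau i j h) = tau i.castSucc j.castSucc h :=
  Subtype.ext (addStrand_pureGen (Nat.add_lt_add_left h m) (by omega))

theorem stabHom_chordBraid {m n : ℕ} (x : Chord m n) :
    stabHom m n (chordBraid x) = chordBraid x.castSucc := by
  cases x with
  | a i j => exact stabHom_alpha i j
  | c i j h =>
    rcases lt_or_gt_of_ne h with h' | h'
    · rw [chordBraid_c_of_lt h', stabHom_tau]
      exact (chordBraid_c_of_lt (m := m) (i := i.castSucc) (j := j.castSucc) h' _).symm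
    · rw [chordBraid_c_of_gt h', stabHom_tau]
      exact (chordBraid_c_of_gt (m := m) (i := i.castSucc) (j := j.castSucc) h' _).symm

theorem freeHom_of {m n : ℕ} (p : Fin (m + n)) :
    freeHom m n (FreeGroup.of p) = chordBraid (Chord.last p) := by
  apply Subtype.ext
  change freeInc (m + n) (FreeGroup.of p) = _
  rw [← freeVar_fin, freeInc_freeVar p.2]
  rcases lt_or_ge p.val m with h | h
  · rw [Chord.last_of_lt h]
    rfl
  · rw [Chord.last_of_ge h, chordBraid_c_of_lt (Fin.castSucc_lt_last _)]
    change _ = pureGen (m + (n + 1)) (m + (p - m)) (m + n)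
    rw [Nat.add_sub_cancel' h]
    rfl

/-- By combing, `P_{m,n+1}` is generated by the loops of the last strand, which are the chords
ending there, and by the image of `P_{m,n}`. -/
theorem closure_chordBraid (m n : ℕ) :
    Subgroup.closure (Set.range (chordBraid (m := m) (n := n))) = ⊤ := by
  induction n with
  | zero => exact Subsingleton.elim _ _
  | succ n ih =>
    refine eq_top_iff.2 fun γ _ => ?_
    obtain ⟨⟨w, g⟩, rfl⟩ := (combEquiv m n).surjective γ
    rw [combEquiv_apply]
    refine mul_mem ?_ ?_
    · have hw : w ∈ Subgroup.closure (Set.range FreeGroup.of) := by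
        rw [FreeGroup.closure_range_of]; trivial
      have := Subgroup.mem_map_of_mem (freeHom m n) hw
      rw [MonoidHom.map_closure] at this
      refine Subgroup.closure_mono ?_ this
      rintro _ ⟨_, ⟨p, rfl⟩, rfl⟩
      exact ⟨_, (freeHom_of p).symm⟩
    · have hg : g ∈ Subgroup.closure (Set.range (chordBraid (m := m) (n := n))) := by
        rw [ih]; trivial
      have := Subgroup.mem_map_of_mem (stabHom m n) hg
      rw [MonoidHom.map_closure] at this
      refine Subgroup.closure_mono ?_ this
      rintro _ ⟨_, ⟨p, rfl⟩, rfl⟩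
      exact ⟨_, (stabHom_chordBraid p).symm⟩

/-! ### The action of pure generators on the free group -/

/-- The inverse of the variable that is linked to `p` by the pure generator with indices `r`
and `s`. -/
def linkVar (l r s p : ℕ) : FreeGroup (Fin l) :=
  if p = r then (freeVar s)⁻¹ else if p = s then (freeVar r)⁻¹ else 1

theorem pureGen_succ {l r s : ℕ} (h : r < s) :
    pureGen l r (s + 1) = (sigma s)⁻¹ * pureGen l r s * ((sigma s)⁻¹)⁻¹ := by
  obtain ⟨d, rfl⟩ : ∃ d, s = r + 1 + d := ⟨s - (r + 1), by omega⟩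
  simp only [pureGen, show r + 1 + d + 1 - (r + 1) = d + 1 by omega,
    show r + 1 + d - (r + 1) = d by omega, List.range'_1_concat, List.map_append,
    List.prod_append, List.map_cons, List.map_nil, List.prod_singleton, mul_inv_rev, mul_assoc,
    inv_inv]

/-- The inverse crossing only mixes the letters `k` and `k + 1`, both of index at least `r`.
Restricting the letters in this way later keeps the conjugators of the `τ_{ij}` free of pole
letters. -/
theorem artin_sigma_inv_mem {l k r : ℕ} (hk : k + 1 < l) (hr : r ≤ k) {u : FreeGroup (Fin l)}
    (hu : u ∈ Subgroup.closure {x | ∃ p, r ≤ p ∧ x = freeVar p}) :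
    artin l (sigma k)⁻¹ u ∈ Subgroup.closure {x | ∃ p, r ≤ p ∧ x = freeVar p} := by
  have hmem (p) (hp : r ≤ p) : (freeVar p : FreeGroup (Fin l)) ∈
      Subgroup.closure {x | ∃ p, r ≤ p ∧ x = freeVar p} := Subgroup.subset_closure ⟨p, hp, rfl⟩
  induction hu using Subgroup.closure_induction with
  | mem x hx =>
    obtain ⟨p, hp, rfl⟩ := hx
    rw [artin_sigma_inv hk, artinInvVal]
    split_ifs
    · exact hmem _ (by omega)
    · exact mul_mem (mul_mem (hmem _ (by omega)) (hmem _ (by omega))) (inv_mem (hmem _ (by omega)))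
    · exact hmem p hp
  | one => rw [map_one]; exact one_mem _
  | mul x y _ _ hx hy => rw [map_mul]; exact mul_mem hx hy
  | inv x _ hx => rw [map_inv]; exact inv_mem hx

theorem abelianization_map_congr {l : ℕ} (f : FreeGroup (Fin l) →* FreeGroup (Fin l))
    {u v : FreeGroup (Fin l)} (h : Abelianization.of u = Abelianization.of v) :
    Abelianization.of (f u) = Abelianization.of (f v) := by
  rw [← Abelianization.map_of, ← Abelianization.map_of, h]

/-- A pure generator conjugates each variable by an element whose class in the abelianization is
determined by the linking numbers. -/
theorem artin_pureGen {l r s : ℕ} (hrs : r < s) (hs : s < l) (p : ℕ) :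
    ∃ u ∈ Subgroup.closure {x : FreeGroup (Fin l) | ∃ q, r ≤ q ∧ x = freeVar q},
      artin l (pureGen l r s) (freeVar p) = u * freeVar p * u⁻¹ ∧
      Abelianization.of u = Abelianization.of (linkVar l r s p) ∧ (p < r → u = 1) := by
  have hmem (p) (hp : r ≤ p) : (freeVar p : FreeGroup (Fin l)) ∈
      Subgroup.closure {x | ∃ p, r ≤ p ∧ x = freeVar p} := Subgroup.subset_closure ⟨p, hp, rfl⟩
  obtain ⟨d, rfl⟩ : ∃ d, s = r + 1 + d := ⟨s - (r + 1), by omega⟩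
  induction d generalizing p with
  | zero =>
    have e : pureGen l r (r + 1 + 0) = sigma r * sigma r := by simp [pureGen, pow_two]
    rw [e, map_mul, MulAut.mul_apply, artin_sigma hs, add_zero]
    by_cases h1 : p = r
    · subst h1
      refine ⟨(freeVar p)⁻¹ * (freeVar (p + 1))⁻¹ * freeVar p, mul_mem (mul_mem
        (inv_mem (hmem _ le_rfl)) (inv_mem (hmem _ (by omega)))) (hmem _ le_rfl), ?_, ?_,
        fun h => absurd h (lt_irrefl _)⟩
      · simp only [artinVal_self, map_mul, map_inv, artin_sigma hs, artinVal_succ]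
        group
      · simp [linkVar, mul_comm]
    by_cases h2 : p = r + 1
    · subst h2
      refine ⟨(freeVar r)⁻¹, inv_mem (hmem _ le_rfl), ?_, ?_, fun h => by omega⟩
      · simp only [artinVal_succ, artin_sigma hs, artinVal_self, inv_inv]
      · simp [linkVar]
    · refine ⟨1, one_mem _, ?_, ?_, fun _ => rfl⟩
      · rw [artinVal_of_ne h1 h2, artin_sigma hs, artinVal_of_ne h1 h2]
        simp
      · simp [linkVar, h1, h2]
  | succ d ih =>
    rw [← add_assoc] at hs ⊢
    set t := r + 1 + d with ht
    have hrt : r < t := by omega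
    have ih (p) := ih p (by omega) (by omega)
    have e : pureGen l r (t + 1) = (sigma t)⁻¹ * pureGen l r t * sigma t := by
      rw [pureGen_succ hrt, inv_inv]
    -- The conjugators for `t + 1` arise by applying the inverse crossing to those for `t`. Only
    -- their classes are known, which is enough because an automorphism acts on the abelianization.
    have key (u : FreeGroup (Fin l)) (q : ℕ) (hu : Abelianization.of u =
        Abelianization.of (linkVar l r t q)) : Abelianization.of (artin l (sigma t)⁻¹ u) =
        Abelianization.of (artin l (sigma t)⁻¹ (linkVar l r t q)) :=
      abelianization_map_congr (artin l (sigma t)⁻¹).toMonoidHom hu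
    have hφ (q : ℕ) := artin_sigma_inv hs q
    have hφm (u) := artin_sigma_inv_mem (u := u) hs hrt.le
    rw [e]
    simp only [map_mul, MulAut.mul_apply, artin_sigma hs]
    generalize artin l (sigma t)⁻¹ = φ at *
    by_cases h1 : p = t
    · subst h1
      obtain ⟨u, hu, hu1, hu2, -⟩ := ih t
      obtain ⟨v, hv, hv1, hv2, -⟩ := ih (t + 1)
      have kv := key v _ hv2
      -- The crossing turns the letter `t` into a conjugate of the letter `t + 1`, which the inverse
      -- crossing brings back conjugated by `freeVar (t + 1)`. In the abelianization this factor
      -- cancels the image of `(freeVar t)⁻¹`, in accordance with `t` not being linked.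
      refine ⟨φ (u * (freeVar t)⁻¹ * u⁻¹ * v) * freeVar (t + 1),
        mul_mem (hφm _ (mul_mem (mul_mem (mul_mem hu
          (inv_mem (hmem _ hrt.le))) (inv_mem hu)) hv)) (hmem _ (by omega)), ?_, ?_,
        fun h => by omega⟩
      · simp only [artinVal_self, map_mul, map_inv, hu1, hv1, hφ, artinInvVal_succ,
          artinInvVal_self]
        group
      · rw [linkVar, if_neg (by omega), if_neg (by omega), map_one] at kv
        simp only [map_mul, map_inv, kv]
        rw [linkVar, if_neg (by omega), if_neg (by omega), hφ, artinInvVal_self]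
        simp
    by_cases h2 : p = t + 1
    · subst h2
      obtain ⟨u, hu, hu1, hu2, -⟩ := ih t
      refine ⟨φ u, hφm _ hu, ?_, ?_, fun h => by omega⟩
      · rw [artinVal_succ, hu1, map_mul, map_mul, map_inv, hφ, artinInvVal_self]
      · rw [key u _ hu2]
        simp only [linkVar, hrt.ne', if_true, if_false, show t + 1 ≠ r by omega]
        rw [map_inv, hφ, artinInvVal_of_ne hrt.ne (by omega)]
    · obtain ⟨u, hu, hu1, hu2, hu3⟩ := ih p
      refine ⟨φ u, hφm _ hu, ?_, ?_, fun h => by rw [hu3 h, map_one]⟩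
      · rw [artinVal_of_ne h1 h2, hu1, map_mul, map_mul, map_inv, hφ, artinInvVal_of_ne h1 h2]
      · rw [key u _ hu2]
        by_cases h3 : p = r
        · simp only [linkVar, h3, if_true]
          rw [map_inv, hφ, artinInvVal_self]
        · simp only [linkVar, h1, h2, h3, if_false, map_one]

end MixedBraid

namespace MixedBraid

/-! ### Chords and their endpoints -/

section Endpoints

variable {m n : ℕ}

/-- The first endpoint of a chord. -/
def Chord.fst : Chord m n → Fin (m + n)
  | .a i _ => Fin.castAdd n i
  | .c i _ _ => Fin.natAdd m i

/-- The second endpoint of a chord. -/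
def Chord.snd : Chord m n → Fin (m + n)
  | .a _ j => Fin.natAdd m j
  | .c _ j _ => Fin.natAdd m j

/-- The value of `f` at the endpoint of a chord that is opposite to `p`, set to `z` if `p` is not
an endpoint. -/
def Chord.link {V : Type*} (x : Chord m n) (p : Fin (m + n)) (z : V) (f : Fin (m + n) → V) : V :=
  if p = x.fst then f x.snd else if p = x.snd then f x.fst else z

theorem Chord.map_link {V W : Type*} (g : V → W) (x : Chord m n) (p : Fin (m + n)) (z : V)
    (f : Fin (m + n) → V) : g (x.link p z f) = x.link p (g z) (fun q => g (f q)) := by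
  unfold Chord.link
  split_ifs <;> rfl

theorem Chord.last_castAdd (i : Fin m) :
    (Chord.last (Fin.castAdd n i) : Chord m (n + 1)) = .a i (Fin.last n) :=
  Chord.last_of_lt (by simp)

theorem Chord.last_natAdd (i : Fin n) :
    (Chord.last (Fin.natAdd m i) : Chord m (n + 1)) =
      .c i.castSucc (Fin.last n) (Fin.castSucc_lt_last i).ne := by
  rw [Chord.last_of_ge (by simp)]
  congr 1
  exact Fin.ext (by simp)

theorem castAdd_ne_natAdd (i : Fin m) (j : Fin n) : Fin.castAdd n i ≠ Fin.natAdd m j := by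
  simp only [ne_eq, Fin.ext_iff, Fin.val_castAdd, Fin.val_natAdd]
  omega

section Link

variable {V : Type*} (z : V) (f : Fin (m + n) → V)

theorem Chord.link_fst (x : Chord m n) : x.link x.fst z f = f x.snd := if_pos rfl

theorem Chord.fst_ne_snd (x : Chord m n) : x.fst ≠ x.snd := by
  cases x with
  | a i j => exact castAdd_ne_natAdd i j
  | c i j h => exact fun e => h (Fin.natAdd_injective _ _ e)

theorem Chord.link_snd (x : Chord m n) : x.link x.snd z f = f x.fst := by
  rw [Chord.link, if_neg x.fst_ne_snd.symm, if_pos rfl]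

theorem Chord.link_of_ne {x : Chord m n} {p : Fin (m + n)} (h : p ≠ x.fst) (h' : p ≠ x.snd) :
    x.link p z f = z := by
  rw [Chord.link, if_neg h, if_neg h']

theorem Chord.link_symm (i j : Fin n) (h : i ≠ j) (p : Fin (m + n)) :
    (Chord.c i j h).link p z f = (Chord.c j i h.symm).link p z f := by
  by_cases h1 : p = (Chord.c (m := m) i j h).fst
  · subst h1
    rw [Chord.link_fst]
    exact (Chord.link_snd z f (Chord.c j i h.symm)).symm
  by_cases h2 : p = (Chord.c (m := m) i j h).snd
  · subst h2
    rw [Chord.link_snd]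
    exact (Chord.link_fst z f (Chord.c j i h.symm)).symm
  · rw [Chord.link_of_ne _ _ h1 h2, Chord.link_of_ne _ _ h2 h1]

end Link

/-! ### The action of the generators -/

/-- This is `artin_pureGen` in terms of chords. For a strand chord both encircled indices are at
least `m`, so pole letters are fixed and conjugators contain strand letters only; both facts are
needed for the powers of `J`. -/
theorem mixedArtin_chordBraid (x : Chord m n) (p : Fin (m + n)) :
    ∃ u, mixedArtin m n (chordBraid x) (FreeGroup.of p) = u * FreeGroup.of p * u⁻¹ ∧
      Abelianization.of u = Abelianization.of (x.link p 1 FreeGroup.of)⁻¹ ∧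
      (x.IsStrandChord → (p.val < m → u = 1) ∧
        u ∈ Subgroup.closure {w | ∃ q : Fin (m + n), m ≤ q.val ∧ w = FreeGroup.of q}) := by
  have hlink (x : Chord m n) : linkVar (m + n) x.fst x.snd p = (x.link p 1 FreeGroup.of)⁻¹ := by
    simp only [linkVar, Chord.link, ← freeVar_fin, Fin.ext_iff]
    split_ifs <;> simp
  have hclosure (r : ℕ) (hr : m ≤ r) :
      Subgroup.closure {w : FreeGroup (Fin (m + n)) | ∃ q, r ≤ q ∧ w = freeVar q} ≤
      Subgroup.closure {w | ∃ q : Fin (m + n), m ≤ q.val ∧ w = FreeGroup.of q} := by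
    rw [Subgroup.closure_le]
    rintro _ ⟨q, hq, rfl⟩
    by_cases h : q < m + n
    · exact Subgroup.subset_closure ⟨⟨q, h⟩, hr.trans hq, freeVar_of_lt h⟩
    -- Indices out of range give the default letter `1`.
    · rw [freeVar, dif_neg h]
      exact one_mem _
  have htau (i j : Fin n) (h : i < j) (h' : i ≠ j) :
      ∃ u, mixedArtin m n (tau i j h) (FreeGroup.of p) = u * FreeGroup.of p * u⁻¹ ∧
      Abelianization.of u = Abelianization.of ((Chord.c i j h').link p 1 FreeGroup.of)⁻¹ ∧
      (p.val < m → u = 1) ∧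
        u ∈ Subgroup.closure {w | ∃ q : Fin (m + n), m ≤ q.val ∧ w = FreeGroup.of q} := by
    obtain ⟨u, h1, h2, h3, h4⟩ := artin_pureGen (l := m + n) (r := m + i) (s := m + j)
      (Nat.add_lt_add_left h m) (by omega) p
    rw [freeVar_fin] at h2
    refine ⟨u, h2, ?_, fun hp => h4 (by omega), hclosure _ (by omega) h1⟩
    rw [← hlink]
    exact h3
  cases x with
  | a i j =>
    obtain ⟨u, h1, h2, h3, h4⟩ := artin_pureGen (l := m + n) (r := i) (s := m + j)
      (by omega) (by omega) p
    rw [freeVar_fin] at h2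
    refine ⟨u, h2, ?_, fun h => h.elim⟩
    rw [← hlink]
    exact h3
  | c i j h =>
    rcases lt_or_gt_of_ne h with h' | h'
    · obtain ⟨u, h1, h2, h3⟩ := htau i j h' h
      rw [chordBraid_c_of_lt h']
      exact ⟨u, h1, h2, fun _ => h3⟩
    · obtain ⟨u, h1, h2, h3⟩ := htau j i h' h.symm
      rw [chordBraid_c_of_gt h', Chord.link_symm]
      exact ⟨u, h1, h2, fun _ => h3⟩

/-- The automorphisms of a free group that send each generator to a conjugate of it. -/
def basisConjugating (X : Type*) : Subgroup (MulAut (FreeGroup X)) where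
  carrier := {φ | ∀ p, ∃ u, φ (FreeGroup.of p) = u * FreeGroup.of p * u⁻¹}
  one_mem' p := ⟨1, by simp⟩
  mul_mem' := by
    intro φ ψ hφ hψ p
    obtain ⟨u, hu⟩ := hψ p
    obtain ⟨v, hv⟩ := hφ p
    refine ⟨φ u * v, ?_⟩
    rw [MulAut.mul_apply, hu, map_mul, map_mul, map_inv, hv]
    group
  inv_mem' := by
    intro φ hφ p
    obtain ⟨u, hu⟩ := hφ p
    refine ⟨φ⁻¹ u⁻¹, ?_⟩
    apply φ.injective
    rw [MulAut.apply_inv_self, map_mul, map_mul, map_inv φ, MulAut.apply_inv_self, hu]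
    group

theorem mixedArtin_mem_basisConjugating (g : MixedPureBraidGroup m n) :
    mixedArtin m n g ∈ basisConjugating (Fin (m + n)) := by
  have h : Subgroup.closure (Set.range (chordBraid (m := m) (n := n))) ≤
      (basisConjugating (Fin (m + n))).comap (mixedArtin m n) := by
    rw [Subgroup.closure_le]
    rintro _ ⟨x, rfl⟩ p
    obtain ⟨u, hu, -⟩ := mixedArtin_chordBraid x p
    exact ⟨u, hu⟩
  rw [closure_chordBraid] at h
  exact h (Subgroup.mem_top g)

end Endpoints

/-! ### The relations of the chord algebra, one strand at a time -/

section Relations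

variable {m n : ℕ} {A : Type*} [Ring A]

theorem lie_eq_zero_iff_commute {x y : A} : ⁅x, y⁆ = 0 ↔ Commute x y := by
  rw [Ring.lie_def, sub_eq_zero]
  rfl

/-- The three brackets belonging to a triangle of chords sum to zero, so two of its 4T relations
imply the third. -/
theorem commute_add_of_commute_add {x y z : A} (h1 : Commute (x + z) y) (h2 : Commute (x + y) z) :
    Commute (y + z) x := by
  have h1 := sub_eq_zero.2 h1.eq
  have h2 := sub_eq_zero.2 h2.eq
  refine sub_eq_zero.1 ?_
  calc (y + z) * x - x * (y + z) =
      -(((x + z) * y - y * (x + z)) + ((x + y) * z - z * (x + y))) := by noncomm_ring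
    _ = 0 := by rw [h1, h2, add_zero, neg_zero]

theorem SatisfiesDK.comp_castSucc {v : Chord m (n + 1) → A} (hv : SatisfiesDK v) :
    SatisfiesDK fun x : Chord m n => v x.castSucc where
  symm _ _ _ := hv.symm _ _ _
  comm_aa _ _ _ _ h1 h2 := hv.comm_aa _ _ _ _ h1 (by simpa using h2)
  comm_ac _ _ _ _ h1 h2 _ := hv.comm_ac _ _ _ _ (by simpa using h1) (by simpa using h2) _
  comm_cc _ _ _ _ _ h2 h3 h4 h5 _ := hv.comm_cc _ _ _ _ _ (by simpa using h2)
    (by simpa using h3) (by simpa using h4) (by simpa using h5) _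
  fourT_a _ _ _ _ := hv.fourT_a _ _ _ _
  fourT_c _ _ _ _ := hv.fourT_c _ _ _ _
  fourT_ccc _ _ _ _ _ _ := hv.fourT_ccc _ _ _ _ _ _

/-- The 4T and commutation relations between an old chord and a chord at the last strand merge into
one formula: the correction is the last-strand chord at the opposite endpoint of `x`, and it is zero
when the chords are disjoint. In this form they match the action of braids on the letters of the
free group. -/
theorem SatisfiesDK.commute_last {v : Chord m (n + 1) → A} (hv : SatisfiesDK v) (x : Chord m n)
    (p : Fin (m + n)) :
    Commute (v x.castSucc + x.link p 0 fun q => v (Chord.last q)) (v (Chord.last p)) := by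
  by_cases h1 : p = x.fst
  · subst h1
    rw [Chord.link_fst]
    cases x with
    | a i j =>
      simp only [Chord.fst, Chord.snd, Chord.last_castAdd, Chord.last_natAdd]
      exact lie_eq_zero_iff_commute.1 (hv.fourT_a _ _ _ _)
    | c i j h =>
      simp only [Chord.fst, Chord.snd, Chord.last_natAdd]
      exact lie_eq_zero_iff_commute.1 (hv.fourT_ccc _ _ _ _ _ _)
  by_cases h2 : p = x.snd
  · subst h2
    rw [Chord.link_snd]
    cases x with
    | a i j =>
      simp only [Chord.fst, Chord.snd, Chord.last_castAdd, Chord.last_natAdd]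
      exact lie_eq_zero_iff_commute.1 (hv.fourT_c _ _ _ _)
    | c i j h =>
      simp only [Chord.fst, Chord.snd, Chord.last_natAdd, Chord.castSucc]
      rw [hv.symm]
      exact lie_eq_zero_iff_commute.1 (hv.fourT_ccc _ _ _ _ _ _)
  rw [Chord.link_of_ne _ _ h1 h2, add_zero]
  refine lie_eq_zero_iff_commute.1 ?_
  induction p using Fin.addCases with
  | left k =>
    rw [Chord.last_castAdd]
    cases x with
    | a i j =>
      exact hv.comm_aa _ _ _ _ (fun e => h1 (by rw [e]; rfl)) (Fin.castSucc_lt_last _).ne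
    | c i j h =>
      have := hv.comm_ac k (Fin.last n) i.castSucc j.castSucc (Fin.castSucc_lt_last _).ne'
        (Fin.castSucc_lt_last _).ne' (by simpa using h)
      exact lie_eq_zero_iff_commute.2 (lie_eq_zero_iff_commute.1 this).symm
  | right k =>
    rw [Chord.last_natAdd]
    cases x with
    | a i j =>
      exact hv.comm_ac _ _ _ _ (fun e => h2 (by rw [← Fin.castSucc_injective _ e]; rfl))
        (Fin.castSucc_lt_last _).ne _
    | c i j h =>
      exact hv.comm_cc _ _ _ _ _ (fun e => h1 (by rw [← Fin.castSucc_injective _ e]; rfl))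
        (Fin.castSucc_lt_last _).ne (fun e => h2 (by rw [← Fin.castSucc_injective _ e]; rfl))
        (Fin.castSucc_lt_last _).ne _

/-- A converse to `SatisfiesDK.comp_castSucc` and `SatisfiesDK.commute_last`: beyond symmetry and
the old relations, only brackets of an old chord with a last-strand chord have to be checked.
Relations in which the last strand plays another role follow by symmetry and
`commute_add_of_commute_add`. -/
theorem satisfiesDK_succ {v : Chord m (n + 1) → A}
    (hsymm : ∀ i j h, v (.c i j h) = v (.c j i h.symm))
    (hv : SatisfiesDK fun x : Chord m n => v x.castSucc)
    (hlast : ∀ (x : Chord m n) (p : Fin (m + n)),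
      Commute (v x.castSucc + x.link p 0 fun q => v (Chord.last q)) (v (Chord.last p))) :
    SatisfiesDK v := by
  have aa (i k : Fin m) (j : Fin n) (h : i ≠ k) :
      Commute (v (.a i j.castSucc)) (v (.a k (Fin.last n))) := by
    have := hlast (.a i j) (Fin.castAdd n k)
    rwa [Chord.link_of_ne _ _ (fun e => h (Fin.castAdd_injective _ _ e).symm)
      (castAdd_ne_natAdd _ _), add_zero, Chord.last_castAdd] at this
  have ac (i : Fin m) (j k : Fin n) (h : j ≠ k) :
      Commute (v (.a i j.castSucc)) (v (.c k.castSucc (Fin.last n) (Fin.castSucc_lt_last _).ne)) := by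
    have := hlast (.a i j) (Fin.natAdd m k)
    rwa [Chord.link_of_ne _ _ (castAdd_ne_natAdd _ _).symm
      (fun e => h (Fin.natAdd_injective _ _ e).symm), add_zero, Chord.last_natAdd] at this
  have ca (i j : Fin n) (h : i ≠ j) (k : Fin m) :
      Commute (v (.c i.castSucc j.castSucc (by simpa using h))) (v (.a k (Fin.last n))) := by
    have := hlast (.c i j h) (Fin.castAdd n k)
    rwa [Chord.link_of_ne _ _ (castAdd_ne_natAdd _ _) (castAdd_ne_natAdd _ _), add_zero,
      Chord.last_castAdd] at this
  have cc (i j k : Fin n) (h : i ≠ j) (h1 : i ≠ k) (h2 : j ≠ k) :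
      Commute (v (.c i.castSucc j.castSucc (by simpa using h)))
        (v (.c k.castSucc (Fin.last n) (Fin.castSucc_lt_last _).ne)) := by
    have := hlast (.c i j h) (Fin.natAdd m k)
    rwa [Chord.link_of_ne _ _ (fun e => h1 (Fin.natAdd_injective _ _ e).symm)
      (fun e => h2 (Fin.natAdd_injective _ _ e).symm), add_zero, Chord.last_natAdd] at this
  have ta (i : Fin m) (j : Fin n) := hlast (.a i j) (Fin.castAdd n i)
  have tc (i : Fin m) (j : Fin n) := hlast (.a i j) (Fin.natAdd m j)
  have tcc (i j : Fin n) (h : i ≠ j) := hlast (.c i j h) (Fin.natAdd m i)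
  have tcc' (i j : Fin n) (h : i ≠ j) := hlast (.c i j h) (Fin.natAdd m j)
  have la (i : Fin m) (j : Fin n) (f : Fin (m + n) → A) :
      (Chord.a i j).link (Fin.castAdd n i) 0 f = f (Fin.natAdd m j) := Chord.link_fst _ _ _
  have lc (i : Fin m) (j : Fin n) (f : Fin (m + n) → A) :
      (Chord.a i j).link (Fin.natAdd m j) 0 f = f (Fin.castAdd n i) := Chord.link_snd _ _ _
  have lcc (i j : Fin n) (h : i ≠ j) (f : Fin (m + n) → A) :
      (Chord.c i j h).link (Fin.natAdd m i) 0 f = f (Fin.natAdd m j) := Chord.link_fst _ _ _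
  have lcc' (i j : Fin n) (h : i ≠ j) (f : Fin (m + n) → A) :
      (Chord.c i j h).link (Fin.natAdd m j) 0 f = f (Fin.natAdd m i) := Chord.link_snd _ _ _
  simp only [la, lc, lcc, lcc', Chord.last_castAdd, Chord.last_natAdd] at ta tc tcc tcc'
  constructor
  · exact hsymm
  · intro i k j l hik hjl
    rw [lie_eq_zero_iff_commute]
    induction j using Fin.lastCases with
    | last =>
      induction l using Fin.lastCases with
      | last => exact absurd rfl hjl
      | cast l => exact (aa k i l hik.symm).symm
    | cast j =>
      induction l using Fin.lastCases with
      | last => exact aa i k j hik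
      | cast l => exact lie_eq_zero_iff_commute.1 (hv.comm_aa i k j l hik (by simpa using hjl))
  · intro i j k l hjk hjl hkl
    rw [lie_eq_zero_iff_commute]
    induction j using Fin.lastCases with
    | last =>
      induction k using Fin.lastCases with
      | last => exact absurd rfl hjk
      | cast k =>
        induction l using Fin.lastCases with
        | last => exact absurd rfl hjl
        | cast l => exact (ca k l (by simpa using hkl) i).symm
    | cast j =>
      induction k using Fin.lastCases with
      | last =>
        induction l using Fin.lastCases with
        | last => exact absurd rfl hkl
        | cast l => rw [hsymm]; exact ac i j l (by simpa using hjl)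
      | cast k =>
        induction l using Fin.lastCases with
        | last => exact ac i j k (by simpa using hjk)
        | cast l =>
          exact lie_eq_zero_iff_commute.1 (hv.comm_ac i j k l (by simpa using hjk)
            (by simpa using hjl) (by simpa using hkl))
  · intro i j k l hij hik hil hjk hjl hkl
    rw [lie_eq_zero_iff_commute]
    induction l using Fin.lastCases with
    | last =>
      obtain ⟨i, rfl⟩ := Fin.exists_castSucc_eq.2 hil
      obtain ⟨j, rfl⟩ := Fin.exists_castSucc_eq.2 hjl
      obtain ⟨k, rfl⟩ := Fin.exists_castSucc_eq.2 hkl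
      exact cc i j k (by simpa using hij) (by simpa using hik) (by simpa using hjk)
    | cast l =>
      induction k using Fin.lastCases with
      | last =>
        obtain ⟨i, rfl⟩ := Fin.exists_castSucc_eq.2 hik
        obtain ⟨j, rfl⟩ := Fin.exists_castSucc_eq.2 hjk
        rw [hsymm (Fin.last n)]
        exact cc i j l (by simpa using hij) (by simpa using hil) (by simpa using hjl)
      | cast k =>
        induction j using Fin.lastCases with
        | last =>
          obtain ⟨i, rfl⟩ := Fin.exists_castSucc_eq.2 hij
          exact (cc k l i (by simpa using hkl) (by simpa using hik.symm)
            (by simpa using hil.symm)).symm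
        | cast j =>
          induction i using Fin.lastCases with
          | last =>
            rw [hsymm (Fin.last n)]
            exact (cc k l j (by simpa using hkl) (by simpa using hjk.symm)
              (by simpa using hjl.symm)).symm
          | cast i =>
            exact lie_eq_zero_iff_commute.1 (hv.comm_cc i j k l (by simpa using hij)
              (by simpa using hik) (by simpa using hil) (by simpa using hjk) (by simpa using hjl)
              (by simpa using hkl))
  · intro i j k hjk
    rw [lie_eq_zero_iff_commute]
    induction k using Fin.lastCases with
    | last =>
      obtain ⟨j, rfl⟩ := Fin.exists_castSucc_eq.2 hjk
      exact ta i j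
    | cast k =>
      induction j using Fin.lastCases with
      | last =>
        rw [hsymm (Fin.last n)]
        exact commute_add_of_commute_add (ta i k) (tc i k)
      | cast j => exact lie_eq_zero_iff_commute.1 (hv.fourT_a i j k (by simpa using hjk))
  · intro i j k hjk
    rw [lie_eq_zero_iff_commute]
    induction k using Fin.lastCases with
    | last =>
      obtain ⟨j, rfl⟩ := Fin.exists_castSucc_eq.2 hjk
      exact tc i j
    | cast k =>
      induction j using Fin.lastCases with
      | last =>
        rw [hsymm (Fin.last n), add_comm]
        exact tc i k
      | cast j => exact lie_eq_zero_iff_commute.1 (hv.fourT_c i j k (by simpa using hjk))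
  · intro i j k hij hjk hik
    rw [lie_eq_zero_iff_commute]
    induction k using Fin.lastCases with
    | last =>
      obtain ⟨i, rfl⟩ := Fin.exists_castSucc_eq.2 hik
      obtain ⟨j, rfl⟩ := Fin.exists_castSucc_eq.2 hjk
      exact tcc i j (by simpa using hij)
    | cast k =>
      induction j using Fin.lastCases with
      | last =>
        obtain ⟨i, rfl⟩ := Fin.exists_castSucc_eq.2 hij
        rw [hsymm (Fin.last n)]
        exact commute_add_of_commute_add (tcc i k (by simpa using hik))
          (tcc' i k (by simpa using hik))
      | cast j =>
        induction i using Fin.lastCases with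
        | last =>
          rw [hsymm (Fin.last n), hsymm (Fin.last n), add_comm]
          exact tcc' j k (by simpa using hjk)
        | cast i =>
          exact lie_eq_zero_iff_commute.1 (hv.fourT_ccc i j k (by simpa using hij)
            (by simpa using hjk) (by simpa using hik))

end Relations

end MixedBraid

namespace MixedBraid

/-! ### Ideals of group algebras generated by differences -/

section Pow

variable {A B : Type*} [Ring A] [Ring B]

theorem pow_succ_induction {I : Ideal A} [I.IsTwoSided] {k : ℕ} {p : A → Prop}
    (hadd : ∀ x y, p x → p y → p (x + y))
    (hmul : ∀ x ∈ I, ∀ y ∈ I ^ k, p (x * y)) {z : A} (hz : z ∈ I ^ (k + 1)) : p z := by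
  rw [Ideal.IsTwoSided.pow_succ] at hz
  exact Submodule.mul_induction_on hz hmul hadd

/-- The target filtration need not consist of powers of an ideal, so that the order of power series
is covered too. -/
theorem map_pow_mem {I : Ideal A} [I.IsTwoSided] {W : ℕ → AddSubmonoid B}
    (hW : ∀ i j x y, x ∈ W i → y ∈ W j → x * y ∈ W (i + j)) (f : A →+* B)
    (h0 : ∀ a, f a ∈ W 0) (h1 : ∀ a ∈ I, f a ∈ W 1) (k : ℕ) {a : A} (ha : a ∈ I ^ k) :
    f a ∈ W k := by
  induction k generalizing a with
  | zero => exact h0 a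
  | succ k ih =>
    refine pow_succ_induction (p := fun a => f a ∈ W (k + 1)) ?_ ?_ ha
    · intro x y hx hy
      rw [map_add]
      exact add_mem hx hy
    · intro x hx y hy
      rw [map_mul, add_comm]
      exact hW _ _ _ _ (h1 x hx) (ih hy)

theorem map_mem_pow {I : Ideal A} [I.IsTwoSided] {J : Ideal B} [J.IsTwoSided] (f : A →+* B)
    (h : ∀ a ∈ I, f a ∈ J) (k : ℕ) {a : A} (ha : a ∈ I ^ k) : f a ∈ J ^ k :=
  map_pow_mem (W := fun k => (J ^ k).toAddSubmonoid)
    (fun _ _ _ _ hx hy => mul_mem_pow_add hx hy) f (fun _ => mem_pow_zero _)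
    (fun a ha => by
      have := h a ha
      rw [← Submodule.pow_one J] at this
      exact this) k ha

theorem mem_pow_one {I : Ideal A} {x : A} : x ∈ I ^ 1 ↔ x ∈ I := by rw [Submodule.pow_one]

end Pow

section GroupIdeal

variable {G H : Type*} [Group G] [Group H]

/-- The two-sided ideal of the group algebra generated by the elements `s - 1`, `s ∈ S`. -/
noncomputable def groupIdeal (S : Set G) : Ideal (MonoidAlgebra ℚ G) :=
  (TwoSidedIdeal.span {y | ∃ s ∈ S, y = MonoidAlgebra.of ℚ G s - 1}).asIdeal

instance (S : Set G) : (groupIdeal S).IsTwoSided :=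
  inferInstanceAs (TwoSidedIdeal.asIdeal _).IsTwoSided

theorem sub_one_mem_groupIdeal {S : Set G} {s : G} (h : s ∈ S) :
    MonoidAlgebra.of ℚ G s - 1 ∈ groupIdeal S :=
  TwoSidedIdeal.mem_asIdeal.2 (TwoSidedIdeal.subset_span ⟨s, h, rfl⟩)

theorem groupIdeal_le {S : Set G} {K : Ideal (MonoidAlgebra ℚ G)} [K.IsTwoSided]
    (h : ∀ s ∈ S, MonoidAlgebra.of ℚ G s - 1 ∈ K) : groupIdeal S ≤ K := by
  intro x hx
  rw [groupIdeal, TwoSidedIdeal.mem_asIdeal] at hx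
  have : x ∈ K.toTwoSided := by
    refine (TwoSidedIdeal.span_le (I := K.toTwoSided)).2 ?_ hx
    rintro _ ⟨s, hs, rfl⟩
    exact Ideal.mem_toTwoSided.2 (h s hs)
  exact Ideal.mem_toTwoSided.1 this

theorem map_groupIdeal_mem {B : Type*} [Ring B] {S : Set G} {K : Ideal B} [K.IsTwoSided]
    (f : MonoidAlgebra ℚ G →+* B) (h : ∀ s ∈ S, f (MonoidAlgebra.of ℚ G s) - 1 ∈ K)
    {a : MonoidAlgebra ℚ G} (ha : a ∈ groupIdeal S) : f a ∈ K := by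
  have : (K.comap f).IsTwoSided := ⟨fun b {a} ha => by
    rw [Ideal.mem_comap, map_mul]
    exact Ideal.mul_mem_right _ _ ha⟩
  refine groupIdeal_le (K := K.comap f) (fun s hs => ?_) ha
  rw [Ideal.mem_comap, map_sub, map_one]
  exact h s hs

/-- The group elements that are congruent to `1` modulo a two-sided ideal. -/
noncomputable def congruenceSubgroup (K : Ideal (MonoidAlgebra ℚ G)) [K.IsTwoSided] : Subgroup G where
  carrier := {g | MonoidAlgebra.of ℚ G g - 1 ∈ K}
  one_mem' := by
    change _ ∈ K
    rw [map_one, sub_self]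
    exact zero_mem _
  mul_mem' := by
    intro a b ha hb
    have e : MonoidAlgebra.of ℚ G (a * b) - 1 = (MonoidAlgebra.of ℚ G a - 1) *
        MonoidAlgebra.of ℚ G b + (MonoidAlgebra.of ℚ G b - 1) := by
      rw [map_mul]; noncomm_ring
    change _ ∈ K
    rw [e]
    exact add_mem (Ideal.mul_mem_right _ _ ha) hb
  inv_mem' := by
    intro a ha
    have e : MonoidAlgebra.of ℚ G a⁻¹ - 1 = -(MonoidAlgebra.of ℚ G a⁻¹ *
        (MonoidAlgebra.of ℚ G a - 1)) := by
      rw [mul_sub, ← map_mul, inv_mul_cancel, map_one]; noncomm_ring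
    change _ ∈ K
    rw [e]
    exact neg_mem (Ideal.mul_mem_left _ _ ha)

theorem mem_congruenceSubgroup {K : Ideal (MonoidAlgebra ℚ G)} [K.IsTwoSided] {g : G} :
    g ∈ congruenceSubgroup K ↔ MonoidAlgebra.of ℚ G g - 1 ∈ K := Iff.rfl

theorem augmentation_of (g : G) : augmentation G (MonoidAlgebra.of ℚ G g) = 1 := by
  simp [augmentation]

/-- Modulo the ideal of a generating set every group element becomes `1`, so every element of the
group algebra becomes its augmentation. -/
theorem sub_algebraMap_augmentation_mem {S : Set G} (hS : Subgroup.closure S = ⊤)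
    (z : MonoidAlgebra ℚ G) : z - algebraMap ℚ _ (augmentation G z) ∈ groupIdeal S := by
  have hg (g : G) : MonoidAlgebra.of ℚ G g - 1 ∈ groupIdeal S := by
    have : Subgroup.closure S ≤ congruenceSubgroup (groupIdeal S) := by
      rw [Subgroup.closure_le]
      exact fun s hs => sub_one_mem_groupIdeal hs
    rw [hS] at this
    exact this (Subgroup.mem_top g)
  induction z using MonoidAlgebra.induction_on with
  | of g => rw [augmentation_of, map_one]; exact hg g
  | add x y hx hy =>
    have := add_mem hx hy
    convert this using 1
    rw [map_add, map_add]; abel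
  | smul r x hx =>
    have := (groupIdeal S).mul_mem_left (algebraMap ℚ _ r) hx
    convert this using 1
    rw [map_smul, smul_eq_mul, map_mul, mul_sub, Algebra.smul_def]

theorem augmentationIdeal_eq_groupIdeal {S : Set G} (hS : Subgroup.closure S = ⊤) :
    augmentationIdeal G = groupIdeal S := by
  refine le_antisymm (fun z hz => ?_) (groupIdeal_le fun s _ => ?_)
  · have := sub_algebraMap_augmentation_mem hS z
    rw [show augmentation G z = 0 from hz, map_zero, sub_zero] at this
    exact this
  · exact mem_pow_one.1 (of_sub_one_mem s)

/-- For a generating set `S`, the powers of the augmentation ideal are spanned by products whose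
first factor is of the form `s - 1`. -/
theorem augmentation_pow_induction {S : Set G} (hS : Subgroup.closure S = ⊤) {k : ℕ}
    {p : MonoidAlgebra ℚ G → Prop} (h0 : p 0) (hadd : ∀ x y, p x → p y → p (x + y))
    (hneg : ∀ x, p x → p (-x))
    (hmul : ∀ s ∈ S, ∀ y ∈ augmentationIdeal G ^ k, p ((MonoidAlgebra.of ℚ G s - 1) * y))
    {z : MonoidAlgebra ℚ G} (hz : z ∈ augmentationIdeal G ^ (k + 1)) : p z := by
  -- The quantifier over `y` makes the property multiplicative in `g`: in the rule for `g - 1` on a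
  -- product, `y` is replaced by a translate, which is again in the power of the ideal.
  have hg (g : G) : ∀ y ∈ augmentationIdeal G ^ k, p ((MonoidAlgebra.of ℚ G g - 1) * y) := by
    have hg : g ∈ Subgroup.closure S := by rw [hS]; trivial
    induction hg using Subgroup.closure_induction with
    | mem x hx => exact hmul x hx
    | one => intro y _; rw [map_one, sub_self, zero_mul]; exact h0
    | mul a b _ _ ha hb =>
      intro y hy
      have e : (MonoidAlgebra.of ℚ G (a * b) - 1) * y = (MonoidAlgebra.of ℚ G a - 1) *
          (MonoidAlgebra.of ℚ G b * y) + (MonoidAlgebra.of ℚ G b - 1) * y := by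
        rw [map_mul]; noncomm_ring
      rw [e]
      exact hadd _ _ (ha _ (Ideal.mul_mem_left _ _ hy)) (hb _ hy)
    | inv a _ ha =>
      intro y hy
      have e : (MonoidAlgebra.of ℚ G a⁻¹ - 1) * y = -((MonoidAlgebra.of ℚ G a - 1) *
          (MonoidAlgebra.of ℚ G a⁻¹ * y)) := by
        rw [sub_mul, sub_mul, ← mul_assoc, ← map_mul, mul_inv_cancel, map_one]; noncomm_ring
      rw [e]
      exact hneg _ (ha _ (Ideal.mul_mem_left _ _ hy))
  refine pow_succ_induction hadd (fun x hx y hy => ?_) hz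
  -- The right-hand side is linear in `x` and makes sense outside the ideal, so induction over the
  -- group algebra applies without the hypothesis that `x` has augmentation zero.
  have e : x = x - algebraMap ℚ _ (augmentation G x) := by
    rw [show augmentation G x = 0 from hx, map_zero, sub_zero]
  rw [e]
  clear hx e
  induction x using MonoidAlgebra.induction_on generalizing y with
  | of g => rw [augmentation_of, map_one]; exact hg g y hy
  | add a b ha hb =>
    have := hadd _ _ (ha y hy) (hb y hy)
    convert this using 1
    rw [map_add, map_add]; noncomm_ring
  | smul r a ha =>
    have := ha (algebraMap ℚ _ r * y) (Ideal.mul_mem_left _ _ hy)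
    convert this using 1
    rw [map_smul, smul_eq_mul, map_mul, Algebra.smul_def, ← mul_sub, Algebra.commutes, mul_assoc]

/-- The homomorphism of group algebras that is induced by a homomorphism of groups. -/
noncomputable def groupAlgebraMap (f : G →* H) : MonoidAlgebra ℚ G →ₐ[ℚ] MonoidAlgebra ℚ H :=
  MonoidAlgebra.lift ℚ _ G ((MonoidAlgebra.of ℚ H).comp f)

theorem groupAlgebraMap_of (f : G →* H) (g : G) :
    groupAlgebraMap f (MonoidAlgebra.of ℚ G g) = MonoidAlgebra.of ℚ H (f g) := by
  rw [groupAlgebraMap, MonoidAlgebra.lift_of]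
  rfl

theorem groupAlgebra_hom_ext {B : Type*} [Ring B] [Algebra ℚ B]
    {f g : MonoidAlgebra ℚ G →ₐ[ℚ] B}
    (h : ∀ x, f (MonoidAlgebra.of ℚ G x) = g (MonoidAlgebra.of ℚ G x)) : f = g :=
  AlgHom.ext fun z => by
    induction z using MonoidAlgebra.induction_on with
    | of x => exact h x
    | add x y hx hy => rw [map_add, map_add, hx, hy]
    | smul r x hx => rw [map_smul, map_smul, hx]

open scoped commutatorElement in
/-- Elements with the same class in the abelianization agree modulo the square of the augmentation
ideal. -/
theorem of_sub_of_mem_sq {u v : G} (h : Abelianization.of u = Abelianization.of v) :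
    MonoidAlgebra.of ℚ G u - MonoidAlgebra.of ℚ G v ∈ augmentationIdeal G ^ 2 := by
  have hcomm : commutator G ≤ congruenceSubgroup (augmentationIdeal G ^ 2) := by
    rw [commutator_def, Subgroup.commutator_le]
    intro a _ b _
    rw [mem_congruenceSubgroup]
    have e : MonoidAlgebra.of ℚ G ⁅a, b⁆ - 1 =
        ((MonoidAlgebra.of ℚ G a - 1) * (MonoidAlgebra.of ℚ G b - 1) -
          (MonoidAlgebra.of ℚ G b - 1) * (MonoidAlgebra.of ℚ G a - 1)) *
            MonoidAlgebra.of ℚ G (a⁻¹ * b⁻¹) := by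
      have e1 : (MonoidAlgebra.of ℚ G a - 1) * (MonoidAlgebra.of ℚ G b - 1) -
          (MonoidAlgebra.of ℚ G b - 1) * (MonoidAlgebra.of ℚ G a - 1) =
          MonoidAlgebra.of ℚ G (a * b) - MonoidAlgebra.of ℚ G (b * a) := by
        rw [map_mul, map_mul]; noncomm_ring
      rw [e1, sub_mul, ← map_mul, ← map_mul, commutatorElement_def,
        show a * b * a⁻¹ * b⁻¹ = a * b * (a⁻¹ * b⁻¹) by group,
        show b * a * (a⁻¹ * b⁻¹) = 1 by group, map_one]
    rw [e]
    refine Ideal.mul_mem_right _ _ (sub_mem ?_ ?_)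
    · exact mul_mem_pow_add (i := 1) (j := 1) (of_sub_one_mem a) (of_sub_one_mem b)
    · exact mul_mem_pow_add (i := 1) (j := 1) (of_sub_one_mem b) (of_sub_one_mem a)
  have h1 : u * v⁻¹ ∈ commutator G := by
    rw [← Abelianization.ker_of, MonoidHom.mem_ker, map_mul, map_inv, h, mul_inv_cancel]
  have h2 := Ideal.mul_mem_right (MonoidAlgebra.of ℚ G v) _ (mem_congruenceSubgroup.1 (hcomm h1))
  rwa [sub_mul, ← map_mul, inv_mul_cancel_right, one_mul] at h2

end GroupIdeal

/-! ### Filtrations of group algebras of semidirect products -/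

section Comb

variable {F G Γ : Type*} [Group F] [Group G] [Group Γ]

/-- An automorphism of a group, as an automorphism of the group algebra. -/
noncomputable def autMap (φ : MulAut F) : MonoidAlgebra ℚ F →ₐ[ℚ] MonoidAlgebra ℚ F :=
  groupAlgebraMap φ.toMonoidHom

theorem autMap_of (φ : MulAut F) (w : F) :
    autMap φ (MonoidAlgebra.of ℚ F w) = MonoidAlgebra.of ℚ F (φ w) :=
  groupAlgebraMap_of _ _

/-- An endomorphism that moves the group elements and the elements `s - 1` up in the filtration by
powers of an ideal moves all elements up in this filtration. -/
theorem sub_mem_pow_succ {S : Set F} (f : MonoidAlgebra ℚ F →ₐ[ℚ] MonoidAlgebra ℚ F)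
    (h0 : ∀ z, f z - z ∈ groupIdeal S)
    (h1 : ∀ s ∈ S, f (MonoidAlgebra.of ℚ F s) - MonoidAlgebra.of ℚ F s ∈ groupIdeal S ^ 2)
    (k : ℕ) {z : MonoidAlgebra ℚ F} (hz : z ∈ groupIdeal S ^ k) :
    f z - z ∈ groupIdeal S ^ (k + 1) := by
  have hstab {z} (hz : z ∈ groupIdeal S) : f z ∈ groupIdeal S := by
    have := add_mem (h0 z) hz
    rwa [sub_add_cancel] at this
  have hone {z} (hz : z ∈ groupIdeal S) : f z - z ∈ groupIdeal S ^ 2 := by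
    -- Elements of the ideal that `f` moves by an element of its square. They form a two-sided ideal
    -- because `f - id` is a twisted derivation, so it suffices to look at the elements `s - 1`.
    let K : Ideal (MonoidAlgebra ℚ F) :=
      { carrier := {z | z ∈ groupIdeal S ∧ f z - z ∈ groupIdeal S ^ 2}
        add_mem' := by
          rintro a b ⟨ha, ha'⟩ ⟨hb, hb'⟩
          refine ⟨add_mem ha hb, ?_⟩
          rw [map_add, add_sub_add_comm]
          exact add_mem ha' hb'
        zero_mem' := by simp
        smul_mem' := by
          rintro c a ⟨ha, ha'⟩
          refine ⟨Ideal.mul_mem_left _ _ ha, ?_⟩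
          have e : f (c * a) - c * a = (f c - c) * f a + c * (f a - a) := by
            rw [map_mul]; noncomm_ring
          rw [smul_eq_mul, e]
          refine add_mem ?_ (Ideal.mul_mem_left _ _ ha')
          exact mul_mem_pow_add (i := 1) (j := 1) (mem_pow_one.2 (h0 c)) (mem_pow_one.2 (hstab ha)) }
    have : K.IsTwoSided := ⟨by
      rintro a c ⟨ha, ha'⟩
      refine ⟨Ideal.mul_mem_right _ _ ha, ?_⟩
      have e : f (a * c) - a * c = f a * (f c - c) + (f a - a) * c := by
        rw [map_mul]; noncomm_ring
      rw [e]
      refine add_mem ?_ (Ideal.mul_mem_right _ _ ha')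
      exact mul_mem_pow_add (i := 1) (j := 1) (mem_pow_one.2 (hstab ha)) (mem_pow_one.2 (h0 c))⟩
    refine (groupIdeal_le (K := K) (fun s hs => ⟨sub_one_mem_groupIdeal hs, ?_⟩) hz).2
    rw [map_sub, map_one, sub_sub_sub_cancel_right]
    exact h1 s hs
  induction k generalizing z with
  | zero => exact mem_pow_one.2 (h0 z)
  | succ k ih =>
    refine pow_succ_induction (p := fun z => f z - z ∈ groupIdeal S ^ (k + 1 + 1)) ?_ ?_ hz
    · intro x y hx hy
      rw [map_add, add_sub_add_comm]
      exact add_mem hx hy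
    · intro x hx y hy
      have e : f (x * y) - x * y = (f x - x) * f y + x * (f y - y) := by
        rw [map_mul]; noncomm_ring
      rw [e]
      refine add_mem ?_ ?_
      · rw [show k + 1 + 1 = 2 + k by omega]
        exact mul_mem_pow_add (hone hx) (map_mem_pow f.toRingHom (fun _ h => hstab h) k hy)
      · rw [show k + 1 + 1 = 1 + (k + 1) by omega]
        exact mul_mem_pow_add (mem_pow_one.2 hx) (ih hy)

/-- The additive span of the products of elements of `𝔞 ^ i` and `𝔟 ^ j` with `i + j = k`. -/
noncomputable def combFiltration (κ : F →* Γ) (ι : G →* Γ) (𝔞 : Ideal (MonoidAlgebra ℚ F))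
    (𝔟 : Ideal (MonoidAlgebra ℚ G)) (k : ℕ) : AddSubmonoid (MonoidAlgebra ℚ Γ) :=
  AddSubmonoid.closure {y | ∃ i j, i + j = k ∧ ∃ a ∈ 𝔞 ^ i, ∃ b ∈ 𝔟 ^ j,
    y = groupAlgebraMap κ a * groupAlgebraMap ι b}

variable {κ : F →* Γ} {ι : G →* Γ} {φ : G →* MulAut F}

theorem groupAlgebraMap_mul_comm (hφ : ∀ g w, κ (φ g w) = ι g * κ w * (ι g)⁻¹) (g : G)
    (a : MonoidAlgebra ℚ F) : MonoidAlgebra.of ℚ Γ (ι g) * groupAlgebraMap κ a =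
      groupAlgebraMap κ (autMap (φ g) a) * MonoidAlgebra.of ℚ Γ (ι g) := by
  induction a using MonoidAlgebra.induction_on with
  | of w =>
    rw [autMap_of, groupAlgebraMap_of, groupAlgebraMap_of, ← map_mul, ← map_mul, hφ,
      inv_mul_cancel_right]
  | add x y hx hy => simp only [map_add, mul_add, add_mul, hx, hy]
  | smul r x hx => simp only [map_smul, mul_smul_comm, smul_mul_assoc, hx]

variable {S : Set F} {T : Set G}

/-- The powers of the ideal generated by the differences of elements in both factors of a
semidirect product, when the second factor acts suitably on the first. -/
theorem groupIdeal_pow_le_combFiltration (hφ : ∀ g w, κ (φ g w) = ι g * κ w * (ι g)⁻¹)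
    (hsurj : ∀ γ, ∃ w g, γ = κ w * ι g)
    (hstab : ∀ g, ∀ a ∈ groupIdeal S, autMap (φ g) a ∈ groupIdeal S)
    (hunip : ∀ t ∈ T, ∀ i, ∀ a ∈ groupIdeal S ^ i,
      autMap (φ t) a - a ∈ groupIdeal S ^ (i + 1)) (k : ℕ) {z : MonoidAlgebra ℚ Γ}
    (hz : z ∈ groupIdeal (κ '' S ∪ ι '' T) ^ k) :
    z ∈ combFiltration κ ι (groupIdeal S) (groupIdeal T) k := by
  set E := combFiltration κ ι (groupIdeal S) (groupIdeal T) with hE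
  have hmem {k i j : ℕ} (hij : i + j = k) {a b} (ha : a ∈ groupIdeal S ^ i)
      (hb : b ∈ groupIdeal T ^ j) : groupAlgebraMap κ a * groupAlgebraMap ι b ∈ E k :=
    AddSubmonoid.subset_closure ⟨i, j, hij, a, ha, b, hb, rfl⟩
  have hι (g : G) (a b) : MonoidAlgebra.of ℚ Γ (ι g) * (groupAlgebraMap κ a * groupAlgebraMap ι b) =
      groupAlgebraMap κ (autMap (φ g) a) *
        groupAlgebraMap ι (MonoidAlgebra.of ℚ G g * b) := by
    rw [← mul_assoc, groupAlgebraMap_mul_comm hφ, mul_assoc, map_mul, groupAlgebraMap_of]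
  have hmulmem {y : MonoidAlgebra ℚ Γ} {k k' : ℕ} (h : ∀ i j, i + j = k → ∀ a ∈ groupIdeal S ^ i,
      ∀ b ∈ groupIdeal T ^ j, y * (groupAlgebraMap κ a * groupAlgebraMap ι b) ∈ E k') :
      ∀ e ∈ E k, y * e ∈ E k' := by
    intro e he
    refine AddSubmonoid.closure_induction (motive := fun e _ => y * e ∈ E k') ?_ ?_ ?_ he
    · rintro _ ⟨i, j, hij, a, ha, b, hb, rfl⟩
      exact h i j hij a ha b hb
    · rw [mul_zero]; exact zero_mem _
    · intro u v _ _ hu hv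
      rw [mul_add]; exact add_mem hu hv
  -- The plan is that each `E k` is a left ideal and that left multiplication by the ideal raises
  -- `k` by one. Here stability under all of `G` suffices, while the unipotence of `T` enters only
  -- in `hstep`.
  have hof (k : ℕ) (γ : Γ) : ∀ e ∈ E k, MonoidAlgebra.of ℚ Γ γ * e ∈ E k := by
    obtain ⟨w, g, rfl⟩ := hsurj γ
    intro e he
    rw [map_mul, mul_assoc]
    refine hmulmem (k := k) (k' := k) ?_ _ (hmulmem (k := k) (k' := k) ?_ e he)
    · intro i j hij a ha b hb
      rw [← groupAlgebraMap_of, ← mul_assoc, ← map_mul]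
      exact hmem hij (Ideal.mul_mem_left _ _ ha) hb
    · intro i j hij a ha b hb
      rw [hι]
      exact hmem hij (map_mem_pow (autMap (φ g)).toRingHom (hstab g) i ha)
        (Ideal.mul_mem_left _ _ hb)
  have hsmul (k : ℕ) (r : ℚ) : ∀ e ∈ E k, algebraMap ℚ (MonoidAlgebra ℚ Γ) r * e ∈ E k := by
    refine hmulmem fun i j hij a ha b hb => ?_
    rw [← mul_assoc, ← AlgHom.commutes (groupAlgebraMap κ), ← map_mul]
    exact hmem hij (Ideal.mul_mem_left _ _ ha) hb
  have hleft (k : ℕ) (y : MonoidAlgebra ℚ Γ) : ∀ e ∈ E k, y * e ∈ E k := by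
    induction y using MonoidAlgebra.induction_on with
    | of γ => exact hof k γ
    | add x y hx hy => intro e he; rw [add_mul]; exact add_mem (hx e he) (hy e he)
    | smul r x hx =>
      intro e he
      rw [Algebra.smul_def, mul_assoc]
      exact hsmul k r _ (hx e he)
  have hstep (k : ℕ) (s : Γ) (hs : s ∈ κ '' S ∪ ι '' T) :
      ∀ e ∈ E k, (MonoidAlgebra.of ℚ Γ s - 1) * e ∈ E (k + 1) := by
    refine hmulmem fun i j hij a ha b hb => ?_
    rcases hs with ⟨s, hs, rfl⟩ | ⟨t, ht, rfl⟩
    · rw [← groupAlgebraMap_of, ← map_one (groupAlgebraMap κ), ← map_sub, ← mul_assoc, ← map_mul]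
      refine hmem (i := 1 + i) (j := j) (by omega) ?_ hb
      exact mul_mem_pow_add (mem_pow_one.2 (sub_one_mem_groupIdeal hs)) ha
    -- Moving `t` past `a` produces `φ t a - a`, which unipotence puts one step deeper in the first
    -- filtration; the remaining term gains the factor `t - 1` in the second.
    · have e : (MonoidAlgebra.of ℚ Γ (ι t) - 1) * (groupAlgebraMap κ a * groupAlgebraMap ι b) =
          groupAlgebraMap κ (autMap (φ t) a - a) *
              groupAlgebraMap ι (MonoidAlgebra.of ℚ G t * b) +
            groupAlgebraMap κ a * groupAlgebraMap ι ((MonoidAlgebra.of ℚ G t - 1) * b) := by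
        rw [sub_mul, hι]
        simp only [map_sub, map_mul, map_one]
        noncomm_ring
      rw [e]
      refine add_mem (hmem (i := i + 1) (j := j) (by omega) (hunip t ht i a ha)
        (Ideal.mul_mem_left _ _ hb)) (hmem (i := i) (j := 1 + j) (by omega) ha ?_)
      exact mul_mem_pow_add (mem_pow_one.2 (sub_one_mem_groupIdeal ht)) hb
  have hideal (k : ℕ) {y} (hy : y ∈ groupIdeal (κ '' S ∪ ι '' T)) : ∀ e ∈ E k,
    y * e ∈ E (k + 1) := by
    let K : Ideal (MonoidAlgebra ℚ Γ) :=
      { carrier := {y | ∀ e ∈ E k, y * e ∈ E (k + 1)}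
        add_mem' := fun ha hb e he => by rw [add_mul]; exact add_mem (ha e he) (hb e he)
        zero_mem' := fun e _ => by rw [zero_mul]; exact zero_mem _
        smul_mem' := fun c a ha e he => by
          rw [smul_eq_mul, mul_assoc]; exact hleft _ _ _ (ha e he) }
    -- Right multiplication is harmless since `E k` absorbs left multiplication.
    have : K.IsTwoSided := ⟨fun b {a} ha e he => by
      rw [mul_assoc]; exact ha _ (hleft _ _ _ he)⟩
    exact groupIdeal_le (K := K) (hstep k) hy
  induction k generalizing z with
  | zero =>
    have := hleft 0 z 1 (by
      have := hmem (k := 0) (i := 0) (j := 0) rfl (mem_pow_zero (I := groupIdeal S) 1)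
        (mem_pow_zero (I := groupIdeal T) 1)
      rwa [map_one, map_one, mul_one] at this)
    rwa [mul_one] at this
  | succ k ih =>
    exact pow_succ_induction (p := fun z => z ∈ E (k + 1))
      (fun _ _ => add_mem) (fun x hx y hy => hideal k hx y (ih hy)) hz

end Comb

end MixedBraid

namespace MixedBraid

/-! ### Mixed pure braids acting on the group algebra of the free group -/

section Action

theorem of_conj_sub_of {F : Type*} [Group F] (u x : F) :
    MonoidAlgebra.of ℚ F (u * x * u⁻¹) - MonoidAlgebra.of ℚ F x =
      ((MonoidAlgebra.of ℚ F u - 1) * (MonoidAlgebra.of ℚ F x - 1) -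
        (MonoidAlgebra.of ℚ F x - 1) * (MonoidAlgebra.of ℚ F u - 1)) *
          MonoidAlgebra.of ℚ F u⁻¹ := by
  have e : (MonoidAlgebra.of ℚ F u - 1) * (MonoidAlgebra.of ℚ F x - 1) -
      (MonoidAlgebra.of ℚ F x - 1) * (MonoidAlgebra.of ℚ F u - 1) =
      MonoidAlgebra.of ℚ F (u * x) - MonoidAlgebra.of ℚ F (x * u) := by
    rw [map_mul, map_mul]; noncomm_ring
  rw [e, sub_mul, ← map_mul, ← map_mul, mul_inv_cancel_right]

variable {m n : ℕ}

theorem closure_range_of (X : Type*) :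
    Subgroup.closure (Set.range (FreeGroup.of : X → FreeGroup X)) = ⊤ :=
  FreeGroup.closure_range_of X

theorem augmentation_autMap {F : Type*} [Group F] (φ : MulAut F) (z : MonoidAlgebra ℚ F) :
    augmentation F (autMap φ z) = augmentation F z := by
  have : (augmentation F).comp (autMap φ) = augmentation F :=
    groupAlgebra_hom_ext fun w => by
      rw [AlgHom.comp_apply, autMap_of, augmentation_of, augmentation_of]
  exact DFunLike.congr_fun this z

/-- The generators of the free group. -/
def freeGens (m n : ℕ) : Set (FreeGroup (Fin (m + n))) := Set.range FreeGroup.of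

/-- The generators of the free group that correspond to strands. -/
def strandGens (m n : ℕ) : Set (FreeGroup (Fin (m + n))) :=
  {w | ∃ q : Fin (m + n), m ≤ q.val ∧ w = FreeGroup.of q}

/-- The braids `τ_{ij}`. -/
def strandBraids (m n : ℕ) : Set (MixedPureBraidGroup m n) :=
  {g | ∃ (i j : Fin n) (h : i < j), g = tau i j h}

theorem augmentationIdeal_free :
    augmentationIdeal (FreeGroup (Fin (m + n))) = groupIdeal (freeGens m n) :=
  augmentationIdeal_eq_groupIdeal (closure_range_of _)

theorem mixedI_eq : mixedI m n = groupIdeal (Set.range (chordBraid (m := m) (n := n))) :=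
  augmentationIdeal_eq_groupIdeal (closure_chordBraid m n)

theorem mixedJ_eq : mixedJ m n = groupIdeal (strandBraids m n) := by
  rw [mixedJ, groupIdeal]
  congr 2
  ext y
  constructor
  · rintro ⟨i, j, h, rfl⟩
    exact ⟨_, ⟨i, j, h, rfl⟩, rfl⟩
  · rintro ⟨_, ⟨i, j, h, rfl⟩, rfl⟩
    exact ⟨i, j, h, rfl⟩

theorem tau_eq_chordBraid (i j : Fin n) (h : i < j) :
    (tau i j h : MixedPureBraidGroup m n) = chordBraid (.c i j h.ne) :=
  (chordBraid_c_of_lt h _).symm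

theorem mixedI_succ : mixedI m (n + 1) =
    groupIdeal (freeHom m n '' freeGens m n ∪ stabHom m n '' Set.range chordBraid) := by
  refine augmentationIdeal_eq_groupIdeal (eq_top_iff.2 ?_)
  rw [Subgroup.closure_union, ← MonoidHom.map_closure, ← MonoidHom.map_closure, freeGens,
    closure_range_of, closure_chordBraid]
  intro γ _
  obtain ⟨⟨w, g⟩, rfl⟩ := (combEquiv m n).surjective γ
  exact Subgroup.mul_mem_sup ⟨w, trivial, rfl⟩ ⟨g, trivial, rfl⟩

theorem strandBraids_succ : strandBraids m (n + 1) =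
    freeHom m n '' strandGens m n ∪ stabHom m n '' strandBraids m n := by
  ext g
  constructor
  · rintro ⟨i, j, h, rfl⟩
    obtain ⟨i, rfl⟩ := Fin.exists_castSucc_eq.2 (h.trans_le (Fin.le_last j)).ne
    induction j using Fin.lastCases with
    | last =>
      refine Or.inl ⟨_, ⟨Fin.natAdd m i, by simp, rfl⟩, ?_⟩
      rw [freeHom_of, Chord.last_natAdd, chordBraid_c_of_lt (Fin.castSucc_lt_last _)]
    | cast j => exact Or.inr ⟨_, ⟨i, j, h, rfl⟩, stabHom_tau _ _ _⟩
  · rintro (⟨_, ⟨q, hq, rfl⟩, rfl⟩ | ⟨_, ⟨i, j, h, rfl⟩, rfl⟩)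
    · rw [freeHom_of, Chord.last_of_ge hq, chordBraid_c_of_lt (Fin.castSucc_lt_last _)]
      exact ⟨_, _, _, rfl⟩
    · exact ⟨_, _, _, stabHom_tau _ _ _⟩

theorem mixedJ_succ : mixedJ m (n + 1) =
    groupIdeal (freeHom m n '' strandGens m n ∪ stabHom m n '' strandBraids m n) := by
  rw [mixedJ_eq, strandBraids_succ]

theorem autMap_mem_freeGens (φ : MulAut (FreeGroup (Fin (m + n))))
    {a} (ha : a ∈ groupIdeal (freeGens m n)) : autMap φ a ∈ groupIdeal (freeGens m n) := by
  rw [← augmentationIdeal_free] at *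
  exact (augmentation_autMap φ a).trans ha

/-- Each strand letter goes to a conjugate of itself, and conjugates of `s - 1` stay in the
two-sided ideal. This holds for all mixed pure braids, not only for the `τ_{ij}`. -/
theorem autMap_mem_strandGens (g : MixedPureBraidGroup m n)
    {a} (ha : a ∈ groupIdeal (strandGens m n)) :
    autMap (mixedArtin m n g) a ∈ groupIdeal (strandGens m n) := by
  refine map_groupIdeal_mem (autMap (mixedArtin m n g)).toRingHom ?_ ha
  rintro _ ⟨q, hq, rfl⟩
  obtain ⟨u, hu⟩ := mixedArtin_mem_basisConjugating g q
  have e : (autMap (mixedArtin m n g)).toRingHom (MonoidAlgebra.of ℚ _ (FreeGroup.of q)) - 1 =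
      MonoidAlgebra.of ℚ _ u * (MonoidAlgebra.of ℚ _ (FreeGroup.of q) - 1) *
        MonoidAlgebra.of ℚ _ u⁻¹ := by
    refine (congrArg (· - 1) (autMap_of _ _)).trans ?_
    rw [hu, mul_sub, sub_mul, ← map_mul, ← map_mul, mul_one, ← map_mul, mul_inv_cancel, map_one]
  rw [e]
  exact Ideal.mul_mem_right _ _ (Ideal.mul_mem_left _ _ (sub_one_mem_groupIdeal ⟨q, hq, rfl⟩))

/-- Automorphisms preserve the augmentation, and a letter and its conjugate agree in the
abelianization, hence modulo the square of the augmentation ideal. -/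
theorem autMap_sub_mem_freeGens (g : MixedPureBraidGroup m n) (i : ℕ)
    {a} (ha : a ∈ groupIdeal (freeGens m n) ^ i) :
    autMap (mixedArtin m n g) a - a ∈ groupIdeal (freeGens m n) ^ (i + 1) := by
  refine sub_mem_pow_succ _ (fun z => ?_) ?_ i ha
  · rw [← augmentationIdeal_free]
    change augmentation _ _ = 0
    rw [map_sub, augmentation_autMap, sub_self]
  · rintro _ ⟨q, rfl⟩
    obtain ⟨u, hu⟩ := mixedArtin_mem_basisConjugating g q
    rw [← augmentationIdeal_free, autMap_of, hu]
    refine of_sub_of_mem_sq ?_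
    rw [map_mul, map_mul, map_inv, mul_comm, inv_mul_cancel_left]

/-- A braid `τ_{ij}` fixes the pole letters, so it acts trivially modulo the ideal of the strand
letters. It conjugates a strand letter by a word in strand letters, so the difference is built from
commutators of elements of that ideal and lies in its square. -/
theorem autMap_sub_mem_strandGens {g : MixedPureBraidGroup m n} (hg : g ∈ strandBraids m n) (i : ℕ)
    {a} (ha : a ∈ groupIdeal (strandGens m n) ^ i) :
    autMap (mixedArtin m n g) a - a ∈ groupIdeal (strandGens m n) ^ (i + 1) := by
  obtain ⟨r, s, hrs, rfl⟩ := hg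
  rw [tau_eq_chordBraid]
  set φ := mixedArtin m n (chordBraid (.c r s hrs.ne))
  have hx (q) (hq : q.val < m) : φ (FreeGroup.of q) = FreeGroup.of q := by
    obtain ⟨u, hu, -, h⟩ := mixedArtin_chordBraid (.c r s hrs.ne) q
    rw [hu, (h trivial).1 hq, one_mul, inv_one, mul_one]
  have hgen (q : Fin (m + n)) : MonoidAlgebra.of ℚ _ (φ (FreeGroup.of q)) -
      MonoidAlgebra.of ℚ _ (FreeGroup.of q) ∈ groupIdeal (strandGens m n) := by
    rcases lt_or_ge q.val m with hq | hq
    · rw [hx q hq, sub_self]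
      exact zero_mem _
    · have h1 : MonoidAlgebra.of ℚ _ (FreeGroup.of q) - 1 ∈ groupIdeal (strandGens m n) :=
        sub_one_mem_groupIdeal ⟨q, hq, rfl⟩
      have h2 := autMap_mem_strandGens (chordBraid (.c r s hrs.ne)) h1
      have := sub_mem h2 h1
      rwa [map_sub, map_one, sub_sub_sub_cancel_right, autMap_of] at this
  have hinv (w) (hw : MonoidAlgebra.of ℚ _ (φ w) - MonoidAlgebra.of ℚ _ w ∈
      groupIdeal (strandGens m n)) : MonoidAlgebra.of ℚ _ (φ w⁻¹) - MonoidAlgebra.of ℚ _ w⁻¹ ∈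
      groupIdeal (strandGens m n) := by
    have e : MonoidAlgebra.of ℚ _ (φ w⁻¹) - MonoidAlgebra.of ℚ _ w⁻¹ =
        -(MonoidAlgebra.of ℚ _ (φ w)⁻¹ * (MonoidAlgebra.of ℚ _ (φ w) - MonoidAlgebra.of ℚ _ w) *
          MonoidAlgebra.of ℚ _ w⁻¹) := by
      rw [mul_sub, sub_mul, ← map_mul, ← map_mul, ← map_mul, ← map_mul, inv_mul_cancel, one_mul,
        mul_inv_cancel_right, neg_sub, map_inv]
    rw [e]
    exact neg_mem (Ideal.mul_mem_right _ _ (Ideal.mul_mem_left _ _ hw))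
  have hword (w) : MonoidAlgebra.of ℚ _ (φ w) - MonoidAlgebra.of ℚ _ w ∈
      groupIdeal (strandGens m n) := by
    induction w using FreeGroup.induction_on with
    | C1 => rw [map_one, sub_self]; exact zero_mem _
    | of q => exact hgen q
    | inv_of q _ => exact hinv _ (hgen q)
    | mul a b ha hb =>
      have e : MonoidAlgebra.of ℚ _ (φ (a * b)) - MonoidAlgebra.of ℚ _ (a * b) =
          (MonoidAlgebra.of ℚ _ (φ a) - MonoidAlgebra.of ℚ _ a) * MonoidAlgebra.of ℚ _ (φ b) +
          MonoidAlgebra.of ℚ _ a * (MonoidAlgebra.of ℚ _ (φ b) - MonoidAlgebra.of ℚ _ b) := by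
        rw [map_mul φ, map_mul, map_mul]; noncomm_ring
      rw [e]
      exact add_mem (Ideal.mul_mem_right _ _ ha) (Ideal.mul_mem_left _ _ hb)
  refine sub_mem_pow_succ _ (fun z => ?_) ?_ i ha
  · induction z using MonoidAlgebra.induction_on with
    | of w => rw [autMap_of]; exact hword w
    | add x y hx hy => rw [map_add, add_sub_add_comm]; exact add_mem hx hy
    | smul c x hx =>
      rw [map_smul, ← smul_sub, Algebra.smul_def]
      exact Ideal.mul_mem_left _ _ hx
  · rintro _ ⟨q, hq, rfl⟩
    obtain ⟨u, hu, -, h⟩ := mixedArtin_chordBraid (.c r s hrs.ne) q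
    have h1 : MonoidAlgebra.of ℚ _ (FreeGroup.of q) - 1 ∈ groupIdeal (strandGens m n) ^ 1 :=
      mem_pow_one.2 (sub_one_mem_groupIdeal ⟨q, hq, rfl⟩)
    have h2 : MonoidAlgebra.of ℚ _ u - 1 ∈ groupIdeal (strandGens m n) ^ 1 := by
      have : Subgroup.closure (strandGens m n) ≤
          congruenceSubgroup (groupIdeal (strandGens m n)) := by
        rw [Subgroup.closure_le]
        exact fun s hs => sub_one_mem_groupIdeal hs
      exact mem_pow_one.2 (this (h trivial).2)
    rw [autMap_of, show φ (FreeGroup.of q) = _ from hu, of_conj_sub_of]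
    exact Ideal.mul_mem_right _ _ (sub_mem (mul_mem_pow_add h2 h1) (mul_mem_pow_add h1 h2))

/-- Conjugation by `u` on the element `x = 1 + X`, up to third order. -/
theorem conj_sub_mem_pow_three {R : Type*} [Ring R] {K : Ideal R} [K.IsTwoSided] {X U D V : R}
    (hX : X ∈ K ^ 1) (hU : U ∈ K ^ 1) (hV : V - 1 ∈ K ^ 1) (hUD : U + D ∈ K ^ 2) :
    (U * X - X * U) * V + (D * X - X * D) ∈ K ^ 3 := by
  have e : (U * X - X * U) * V + (D * X - X * D) =
      (U * X - X * U) * (V - 1) + ((U + D) * X - X * (U + D)) := by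
    noncomm_ring
  rw [e]
  refine add_mem ?_ (sub_mem (mul_mem_pow_add (i := 2) (j := 1) hUD hX)
    (mul_mem_pow_add (i := 1) (j := 2) hX hUD))
  exact mul_mem_pow_add (i := 2) (j := 1)
    (sub_mem (mul_mem_pow_add (i := 1) (j := 1) hU hX) (mul_mem_pow_add (i := 1) (j := 1) hX hU)) hV

/-- Modulo the square of the augmentation ideal, `g ↦ g - 1` factors through the abelianization and
is additive. -/
theorem of_sub_one_add_mem_sq {G : Type*} [Group G] {u d : G}
    (h : Abelianization.of u = Abelianization.of d⁻¹) :
    (MonoidAlgebra.of ℚ G u - 1) + (MonoidAlgebra.of ℚ G d - 1) ∈ augmentationIdeal G ^ 2 := by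
  have h1 : MonoidAlgebra.of ℚ G d⁻¹ * MonoidAlgebra.of ℚ G d = 1 := by
    rw [← map_mul, inv_mul_cancel, map_one]
  have e : (MonoidAlgebra.of ℚ G u - 1) + (MonoidAlgebra.of ℚ G d - 1) =
      (MonoidAlgebra.of ℚ G u - MonoidAlgebra.of ℚ G d⁻¹) -
        (MonoidAlgebra.of ℚ G d⁻¹ - 1) * (MonoidAlgebra.of ℚ G d - 1) := by
    rw [sub_mul, mul_sub, h1]
    noncomm_ring
  rw [e]
  exact sub_mem (of_sub_of_mem_sq h)
    (mul_mem_pow_add (i := 1) (j := 1) (of_sub_one_mem _) (of_sub_one_mem _))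

/-- The action of a generator on a variable, up to third order. -/
theorem autMap_chordBraid_sub_mem (x : Chord m n) (p : Fin (m + n)) :
    autMap (mixedArtin m n (chordBraid x)) (MonoidAlgebra.of ℚ _ (FreeGroup.of p)) -
      MonoidAlgebra.of ℚ _ (FreeGroup.of p) +
      ((x.link p 0 fun q => MonoidAlgebra.of ℚ _ (FreeGroup.of q) - 1) *
          (MonoidAlgebra.of ℚ _ (FreeGroup.of p) - 1) -
        (MonoidAlgebra.of ℚ _ (FreeGroup.of p) - 1) *
          (x.link p 0 fun q => MonoidAlgebra.of ℚ _ (FreeGroup.of q) - 1)) ∈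
      augmentationIdeal (FreeGroup (Fin (m + n))) ^ 3 := by
  obtain ⟨u, hu, hd, -⟩ := mixedArtin_chordBraid x p
  rw [autMap_of, hu, of_conj_sub_of]
  -- The default `1` of the linked letter matches the default `0` of the difference, so unlinked
  -- letters need no separate case.
  have hlink : (x.link p 0 fun q => MonoidAlgebra.of ℚ _ (FreeGroup.of q) - 1) =
      MonoidAlgebra.of ℚ _ (x.link p 1 FreeGroup.of) - 1 := by
    rw [Chord.map_link (fun w => MonoidAlgebra.of ℚ (FreeGroup (Fin (m + n))) w - 1) x p,
      map_one, sub_self]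
  rw [hlink]
  exact conj_sub_mem_pow_three (of_sub_one_mem _) (of_sub_one_mem _) (of_sub_one_mem _)
    (of_sub_one_add_mem_sq hd)

end Action

/-! ### The Magnus expansion -/

section Magnus

variable {X A : Type*} [Ring A]

open PowerSeries

/-- The power series without terms of degree less than `k`. -/
def orderFiltration (A : Type*) [Ring A] (k : ℕ) : AddSubmonoid A⟦X⟧ where
  carrier := {f | ∀ i < k, coeff i f = 0}
  add_mem' := fun hf hg i hi => by rw [map_add, hf i hi, hg i hi, add_zero]
  zero_mem' := fun i _ => map_zero _

theorem orderFiltration_mul (i j : ℕ) (f g : A⟦X⟧) (hf : f ∈ orderFiltration A i)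
    (hg : g ∈ orderFiltration A j) : f * g ∈ orderFiltration A (i + j) := by
  intro k hk
  rw [coeff_mul]
  refine Finset.sum_eq_zero fun p hp => ?_
  rw [Finset.HasAntidiagonal.mem_antidiagonal] at hp
  rcases lt_or_ge p.1 i with h | h
  · rw [hf _ h, zero_mul]
  · rw [hg p.2 (by omega), mul_zero]

/-- Leading coefficients multiply, since all other terms of the Cauchy product vanish. The variable
of the series only records the degree. -/
theorem coeff_mul_of_mem {i j : ℕ} {f g : A⟦X⟧} (hf : f ∈ orderFiltration A i)
    (hg : g ∈ orderFiltration A j) : coeff (i + j) (f * g) = coeff i f * coeff j g := by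
  rw [coeff_mul, Finset.sum_eq_single (i, j)]
  · rintro ⟨a, b⟩ hp hne
    rw [Finset.HasAntidiagonal.mem_antidiagonal] at hp
    simp only at hp ⊢
    rcases lt_or_ge a i with h | h
    · rw [hf _ h, zero_mul]
    · rw [hg b, mul_zero]
      by_contra hb
      exact hne (Prod.ext (by omega) (by omega))
  · intro h
    exact absurd (Finset.HasAntidiagonal.mem_antidiagonal.2 (rfl : i + j = i + j)) h

/-- The power series with coefficients in the powers of an ideal. -/
def coeffFiltration (K : Ideal A) (k : ℕ) : AddSubmonoid A⟦X⟧ where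
  carrier := {f | ∀ i, coeff i f ∈ K ^ k}
  add_mem' := fun hf hg i => by rw [map_add]; exact add_mem (hf i) (hg i)
  zero_mem' := fun i => by rw [map_zero]; exact zero_mem _

theorem coeffFiltration_mul (K : Ideal A) [K.IsTwoSided] (i j : ℕ) (f g : A⟦X⟧)
    (hf : f ∈ coeffFiltration K i) (hg : g ∈ coeffFiltration K j) :
    f * g ∈ coeffFiltration K (i + j) := by
  intro k
  rw [coeff_mul]
  exact sum_mem fun p _ => mul_mem_pow_add (hf _) (hg _)

theorem isUnit_one_add_C_mul_X (a : A) : IsUnit (1 + C a * PowerSeries.X : A⟦X⟧) := by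
  rw [isUnit_iff_constantCoeff]
  simp

theorem C_mul_X_mem (a : A) : C a * PowerSeries.X ∈ orderFiltration A 1 := by
  intro i hi
  obtain rfl : i = 0 := by omega
  simp

theorem coeff_one_C_mul_X (a : A) : coeff 1 (C a * PowerSeries.X : A⟦X⟧) = a := by
  simp

variable [Algebra ℚ A]

/-- The Magnus expansion of the group algebra of a free group. -/
noncomputable def magnus (v : X → A) : MonoidAlgebra ℚ (FreeGroup X) →ₐ[ℚ] A⟦X⟧ :=
  MonoidAlgebra.lift ℚ _ _ ((Units.coeHom _).comp
    (FreeGroup.lift fun x => (isUnit_one_add_C_mul_X (v x)).unit))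

theorem magnus_of (v : X → A) (x : X) :
    magnus v (MonoidAlgebra.of ℚ _ (FreeGroup.of x)) = 1 + C (v x) * PowerSeries.X := by
  rw [magnus, MonoidAlgebra.lift_of, MonoidHom.comp_apply, FreeGroup.lift_apply_of]
  rfl

theorem magnus_of_sub_one (v : X → A) (x : X) :
    magnus v (MonoidAlgebra.of ℚ _ (FreeGroup.of x) - 1) = C (v x) * PowerSeries.X := by
  rw [map_sub, magnus_of, map_one, add_sub_cancel_left]

/-- The difference `x - 1` of a letter goes to a series without constant term, and orders add under
multiplication. -/
theorem magnus_mem_orderFiltration (v : X → A) (k : ℕ) {a : MonoidAlgebra ℚ (FreeGroup X)}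
    (ha : a ∈ augmentationIdeal (FreeGroup X) ^ k) : magnus v a ∈ orderFiltration A k := by
  refine map_pow_mem (W := orderFiltration A) orderFiltration_mul (magnus v).toRingHom
    (fun a i hi => absurd hi (Nat.not_lt_zero i)) (fun a ha => ?_) k ha
  refine augmentation_pow_induction (closure_range_of X) (k := 0)
    (p := fun a => magnus v a ∈ orderFiltration A 1) ?_ ?_ ?_ ?_ (mem_pow_one.2 ha)
  · rw [map_zero]; exact zero_mem _
  · intro x y hx hy; rw [map_add]; exact add_mem hx hy
  · intro x hx i hi
    rw [map_neg, map_neg, hx i hi, neg_zero]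
  · rintro _ ⟨x, rfl⟩ y _
    rw [map_mul, magnus_of_sub_one]
    exact orderFiltration_mul 1 0 _ _ (C_mul_X_mem _) fun i hi => absurd hi (Nat.not_lt_zero i)

end Magnus

end MixedBraid

namespace MixedBraid

open PowerSeries

/-! ### The expansion of mixed pure braids -/

section Magnus

variable {m n : ℕ} {A : Type*} [Ring A] [Algebra ℚ A]

theorem mem_of_mem_pow_succ {R : Type*} [Ring R] {I : Ideal R} [I.IsTwoSided] {k : ℕ} {z : R}
    (hz : z ∈ I ^ (k + 1)) : z ∈ I :=
  pow_succ_induction (p := fun z => z ∈ I) (fun _ _ => add_mem)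
    (fun _ hx y _ => Ideal.mul_mem_right y _ hx) hz

theorem coeff_magnus_of_mem {X : Type*} (v : X → A) {i k : ℕ} (hik : i < k)
    {a : MonoidAlgebra ℚ (FreeGroup X)} (ha : a ∈ augmentationIdeal (FreeGroup X) ^ k) :
    coeff i (magnus v a) = 0 :=
  magnus_mem_orderFiltration v k ha i hik

theorem coeff_magnus_mul {X : Type*} (v : X → A) {i j : ℕ}
    {a b : MonoidAlgebra ℚ (FreeGroup X)} (ha : a ∈ augmentationIdeal (FreeGroup X) ^ i)
    (hb : b ∈ augmentationIdeal (FreeGroup X) ^ j) :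
    coeff (i + j) (magnus v (a * b)) = coeff i (magnus v a) * coeff j (magnus v b) := by
  rw [map_mul]
  exact coeff_mul_of_mem (magnus_mem_orderFiltration v i ha) (magnus_mem_orderFiltration v j hb)

theorem coeff_magnus_of_sub_one {X : Type*} (v : X → A) (p : X) :
    coeff 1 (magnus v (MonoidAlgebra.of ℚ _ (FreeGroup.of p) - 1)) = v p := by
  rw [magnus_of_sub_one, coeff_one_C_mul_X]

/-- To first order, a generator of the mixed pure braid group acts on the Magnus expansion by the
commutator with the corresponding chord. -/
theorem coeff_magnus_autMap_sub {v : Chord m (n + 1) → A} (hv : SatisfiesDK v) (x : Chord m n)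
    (i : ℕ) {a : MonoidAlgebra ℚ (FreeGroup (Fin (m + n)))}
    (ha : a ∈ augmentationIdeal (FreeGroup (Fin (m + n))) ^ i) :
    coeff (i + 1) (magnus (fun p => v (Chord.last p))
        (autMap (mixedArtin m n (chordBraid x)) a - a)) =
      v x.castSucc * coeff i (magnus (fun p => v (Chord.last p)) a) -
        coeff i (magnus (fun p => v (Chord.last p)) a) * v x.castSucc := by
  set M := magnus fun p : Fin (m + n) => v (Chord.last p) with hM
  set φ := autMap (mixedArtin m n (chordBraid x)) with hφ
  have hφsub (i : ℕ) {a} (ha : a ∈ augmentationIdeal (FreeGroup (Fin (m + n))) ^ i) :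
      φ a - a ∈ augmentationIdeal (FreeGroup (Fin (m + n))) ^ (i + 1) := by
    rw [augmentationIdeal_free] at ha ⊢
    exact autMap_sub_mem_freeGens _ i ha
  induction i generalizing a with
  | zero =>
    -- Subtracting the augmentation does not change `φ a - a`, which therefore lies in the second
    -- power. The constant coefficient of the expansion is a scalar, so the commutator on the right
    -- vanishes too.
    have h1 : a - algebraMap ℚ _ (augmentation _ a) ∈
        augmentationIdeal (FreeGroup (Fin (m + n))) ^ 1 := by
      rw [mem_pow_one, augmentationIdeal_free]
      exact sub_algebraMap_augmentation_mem (closure_range_of _) a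
    have h2 := hφsub 1 h1
    rw [map_sub, AlgHom.commutes, sub_sub_sub_cancel_right] at h2
    have h3 := coeff_magnus_of_mem (fun p => v (Chord.last p)) zero_lt_one h1
    rw [map_sub, AlgHom.commutes, map_sub, sub_eq_zero, PowerSeries.algebraMap_apply,
      coeff_zero_C] at h3
    rw [coeff_magnus_of_mem _ (by omega) h2, hM, h3, Algebra.commutes, sub_self]
  | succ i ih =>
    refine augmentation_pow_induction (closure_range_of _)
      (p := fun a => coeff (i + 1 + 1) (M (φ a - a)) =
        v x.castSucc * coeff (i + 1) (M a) - coeff (i + 1) (M a) * v x.castSucc) ?_ ?_ ?_ ?_ ha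
    · simp
    · intro a b ha hb
      rw [map_add φ, add_sub_add_comm, map_add, map_add, ha, hb, map_add, map_add]
      noncomm_ring
    · intro a ha
      rw [map_neg φ, neg_sub_neg, ← neg_sub, map_neg, map_neg, ha, map_neg, map_neg]
      noncomm_ring
    · rintro _ ⟨p, rfl⟩ y hy
      set X : MonoidAlgebra ℚ (FreeGroup (Fin (m + n))) :=
        MonoidAlgebra.of ℚ _ (FreeGroup.of p) - 1 with hX
      have hX1 : X ∈ augmentationIdeal (FreeGroup (Fin (m + n))) ^ 1 := of_sub_one_mem _
      have hMX : coeff 1 (M X) = v (Chord.last p) := coeff_magnus_of_sub_one _ p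
      have hφy : φ y ∈ augmentationIdeal (FreeGroup (Fin (m + n))) ^ i := by
        have := add_mem (Ideal.pow_le_pow_right (Nat.le_succ i) (hφsub i hy)) hy
        rwa [sub_add_cancel] at this
      have hMφy : coeff i (M (φ y)) = coeff i (M y) := by
        have := coeff_magnus_of_mem (fun p => v (Chord.last p)) (Nat.lt_succ_self i) (hφsub i hy)
        rwa [map_sub, map_sub, sub_eq_zero] at this
      -- The braid moves a letter by minus the commutator with the linked letter `D`, up to third
      -- order. The relations at the last strand say that the chord of the braid plus the chord of
      -- `D` commutes with the chord of the letter, which turns this into the commutator with the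
      -- chord of the braid.
      have hMφX : coeff 2 (M (φ X - X)) =
          v x.castSucc * v (Chord.last p) - v (Chord.last p) * v x.castSucc := by
        set D : MonoidAlgebra ℚ (FreeGroup (Fin (m + n))) :=
          x.link p 0 fun q => MonoidAlgebra.of ℚ _ (FreeGroup.of q) - 1 with hD
        have hD1 : D ∈ augmentationIdeal (FreeGroup (Fin (m + n))) ^ 1 := by
          rw [hD, Chord.link]
          split_ifs
          · exact of_sub_one_mem _
          · exact of_sub_one_mem _
          · exact zero_mem _
        have hMD : coeff 1 (M D) = x.link p 0 fun q => v (Chord.last q) := by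
          rw [hD, Chord.map_link (fun z => coeff 1 (M z)) x p, map_zero, map_zero]
          congr 1
          funext q
          exact coeff_magnus_of_sub_one _ q
        have e : autMap (mixedArtin m n (chordBraid x)) (MonoidAlgebra.of ℚ _ (FreeGroup.of p)) -
            MonoidAlgebra.of ℚ _ (FreeGroup.of p) = φ X - X := by
          rw [hX, map_sub, map_one, sub_sub_sub_cancel_right]
        have h3 : coeff 2 (M (φ X - X + (D * X - X * D))) = 0 := by
          rw [← e]
          exact coeff_magnus_of_mem _ (show 2 < 3 by omega) (autMap_chordBraid_sub_mem x p)
        have h1 := coeff_magnus_mul (i := 1) (j := 1) (fun p => v (Chord.last p)) hD1 hX1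
        have h2 := coeff_magnus_mul (i := 1) (j := 1) (fun p => v (Chord.last p)) hX1 hD1
        rw [← hM, hMX, hMD] at h1 h2
        rw [map_add M, map_add (coeff 2), map_sub M (D * X), map_sub (coeff 2) (M (D * X)),
          show 2 = 1 + 1 from rfl, h1, h2] at h3
        have h4 := (hv.commute_last x p).eq
        rw [add_mul, mul_add] at h4
        have h5 := eq_neg_of_add_eq_zero_left h3
        rw [h5, neg_sub, sub_eq_sub_iff_add_eq_add, add_comm, ← h4, add_comm]
      -- To leading order `φ - id` is a derivation, as is the commutator with a chord, so the two
      -- agree on products.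
      have e : φ (X * y) - X * y = (φ X - X) * φ y + X * (φ y - y) := by
        rw [map_mul]; noncomm_ring
      have h6 := coeff_magnus_mul (i := 1 + 1) (j := i) (fun p => v (Chord.last p))
        (hφsub 1 hX1) hφy
      have h7 := coeff_magnus_mul (i := 1) (j := i + 1) (fun p => v (Chord.last p)) hX1
        (hφsub i hy)
      have h8 := coeff_magnus_mul (i := 1) (j := i) (fun p => v (Chord.last p)) hX1 hy
      rw [← hM] at h6 h7 h8
      rw [e, map_add, map_add, show i + 1 + 1 = 1 + 1 + i by omega, h6,
        show 1 + 1 + i = 1 + (i + 1) by omega, h7, add_comm i 1, h8, add_comm 1 i, ih hy,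
        hMφy, hMφX, hMX]
      noncomm_ring

end Magnus

/-! ### Strand chords and the notion of an expansion -/

/-- The two-sided ideal generated by the strand chords. -/
def strandChordIdeal {m n : ℕ} {A : Type*} [Ring A] (u : Chord m n → A) : Ideal A :=
  (TwoSidedIdeal.span {y | ∃ x : Chord m n, x.IsStrandChord ∧ y = u x}).asIdeal

instance {m n : ℕ} {A : Type*} [Ring A] (u : Chord m n → A) : (strandChordIdeal u).IsTwoSided :=
  inferInstanceAs (TwoSidedIdeal.asIdeal _).IsTwoSided

theorem mem_strandChordIdeal {m n : ℕ} {A : Type*} [Ring A] (u : Chord m n → A) {x : Chord m n}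
    (hx : x.IsStrandChord) : u x ∈ strandChordIdeal u :=
  TwoSidedIdeal.mem_asIdeal.2 (TwoSidedIdeal.subset_span ⟨x, hx, rfl⟩)

theorem map_strandChordIdeal_mem {m n : ℕ} {A B : Type*} [Ring A] [Ring B] {u : Chord m n → A}
    {K : Ideal B} [K.IsTwoSided] (f : A →+* B) (h : ∀ x, x.IsStrandChord → f (u x) ∈ K) {a : A}
    (ha : a ∈ strandChordIdeal u) : f a ∈ K := by
  rw [strandChordIdeal, TwoSidedIdeal.mem_asIdeal] at ha
  have : a ∈ K.toTwoSided.comap f := by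
    refine (TwoSidedIdeal.span_le (I := K.toTwoSided.comap f)).2 ?_ ha
    rintro _ ⟨x, hx, rfl⟩
    exact (TwoSidedIdeal.mem_comap f).2 (Ideal.mem_toTwoSided.2 (h x hx))
  exact Ideal.mem_toTwoSided.1 ((TwoSidedIdeal.mem_comap f).1 this)

/-- Having all coefficients in `K` is membership in the kernel of a ring homomorphism, hence in a
two-sided ideal, and can be tested on ideal generators. -/
theorem mem_ker_map_mk {A : Type*} [Ring A] {K : Ideal A} [K.IsTwoSided] {f : A⟦X⟧} :
    f ∈ RingHom.ker (PowerSeries.map (Ideal.Quotient.mk K)) ↔ ∀ i, coeff i f ∈ K := by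
  rw [RingHom.mem_ker, PowerSeries.ext_iff]
  refine forall_congr' fun i => ?_
  rw [coeff_map, map_zero, Ideal.Quotient.eq_zero_iff_mem]

/-- The Magnus expansion sends the powers of the ideal of the strands to the powers of the ideal of
the strand chords. -/
theorem coeff_magnus_mem_strandChordIdeal {m n : ℕ} {A : Type*} [Ring A] [Algebra ℚ A]
    (v : Chord m (n + 1) → A) (k : ℕ) {a : MonoidAlgebra ℚ (FreeGroup (Fin (m + n)))}
    (ha : a ∈ groupIdeal (strandGens m n) ^ k) :
    magnus (fun p => v (Chord.last p)) a ∈ coeffFiltration (strandChordIdeal v) k := by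
  refine map_pow_mem (coeffFiltration_mul (strandChordIdeal v))
    (magnus fun p => v (Chord.last p)).toRingHom (fun a i => mem_pow_zero _) (fun a ha i => ?_) k ha
  refine mem_pow_one.2 (mem_ker_map_mk.1 ?_ i)
  refine map_groupIdeal_mem _ ?_ ha
  rintro _ ⟨q, hq, rfl⟩
  have e : (magnus fun p => v (Chord.last p)).toRingHom
      (MonoidAlgebra.of ℚ _ (FreeGroup.of q)) - 1 = C (v (Chord.last q)) * PowerSeries.X := by
    rw [← magnus_of_sub_one (fun p => v (Chord.last p)), map_sub, map_one]
    rfl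
  rw [e]
  refine Ideal.mul_mem_right _ _ (mem_ker_map_mk.2 fun i => ?_)
  rw [coeff_C]
  split_ifs
  · rw [Chord.last_of_ge hq]
    exact mem_strandChordIdeal v trivial
  · exact zero_mem _

/-- A linear map from the group algebra of the mixed pure braid group to power series of chord
diagrams which respects the filtrations and which is, to leading order, compatible with
multiplication by generators. -/
structure IsExpansion {m n : ℕ} (L : MixedGroupAlgebra m n →ₗ[ℚ] (ChordAlgebra m n)⟦X⟧) :
    Prop where
  map_one : L 1 = 1
  mem_order (k : ℕ) (z : MixedGroupAlgebra m n) (hz : z ∈ mixedI m n ^ k) :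
    L z ∈ orderFiltration (ChordAlgebra m n) k
  coeff_mul (x : Chord m n) (k : ℕ) (z : MixedGroupAlgebra m n) (hz : z ∈ mixedI m n ^ k) :
    coeff (k + 1) (L ((MonoidAlgebra.of ℚ _ (chordBraid x) - 1) * z)) = chord x * coeff k (L z)
  mem_coeff (k : ℕ) (z : MixedGroupAlgebra m n) (hz : z ∈ mixedJ m n ^ k) :
    L z ∈ coeffFiltration (strandChordIdeal (chord (m := m) (n := n))) k

theorem mixedJ_le (m n : ℕ) : mixedJ m n ≤ mixedI m n := by
  rw [mixedJ_eq]
  exact groupIdeal_le fun g _ => mem_pow_one.1 (of_sub_one_mem g)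

/-- Without strands there are no chords, so compatibility with generators is vacuous, and the
augmentation kills all positive powers of both ideals. -/
theorem isExpansion_zero (m : ℕ) :
    IsExpansion ((Algebra.linearMap ℚ ((ChordAlgebra m 0)⟦X⟧)).comp
      (augmentation (MixedPureBraidGroup m 0)).toLinearMap) where
  map_one := by simp
  mem_order k z hz := by
    cases k with
    | zero => exact fun i hi => absurd hi (Nat.not_lt_zero i)
    | succ k =>
      have h : augmentation (MixedPureBraidGroup m 0) z = 0 := mem_of_mem_pow_succ hz
      rw [LinearMap.comp_apply, AlgHom.toLinearMap_apply, h, _root_.map_zero]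
      exact zero_mem _
  coeff_mul x := by
    cases x with
    | a i j => exact j.elim0
    | c i j h => exact j.elim0
  mem_coeff k z hz := by
    cases k with
    | zero => exact fun i => mem_pow_zero _
    | succ k =>
      have h : augmentation (MixedPureBraidGroup m 0) z = 0 :=
        mixedJ_le m 0 (mem_of_mem_pow_succ hz)
      rw [LinearMap.comp_apply, AlgHom.toLinearMap_apply, h, _root_.map_zero]
      exact zero_mem _

/-! ### The expansion of combed braids -/

section Step

variable {m n : ℕ}

/-- Adding a strand to chord diagrams. -/
noncomputable def chordInc (m n : ℕ) : ChordAlgebra m n →ₐ[ℚ] ChordAlgebra m (n + 1) :=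
  chordLift _ satisfiesDK_chord.comp_castSucc

theorem chordInc_chord (x : Chord m n) : chordInc m n (chord x) = chord x.castSucc :=
  chordLift_chord _ _ x

/-- The expansion of the combed braids. -/
noncomputable def combExpansion (L : MixedGroupAlgebra m n →ₗ[ℚ] (ChordAlgebra m n)⟦X⟧) :
    MixedGroupAlgebra m (n + 1) →ₗ[ℚ] (ChordAlgebra m (n + 1))⟦X⟧ :=
  (Finsupp.linearCombination ℚ fun γ =>
    magnus (fun p => chord (Chord.last p)) (MonoidAlgebra.of ℚ _ ((combEquiv m n).symm γ).1) *
      PowerSeries.map (chordInc m n : ChordAlgebra m n →+* ChordAlgebra m (n + 1))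
        (L (MonoidAlgebra.of ℚ _ ((combEquiv m n).symm γ).2))).comp
    (MonoidAlgebra.coeffLinearEquiv ℚ).toLinearMap

theorem combExpansion_of (L : MixedGroupAlgebra m n →ₗ[ℚ] (ChordAlgebra m n)⟦X⟧)
    (w : FreeGroup (Fin (m + n))) (g : MixedPureBraidGroup m n) :
    combExpansion L (MonoidAlgebra.of ℚ _ (freeHom m n w * stabHom m n g)) =
      magnus (fun p => chord (Chord.last p)) (MonoidAlgebra.of ℚ _ w) *
        PowerSeries.map (chordInc m n : ChordAlgebra m n →+* ChordAlgebra m (n + 1))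
          (L (MonoidAlgebra.of ℚ _ g)) := by
  rw [← combEquiv_apply]
  simp [combExpansion, MonoidAlgebra.coeffLinearEquiv]

theorem map_smul_series (c : ℚ) (f : (ChordAlgebra m n)⟦X⟧) :
    PowerSeries.map (chordInc m n : ChordAlgebra m n →+* ChordAlgebra m (n + 1)) (c • f) =
      c • PowerSeries.map (chordInc m n : ChordAlgebra m n →+* ChordAlgebra m (n + 1)) f := by
  ext i
  simp

/-- The defining formula on group elements is bilinear. Since powers of the ideals are spanned by
such products of elements of the two group algebras, this is all that has to be known about the map.
-/
theorem combExpansion_mul (L : MixedGroupAlgebra m n →ₗ[ℚ] (ChordAlgebra m n)⟦X⟧)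
    (a : MonoidAlgebra ℚ (FreeGroup (Fin (m + n)))) (b : MixedGroupAlgebra m n) :
    combExpansion L (groupAlgebraMap (freeHom m n) a * groupAlgebraMap (stabHom m n) b) =
      magnus (fun p => chord (Chord.last p)) a *
        PowerSeries.map (chordInc m n : ChordAlgebra m n →+* ChordAlgebra m (n + 1)) (L b) := by
  induction a using MonoidAlgebra.induction_on with
  | of w =>
    induction b using MonoidAlgebra.induction_on with
    | of g => rw [groupAlgebraMap_of, groupAlgebraMap_of, ← map_mul, combExpansion_of]
    | add x y hx hy => simp only [map_add, mul_add, hx, hy]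
    | smul r x hx => rw [map_smul, map_smul, mul_smul_comm, map_smul, hx, map_smul_series,
        mul_smul_comm]
  | add x y hx hy => simp only [map_add, add_mul, hx, hy]
  | smul r x hx => simp only [map_smul, smul_mul_assoc, hx]

theorem combFiltration_induction {F G Γ : Type*} [Group F] [Group G] [Group Γ] {κ : F →* Γ}
    {ι : G →* Γ} {𝔞 : Ideal (MonoidAlgebra ℚ F)} {𝔟 : Ideal (MonoidAlgebra ℚ G)} {k : ℕ}
    {p : MonoidAlgebra ℚ Γ → Prop} (h0 : p 0) (hadd : ∀ x y, p x → p y → p (x + y))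
    (h : ∀ i j, i + j = k → ∀ a ∈ 𝔞 ^ i, ∀ b ∈ 𝔟 ^ j,
      p (groupAlgebraMap κ a * groupAlgebraMap ι b))
    {z} (hz : z ∈ combFiltration κ ι 𝔞 𝔟 k) : p z := by
  refine AddSubmonoid.closure_induction (motive := fun z _ => p z) ?_ h0
    (fun x y _ _ => hadd x y) hz
  rintro _ ⟨i, j, hij, a, ha, b, hb, rfl⟩
  exact h i j hij a ha b hb

theorem exists_comb (γ : MixedPureBraidGroup m (n + 1)) :
    ∃ w g, γ = freeHom m n w * stabHom m n g := by
  obtain ⟨⟨w, g⟩, rfl⟩ := (combEquiv m n).surjective γ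
  exact ⟨w, g, rfl⟩

/-- Every mixed pure braid acts unipotently on the augmentation filtration of the free group, so the
splitting of powers applies with all generators of `P_{m,n}`. -/
theorem mixedI_pow_induction {k : ℕ} {p : MixedGroupAlgebra m (n + 1) → Prop} (h0 : p 0)
    (hadd : ∀ x y, p x → p y → p (x + y))
    (h : ∀ i j, i + j = k → ∀ a ∈ augmentationIdeal (FreeGroup (Fin (m + n))) ^ i,
      ∀ b ∈ mixedI m n ^ j,
      p (groupAlgebraMap (freeHom m n) a * groupAlgebraMap (stabHom m n) b))
    {z} (hz : z ∈ mixedI m (n + 1) ^ k) : p z := by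
  rw [mixedI_succ] at hz
  refine combFiltration_induction h0 hadd ?_ (groupIdeal_pow_le_combFiltration
    (φ := mixedArtin m n) freeHom_mixedArtin exists_comb
    (fun g a => autMap_mem_freeGens _) (fun g _ i a => autMap_sub_mem_freeGens g i) k hz)
  rw [← augmentationIdeal_free, ← mixedI_eq]
  exact h

/-- The second factor is now generated by the `τ_{ij}` alone. This is essential, since unipotence on
the powers of the ideal of strand letters is known only for them. -/
theorem mixedJ_pow_induction {k : ℕ} {p : MixedGroupAlgebra m (n + 1) → Prop} (h0 : p 0)
    (hadd : ∀ x y, p x → p y → p (x + y))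
    (h : ∀ i j, i + j = k → ∀ a ∈ groupIdeal (strandGens m n) ^ i, ∀ b ∈ mixedJ m n ^ j,
      p (groupAlgebraMap (freeHom m n) a * groupAlgebraMap (stabHom m n) b))
    {z} (hz : z ∈ mixedJ m (n + 1) ^ k) : p z := by
  rw [mixedJ_succ] at hz
  refine combFiltration_induction h0 hadd ?_ (groupIdeal_pow_le_combFiltration
    (φ := mixedArtin m n) freeHom_mixedArtin exists_comb
    (fun g a => autMap_mem_strandGens g) (fun g hg i a => autMap_sub_mem_strandGens hg i) k hz)
  rw [← mixedJ_eq]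
  exact h

/-- The chords of `n + 1` strands, up to the order of the endpoints. -/
theorem chord_succ_cases {p : Chord m (n + 1) → Prop}
    (hsymm : ∀ i j h, p (.c i j h) → p (.c j i h.symm)) (hcast : ∀ x : Chord m n, p x.castSucc)
    (hlast : ∀ q : Fin (m + n), p (Chord.last q)) (x : Chord m (n + 1)) : p x := by
  cases x with
  | a i j =>
    induction j using Fin.lastCases with
    | last => rw [← Chord.last_castAdd]; exact hlast _
    | cast j => exact hcast (.a i j)
  | c i j h =>
    induction j using Fin.lastCases with
    | last =>
      obtain ⟨i, rfl⟩ := Fin.exists_castSucc_eq.2 h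
      rw [← Chord.last_natAdd]
      exact hlast _
    | cast j =>
      induction i using Fin.lastCases with
      | last =>
        refine hsymm _ _ h.symm ?_
        rw [← Chord.last_natAdd]
        exact hlast _
      | cast i => exact hcast (.c i j (by simpa using h))

/-- Commuting `g` past the free factor splits the product into a term where `g` acts on `a` and a
term where `g - 1` multiplies `b`. -/
theorem of_stabHom_mul (g : MixedPureBraidGroup m n)
    (a : MonoidAlgebra ℚ (FreeGroup (Fin (m + n)))) (b : MixedGroupAlgebra m n) :
    (MonoidAlgebra.of ℚ _ (stabHom m n g) - 1) *
        (groupAlgebraMap (freeHom m n) a * groupAlgebraMap (stabHom m n) b) =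
      groupAlgebraMap (freeHom m n) (autMap (mixedArtin m n g) a - a) *
          groupAlgebraMap (stabHom m n) (MonoidAlgebra.of ℚ _ g * b) +
        groupAlgebraMap (freeHom m n) a *
          groupAlgebraMap (stabHom m n) ((MonoidAlgebra.of ℚ _ g - 1) * b) := by
  rw [sub_mul, ← mul_assoc, groupAlgebraMap_mul_comm freeHom_mixedArtin]
  simp only [map_sub, map_mul, _root_.map_one, groupAlgebraMap_of]
  noncomm_ring

variable {L : MixedGroupAlgebra m n →ₗ[ℚ] (ChordAlgebra m n)⟦X⟧}

theorem IsExpansion.map_mem_order (hL : IsExpansion L) (k : ℕ) {z : MixedGroupAlgebra m n}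
    (hz : z ∈ mixedI m n ^ k) :
    PowerSeries.map (chordInc m n : ChordAlgebra m n →+* ChordAlgebra m (n + 1)) (L z) ∈
      orderFiltration (ChordAlgebra m (n + 1)) k := by
  intro i hi
  rw [coeff_map, hL.mem_order k z hz i hi, _root_.map_zero]

theorem IsExpansion.coeff_combExpansion (hL : IsExpansion L) {i j : ℕ}
    {a : MonoidAlgebra ℚ (FreeGroup (Fin (m + n)))} {b : MixedGroupAlgebra m n}
    (ha : a ∈ augmentationIdeal (FreeGroup (Fin (m + n))) ^ i) (hb : b ∈ mixedI m n ^ j) :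
    coeff (i + j) (combExpansion L
      (groupAlgebraMap (freeHom m n) a * groupAlgebraMap (stabHom m n) b)) =
      coeff i (magnus (fun p => chord (Chord.last p)) a) * chordInc m n (coeff j (L b)) := by
  rw [combExpansion_mul, coeff_mul_of_mem (magnus_mem_orderFiltration _ i ha)
    (hL.map_mem_order j hb), coeff_map]
  rfl

/-- The filtration properties follow from the splittings of the powers of both ideals. Compatibility
with a generator is immediate for a loop of the last strand, since the Magnus expansion is
multiplicative; for an old generator it is the comparison of Artin's action with the commutator. -/
theorem isExpansion_combExpansion (hL : IsExpansion L) : IsExpansion (combExpansion L) where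
  map_one := by
    have := combExpansion_mul L 1 1
    rwa [_root_.map_one, _root_.map_one, _root_.map_one, hL.map_one, _root_.map_one, mul_one,
      mul_one] at this
  mem_order k z hz := by
    refine mixedI_pow_induction (p := fun z => combExpansion L z ∈ orderFiltration _ k) ?_ ?_ ?_ hz
    · rw [_root_.map_zero]; exact zero_mem _
    · intro x y hx hy; rw [map_add]; exact add_mem hx hy
    · rintro i j rfl a ha b hb
      rw [combExpansion_mul]
      exact orderFiltration_mul _ _ _ _ (magnus_mem_orderFiltration _ i ha)
        (hL.map_mem_order j hb)
  mem_coeff k z hz := by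
    refine mixedJ_pow_induction (p := fun z => combExpansion L z ∈
      coeffFiltration (strandChordIdeal chord) k) ?_ ?_ ?_ hz
    · rw [_root_.map_zero]; exact zero_mem _
    · intro x y hx hy; rw [map_add]; exact add_mem hx hy
    · rintro i j rfl a ha b hb
      rw [combExpansion_mul]
      refine coeffFiltration_mul _ _ _ _ _ (coeff_magnus_mem_strandChordIdeal chord i ha)
        fun s => ?_
      rw [coeff_map]
      refine map_mem_pow (chordInc m n : ChordAlgebra m n →+* ChordAlgebra m (n + 1))
        (fun y hy => map_strandChordIdeal_mem _ (fun x hx => ?_) hy) j (hL.mem_coeff j b hb s)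
      have e : (chordInc m n : ChordAlgebra m n →+* ChordAlgebra m (n + 1)) (chord x) =
          chord x.castSucc := chordInc_chord x
      rw [e]
      refine mem_strandChordIdeal _ ?_
      cases x with
      | a i j => exact hx
      | c i j h => trivial
  coeff_mul x k z hz := by
    refine mixedI_pow_induction (p := fun z => coeff (k + 1) (combExpansion L
      ((MonoidAlgebra.of ℚ _ (chordBraid x) - 1) * z)) =
        chord x * coeff k (combExpansion L z)) ?_ ?_ ?_ hz
    · simp
    · intro x y hx hy; rw [mul_add, map_add, map_add, hx, hy, map_add, map_add, mul_add]
    · rintro i j rfl a ha b hb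
      induction x using chord_succ_cases with
      | hsymm r s h ih => rwa [chordBraid_symm, satisfiesDK_chord.symm] at ih
      | hcast x =>
        rw [← stabHom_chordBraid, of_stabHom_mul, map_add, map_add, hL.coeff_combExpansion ha hb]
        have hsub : autMap (mixedArtin m n (chordBraid x)) a - a ∈
            augmentationIdeal (FreeGroup (Fin (m + n))) ^ (i + 1) := by
          rw [augmentationIdeal_free] at ha ⊢
          exact autMap_sub_mem_freeGens _ i ha
        have hgb : (MonoidAlgebra.of ℚ _ (chordBraid x) - 1) * b ∈ mixedI m n ^ (j + 1) := by
          rw [add_comm j 1]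
          exact mul_mem_pow_add (of_sub_one_mem _) hb
        have h1 := hL.coeff_combExpansion hsub (Ideal.mul_mem_left _
          (MonoidAlgebra.of ℚ _ (chordBraid x)) hb)
        have h2 := hL.coeff_combExpansion ha hgb
        -- Multiplication by a group element does not affect leading coefficients.
        have h3 : coeff j (L (MonoidAlgebra.of ℚ _ (chordBraid x) * b)) = coeff j (L b) := by
          have := hL.mem_order (j + 1) _ hgb j (Nat.lt_succ_self j)
          rwa [sub_mul, one_mul, map_sub, map_sub, sub_eq_zero] at this
        -- The first summand gives the commutator of the chord with the coefficient of `a`, the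
        -- second the coefficient of `a` times the chord. Their sum is the chord times the
        -- coefficient of `a`, in front of that of `b`.
        rw [show i + j + 1 = i + 1 + j by omega, h1, show i + 1 + j = i + (j + 1) by omega, h2, h3,
          hL.coeff_mul x j b hb, _root_.map_mul, chordInc_chord,
          coeff_magnus_autMap_sub satisfiesDK_chord x i ha]
        noncomm_ring
      | hlast q =>
        rw [← freeHom_of, ← groupAlgebraMap_of, ← _root_.map_one (groupAlgebraMap (freeHom m n)),
          ← map_sub, ← mul_assoc, ← _root_.map_mul, hL.coeff_combExpansion ha hb]
        have h1 := hL.coeff_combExpansion (i := 1 + i)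
          (mul_mem_pow_add (of_sub_one_mem (FreeGroup.of q)) ha) hb
        rw [show i + j + 1 = 1 + i + j by omega, h1,
          coeff_magnus_mul _ (of_sub_one_mem (FreeGroup.of q)) ha, coeff_magnus_of_sub_one,
          mul_assoc]

end Step

theorem exists_isExpansion (m n : ℕ) :
    ∃ L : MixedGroupAlgebra m n →ₗ[ℚ] (ChordAlgebra m n)⟦X⟧, IsExpansion L := by
  induction n with
  | zero => exact ⟨_, isExpansion_zero m⟩
  | succ n ih =>
    obtain ⟨L, hL⟩ := ih
    exact ⟨_, isExpansion_combExpansion hL⟩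

end MixedBraid

namespace MixedBraid

/-! ### The relations in the associated graded algebra -/

theorem augmentation_groupAlgebraMap {G H : Type*} [Group G] [Group H] (f : G →* H)
    (z : MonoidAlgebra ℚ G) : augmentation H (groupAlgebraMap f z) = augmentation G z := by
  have : (augmentation H).comp (groupAlgebraMap f) = augmentation G :=
    groupAlgebra_hom_ext fun w => by
      rw [AlgHom.comp_apply, groupAlgebraMap_of, augmentation_of, augmentation_of]
  exact DFunLike.congr_fun this z

theorem groupAlgebraMap_mem_pow {G H : Type*} [Group G] [Group H] (f : G →* H) (k : ℕ)
    {z : MonoidAlgebra ℚ G} (hz : z ∈ augmentationIdeal G ^ k) :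
    groupAlgebraMap f z ∈ augmentationIdeal H ^ k :=
  map_mem_pow (groupAlgebraMap f : MonoidAlgebra ℚ G →+* MonoidAlgebra ℚ H)
    (fun a ha => (augmentation_groupAlgebraMap f a).trans ha) k hz

theorem commute_mk_iff {R : Type*} [Ring R] {K : Ideal R} [K.IsTwoSided] {x y : R} :
    Commute (Ideal.Quotient.mk K x) (Ideal.Quotient.mk K y) ↔ x * y - y * x ∈ K := by
  rw [commute_iff_eq, ← map_mul, ← map_mul, Ideal.Quotient.eq]

theorem commute_mk_add {R : Type*} [Ring R] {K : Ideal R} [K.IsTwoSided] {x y z : R}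
    (h : (x + y) * z - z * (x + y) ∈ K) :
    Commute (Ideal.Quotient.mk K x + Ideal.Quotient.mk K y) (Ideal.Quotient.mk K z) := by
  rw [← map_add]
  exact commute_mk_iff.2 h

/-- The relations of `dk_{m,n}` hold for the generators of the mixed pure braid group, up to third
order. -/
theorem satisfiesDK_mk_cube (m n : ℕ) : SatisfiesDK fun x : Chord m n =>
    Ideal.Quotient.mk (mixedI m n ^ 3) (MonoidAlgebra.of ℚ _ (chordBraid x) - 1) := by
  induction n with
  | zero =>
    constructor
    · intro i; exact i.elim0
    · intro _ _ i; exact i.elim0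
    · intro _ i; exact i.elim0
    · intro i; exact i.elim0
    · intro _ i; exact i.elim0
    · intro _ i; exact i.elim0
    · intro i; exact i.elim0
  | succ n ih =>
    refine satisfiesDK_succ (fun i j h => by rw [chordBraid_symm]) ?_ fun x p => ?_
    -- Relations among old chords are transported along the homomorphism that adds a strand.
    · have h := ih.map (Ideal.quotientMap (mixedI m (n + 1) ^ 3)
        (groupAlgebraMap (stabHom m n) : MixedGroupAlgebra m n →+* MixedGroupAlgebra m (n + 1))
        (fun z hz => Ideal.mem_comap.2 (groupAlgebraMap_mem_pow (stabHom m n) 3 hz)))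
      convert h using 2 with x
      rw [Ideal.quotientMap_mk, ← stabHom_chordBraid, ← groupAlgebraMap_of]
      simp
    · set κ := groupAlgebraMap (freeHom m n) with hκ
      set X : MonoidAlgebra ℚ (FreeGroup (Fin (m + n))) :=
        MonoidAlgebra.of ℚ _ (FreeGroup.of p) - 1 with hX
      set D : MonoidAlgebra ℚ (FreeGroup (Fin (m + n))) :=
        x.link p 0 fun q => MonoidAlgebra.of ℚ _ (FreeGroup.of q) - 1 with hD
      have hlast (q : Fin (m + n)) : MonoidAlgebra.of ℚ _ (chordBraid (Chord.last q)) - 1 =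
          κ (MonoidAlgebra.of ℚ _ (FreeGroup.of q) - 1) := by
        rw [map_sub, map_one, hκ, groupAlgebraMap_of, freeHom_of]
      have hlink : (x.link p 0 fun q => Ideal.Quotient.mk (mixedI m (n + 1) ^ 3)
          (MonoidAlgebra.of ℚ _ (chordBraid (Chord.last q)) - 1)) =
          Ideal.Quotient.mk (mixedI m (n + 1) ^ 3) (κ D) := by
        rw [Chord.map_link (fun z => Ideal.Quotient.mk (mixedI m (n + 1) ^ 3) (κ z)) x p 0 fun q =>
          MonoidAlgebra.of ℚ (FreeGroup (Fin (m + n))) (FreeGroup.of q) - 1, map_zero, map_zero]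
        simp only [hlast]
      rw [hlink, hlast, ← hX, ← stabHom_chordBraid]
      refine commute_mk_add ?_
      set γ := MonoidAlgebra.of ℚ _ (stabHom m n (chordBraid x))
      set φ := autMap (mixedArtin m n (chordBraid x)) with hφ
      have hcomm : γ * κ X = κ (φ X) * γ := groupAlgebraMap_mul_comm freeHom_mixedArtin _ _
      -- The commutator relation of the semidirect product splits off two terms of third order: a
      -- difference of second order times `γ - 1`, and the error in the third-order description of
      -- the action.
      have e : (γ - 1 + κ D) * κ X - κ X * (γ - 1 + κ D) =
          κ (φ X - X) * (γ - 1) + κ (φ X - X + (D * X - X * D)) := by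
        simp only [map_add, map_sub, map_mul, add_mul, sub_mul, mul_add, mul_sub, hcomm]
        noncomm_ring
      rw [e]
      refine add_mem ?_ (groupAlgebraMap_mem_pow _ 3 ?_)
      · refine mul_mem_pow_add (i := 2) (j := 1) (groupAlgebraMap_mem_pow _ 2 ?_)
          (of_sub_one_mem _)
        have h1 : X ∈ augmentationIdeal (FreeGroup (Fin (m + n))) ^ 1 := of_sub_one_mem _
        rw [augmentationIdeal_free] at h1 ⊢
        exact autMap_sub_mem_freeGens _ 1 h1
      · have h := autMap_chordBraid_sub_mem x p
        have e : autMap (mixedArtin m n (chordBraid x)) (MonoidAlgebra.of ℚ _ (FreeGroup.of p)) -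
            MonoidAlgebra.of ℚ _ (FreeGroup.of p) = φ X - X := by
          rw [hX, map_sub, map_one, sub_sub_sub_cancel_right]
        rwa [e] at h

/-! ### Homogeneous elements of completions -/

namespace DegreeCompletion

section Single

variable {A : ℕ → Type*} [∀ k, AddCommGroup (A k)]

theorem single_same (k : ℕ) (x : A k) : single k x k = x := Pi.single_eq_same _ _

theorem single_of_ne {i k : ℕ} (h : k ≠ i) (x : A i) : single i x k = 0 := Pi.single_eq_of_ne h _

theorem single_zero (k : ℕ) : (single k 0 : DegreeCompletion A) = 0 := Pi.single_zero _

theorem single_add (k : ℕ) (x y : A k) : single k (x + y) = single k x + single k y :=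
  Pi.single_add _ _ _

theorem single_neg (k : ℕ) (x : A k) : single k (-x) = -single k x := Pi.single_neg _ _

theorem single_smul [∀ k, Module ℚ (A k)] (k : ℕ) (c : ℚ) (x : A k) :
    single k (c • x) = c • single k x := Pi.single_smul _ _ _

variable [DirectSum.GSemiring A]

theorem single_mul_single {i j : ℕ} (x : A i) (y : A j) :
    (single i x * single j y : DegreeCompletion A) = single (i + j) (GradedMonoid.GMul.mul x y) := by
  refine ext_of fun k => ?_
  rw [of_mul_apply]
  by_cases hk : k = i + j
  · subst hk
    rw [Finset.sum_eq_single (i, j), single_same, single_same, single_same, DirectSum.of_mul_of]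
    · rintro ⟨a, b⟩ hp hne
      by_cases ha : a = i
      · subst ha
        have hb : b ≠ j := fun h => hne (by rw [h])
        simp only [single_of_ne hb, map_zero, mul_zero]
      · simp only [single_of_ne ha, map_zero, zero_mul]
    · intro h
      exact absurd (Finset.HasAntidiagonal.mem_antidiagonal.2 (rfl : i + j = i + j)) h
  · rw [single_of_ne hk, map_zero]
    refine Finset.sum_eq_zero ?_
    rintro ⟨a, b⟩ hp
    rw [Finset.HasAntidiagonal.mem_antidiagonal] at hp
    by_cases ha : a = i
    · subst ha
      have hb : b ≠ j := fun h => hk (by rw [← hp, h])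
      simp only [single_of_ne hb, map_zero, mul_zero]
    · simp only [single_of_ne ha, map_zero, zero_mul]

end Single

end DegreeCompletion

open DegreeCompletion

/-! ### Relations in the completed associated graded algebra -/

section AssociatedGraded

variable {R : Type*} [Ring R] {I : Ideal R}

theorem GradedPiece.mk_zero (k : ℕ) : GradedPiece.mk (I := I) k 0 = 0 := rfl

theorem GradedPiece.mk_add {k : ℕ} (x y : ↥(I ^ k)) :
    GradedPiece.mk k (x + y) = GradedPiece.mk k x + GradedPiece.mk k y := rfl

theorem GradedPiece.mk_smul [Algebra ℚ R] {k : ℕ} (c : ℚ) (x : ↥(I ^ k)) :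
    GradedPiece.mk k (c • x) = c • GradedPiece.mk k x := rfl

variable [I.IsTwoSided]

theorem single_mk_mul_single_mk {i j : ℕ} (x : ↥(I ^ i)) (y : ↥(I ^ j)) :
    (single i (GradedPiece.mk i x) * single j (GradedPiece.mk j y) :
      DegreeCompletion (GradedPiece I)) =
      single (i + j) (GradedPiece.mk (i + j) ⟨(x : R) * y, mul_mem_pow_add x.2 y.2⟩) :=
  single_mul_single _ _

/-- A bracket of two classes of degree one lives in `I ^ 2 / I ^ 3`, so it vanishes once the bracket
of representatives vanishes modulo `I ^ 3`. -/
theorem single_mk_lie {x y : ↥(I ^ 1)}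
    (h : ⁅Ideal.Quotient.mk (I ^ 3) (x : R), Ideal.Quotient.mk (I ^ 3) (y : R)⁆ = 0) :
    ⁅(single 1 (GradedPiece.mk 1 x) : DegreeCompletion (GradedPiece I)),
      single 1 (GradedPiece.mk 1 y)⁆ = 0 := by
  rw [lie_eq_zero_iff_commute, commute_mk_iff] at h
  rw [Ring.lie_def, single_mk_mul_single_mk, single_mk_mul_single_mk, sub_eq_zero]
  congr 1
  exact GradedPiece.mk_eq_mk.2 h

/-- Relations up to third order hold in the associated graded algebra. -/
theorem satisfiesDK_single {m n : ℕ} (e : Chord m n → R) (he : ∀ x, e x ∈ I ^ 1)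
    (h : SatisfiesDK fun x => Ideal.Quotient.mk (I ^ 3) (e x))
    (hsymm : ∀ i j hij, e (.c i j hij) = e (.c j i hij.symm)) :
    SatisfiesDK fun x =>
      (single 1 (GradedPiece.mk 1 ⟨e x, he x⟩) : DegreeCompletion (GradedPiece I)) where
  symm i j hij := by
    congr 2
    exact Subtype.ext (hsymm i j hij)
  comm_aa i k j l h1 h2 := single_mk_lie (h.comm_aa i k j l h1 h2)
  comm_ac i j k l h1 h2 h3 := single_mk_lie (h.comm_ac i j k l h1 h2 h3)
  comm_cc i j k l h1 h2 h3 h4 h5 h6 := single_mk_lie (h.comm_cc i j k l h1 h2 h3 h4 h5 h6)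
  fourT_a i j k h1 := by
    rw [← single_add, ← GradedPiece.mk_add]
    exact single_mk_lie (h.fourT_a i j k h1)
  fourT_c i j k h1 := by
    rw [← single_add, ← GradedPiece.mk_add]
    exact single_mk_lie (h.fourT_c i j k h1)
  fourT_ccc i j k h1 h2 h3 := by
    rw [← single_add, ← GradedPiece.mk_add]
    exact single_mk_lie (h.fourT_ccc i j k h1 h2 h3)

end AssociatedGraded

end MixedBraid

namespace MixedBraid

open DegreeCompletion

/-! ### Algebras with the same generators as an associated graded algebra -/

section Comparison

variable {X R A : Type*} [Ring R] [Algebra ℚ R] [Ring A] [Algebra ℚ A]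

/-- The data that identify an algebra `A`, generated by the elements `u x` in degree one, with the
associated graded algebra of a two-sided ideal `I` of `R`, in such a way that `u x` corresponds to
the class of `e x`: the ideal `I` is generated by the elements `e x` and has codimension one, the
homomorphism `θ` maps `u x` to the class of `e x`, and the linear maps `ℓ k` map products of `k`
elements `e x` to the corresponding monomials and vanish on `I ^ (k + 1)`. -/
structure IsGradedComparison (I : Ideal R) [I.IsTwoSided] (e : X → R) (u : X → A)
    (θ : A →ₐ[ℚ] DegreeCompletion (GradedPiece I)) (ℓ : ℕ → R →ₗ[ℚ] A) : Prop where
  mem (x : X) : e x ∈ I ^ 1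
  adjoin : Algebra.adjoin ℚ (Set.range u) = ⊤
  exists_scalar (z : R) : ∃ c : ℚ, z - algebraMap ℚ R c ∈ I
  pow_induction (k : ℕ) (p : R → Prop) (h0 : p 0) (hadd : ∀ x y, p x → p y → p (x + y))
    (hneg : ∀ x, p x → p (-x)) (hmul : ∀ x, ∀ y ∈ I ^ k, p (e x * y)) (z : R)
    (hz : z ∈ I ^ (k + 1)) : p z
  map_gen (x : X) : θ (u x) = single 1 (GradedPiece.mk 1 ⟨e x, mem x⟩)
  ℓ_one : ℓ 0 1 = 1
  ℓ_eq_zero (k : ℕ) (z : R) (hz : z ∈ I ^ (k + 1)) : ℓ k z = 0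
  ℓ_mul (k : ℕ) (x : X) (z : R) (hz : z ∈ I ^ k) : ℓ (k + 1) (e x * z) = u x * ℓ k z

variable {I : Ideal R} [I.IsTwoSided] {e : X → R} {u : X → A}
  {θ : A →ₐ[ℚ] DegreeCompletion (GradedPiece I)} {ℓ : ℕ → R →ₗ[ℚ] A}

theorem single_mk_algebraMap (c : ℚ) :
    single 0 (GradedPiece.mk 0 ⟨algebraMap ℚ R c, mem_pow_zero _⟩) =
      algebraMap ℚ (DegreeCompletion (GradedPiece I)) c := by
  have h : (⟨algebraMap ℚ R c, mem_pow_zero _⟩ : ↥(I ^ 0)) = c • ⟨1, mem_pow_zero _⟩ :=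
    Subtype.ext (Algebra.algebraMap_eq_smul_one c)
  rw [h, GradedPiece.mk_smul, single_smul, Algebra.algebraMap_eq_smul_one]
  rfl

namespace IsGradedComparison

/-- Every homogeneous element of `A` comes from an element of a power of `I`. -/
theorem exists_of_mem_monomialDegree (h : IsGradedComparison I e u θ ℓ) {k : ℕ} {y : A}
    (hy : y ∈ monomialDegree u k) :
    ∃ s : ↥(I ^ k), θ y = single k (GradedPiece.mk k s) ∧ ℓ k s = y := by
  have hadd {k : ℕ} {y y' : A} :
      (∃ s : ↥(I ^ k), θ y = single k (GradedPiece.mk k s) ∧ ℓ k s = y) →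
      (∃ s : ↥(I ^ k), θ y' = single k (GradedPiece.mk k s) ∧ ℓ k s = y') →
      ∃ s : ↥(I ^ k), θ (y + y') = single k (GradedPiece.mk k s) ∧ ℓ k s = y + y' := by
    rintro ⟨s, hs, hs'⟩ ⟨t, ht, ht'⟩
    refine ⟨s + t, ?_, ?_⟩
    · rw [map_add, hs, ht, GradedPiece.mk_add, single_add]
    · rw [Submodule.coe_add, map_add, hs', ht']
  unfold monomialDegree at hy
  induction hy using Submodule.pow_induction_on_left' with
  | algebraMap r =>
    refine ⟨⟨algebraMap ℚ R r, mem_pow_zero _⟩, ?_, ?_⟩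
    · rw [single_mk_algebraMap, AlgHom.commutes]
    · change ℓ 0 (algebraMap ℚ R r) = _
      rw [Algebra.algebraMap_eq_smul_one, map_smul, h.ℓ_one, Algebra.algebraMap_eq_smul_one]
  | add x y i hx hy ihx ihy => exact hadd ihx ihy
  | mem_mul y hy i z hz ih =>
    obtain ⟨s, hs, hs'⟩ := ih
    induction hy using Submodule.span_induction with
    | mem y hy =>
      obtain ⟨x, rfl⟩ := hy
      have hmem : e x * (s : R) ∈ I ^ (i + 1) := by
        rw [add_comm]; exact mul_mem_pow_add (h.mem x) s.2
      refine ⟨⟨e x * s, hmem⟩, ?_, ?_⟩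
      · rw [map_mul, h.map_gen, hs, single_mk_mul_single_mk]
        -- The product has degree `1 + i` instead of `i + 1`, and the type of the graded piece
        -- depends on this. Generalizing the index allows the substitution.
        have key (j : ℕ) (hj : j = i + 1) (h' : e x * (s : R) ∈ I ^ j) :
            (single j (GradedPiece.mk j ⟨e x * s, h'⟩) : DegreeCompletion (GradedPiece I)) =
              single (i + 1) (GradedPiece.mk (i + 1) ⟨e x * s, hmem⟩) := by
          subst hj; rfl
        exact key _ (add_comm _ _) _
      · rw [h.ℓ_mul i x s s.2, hs']
    | zero =>
      refine ⟨0, ?_, ?_⟩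
      · rw [zero_mul, map_zero, GradedPiece.mk_zero, single_zero]
      · rw [zero_mul, Submodule.coe_zero, map_zero]
    | add y y' _ _ ihy ihy' => rw [add_mul]; exact hadd ihy ihy'
    | smul c y _ ihy =>
      obtain ⟨t, ht, ht'⟩ := ihy
      refine ⟨c • t, ?_, ?_⟩
      · rw [smul_mul_assoc, map_smul, ht, GradedPiece.mk_smul, single_smul]
      · change ℓ _ (c • (t : R)) = _
        rw [smul_mul_assoc, map_smul, ht']

/-- Every class in `I ^ k / I ^ (k + 1)` comes from a homogeneous element of `A`. -/
theorem exists_mem_monomialDegree (h : IsGradedComparison I e u θ ℓ) {k : ℕ} {z : R}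
    (hz : z ∈ I ^ k) :
    ∃ y ∈ monomialDegree u k, θ y = single k (GradedPiece.mk k ⟨z, hz⟩) := by
  induction k generalizing z with
  | zero =>
    obtain ⟨c, hc⟩ := h.exists_scalar z
    refine ⟨algebraMap ℚ A c, ?_, ?_⟩
    · rw [monomialDegree, pow_zero]
      exact Submodule.mem_one.2 ⟨c, rfl⟩
    · rw [AlgHom.commutes, ← single_mk_algebraMap]
      congr 1
      refine GradedPiece.mk_eq_mk.2 (mem_pow_one.2 ?_)
      rw [← neg_mem_iff, neg_sub]
      exact hc
  | succ k ih =>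
    suffices ∃ hz : z ∈ I ^ (k + 1), ∃ y ∈ monomialDegree u (k + 1),
        θ y = single (k + 1) (GradedPiece.mk (k + 1) ⟨z, hz⟩) from this.2
    refine h.pow_induction k (fun z => ∃ hz : z ∈ I ^ (k + 1), ∃ y ∈ monomialDegree u (k + 1),
        θ y = single (k + 1) (GradedPiece.mk (k + 1) ⟨z, hz⟩)) ?_ ?_ ?_ ?_ z hz
    · refine ⟨zero_mem _, 0, zero_mem _, ?_⟩
      rw [map_zero]
      exact (single_zero _).symm
    · rintro x y ⟨hx, a, ha, hxa⟩ ⟨hy, b, hb, hyb⟩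
      refine ⟨add_mem hx hy, a + b, add_mem ha hb, ?_⟩
      rw [map_add, hxa, hyb, ← single_add]
      rfl
    · rintro x ⟨hx, a, ha, hxa⟩
      refine ⟨neg_mem hx, -a, neg_mem ha, ?_⟩
      rw [map_neg, hxa, ← single_neg]
      rfl
    · intro x y hy
      obtain ⟨b, hb, hyb⟩ := ih hy
      have hmem : e x * y ∈ I ^ (k + 1) := by
        rw [add_comm]; exact mul_mem_pow_add (h.mem x) hy
      refine ⟨hmem, u x * b, ?_, ?_⟩
      · rw [add_comm]
        exact SetLike.GradedMul.mul_mem (mem_monomialDegree_one u x) hb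
      · rw [map_mul, h.map_gen, hyb, single_mk_mul_single_mk]
        have key (j : ℕ) (hj : j = k + 1) (h' : e x * y ∈ I ^ j) :
            (single j (GradedPiece.mk j ⟨e x * y, h'⟩) : DegreeCompletion (GradedPiece I)) =
              single (k + 1) (GradedPiece.mk (k + 1) ⟨e x * y, hmem⟩) := by
          subst hj; rfl
        exact key _ (add_comm _ _) _

theorem eq_single (h : IsGradedComparison I e u θ ℓ) {k : ℕ} {y : A}
    (hy : y ∈ monomialDegree u k) : θ y = single k (θ y k) := by
  obtain ⟨s, hs, -⟩ := h.exists_of_mem_monomialDegree hy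
  rw [hs, single_same]

/-- Injectivity of `θ` in each degree: if the class of a representative `s` vanishes, then `s` lies
in `I ^ (k + 1)`, where `ℓ k` is zero, but `ℓ k s` recovers `y`. -/
theorem eq_zero_of_apply_eq_zero (h : IsGradedComparison I e u θ ℓ) {k : ℕ} {y : A}
    (hy : y ∈ monomialDegree u k) (h0 : θ y k = 0) : y = 0 := by
  obtain ⟨s, hs, hs'⟩ := h.exists_of_mem_monomialDegree hy
  rw [hs, single_same, ← GradedPiece.mk_zero, GradedPiece.mk_eq_mk] at h0
  rw [← hs', h.ℓ_eq_zero k _ (by simpa using h0)]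

theorem coe_mul_apply (f g : DegreeCompletion fun k => monomialDegree u k) (k : ℕ) :
    (((f * g) k : monomialDegree u k) : A) =
      ∑ p ∈ Finset.HasAntidiagonal.antidiagonal k, (f p.1 : A) * (g p.2 : A) := by
  have := congrArg (DirectSum.coeAlgHom fun k => monomialDegree u k) (of_mul_apply f g k)
  simpa only [map_sum, map_mul, DirectSum.coeAlgHom_of] using this

theorem sum_single_mul_single_apply {B : ℕ → Type*} [∀ k, AddCommGroup (B k)]
    [DirectSum.GSemiring B] (f g : DegreeCompletion B) (k : ℕ) :
    (∑ p ∈ Finset.HasAntidiagonal.antidiagonal k, single p.1 (f p.1) * single p.2 (g p.2) :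
      DegreeCompletion B) k = (f * g) k := by
  apply DirectSum.of_injective k
  rw [of_mul_apply]
  have hsum (s : Finset (ℕ × ℕ)) (F : ℕ × ℕ → DegreeCompletion B) :
      DirectSum.of B k ((∑ p ∈ s, F p) k) = ∑ p ∈ s, DirectSum.of B k (F p k) := by
    induction s using Finset.induction_on with
    | empty => rw [Finset.sum_empty, Finset.sum_empty]; exact map_zero _
    | insert a s ha ih => rw [Finset.sum_insert ha, Finset.sum_insert ha, of_add_apply, ih]
  rw [hsum]
  refine Finset.sum_congr rfl ?_
  rintro ⟨i, j⟩ hp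
  obtain rfl : i + j = k := by simpa using hp
  rw [single_mul_single, single_same, DirectSum.of_mul_of]

/-- The homomorphism of completions that is induced by `θ`. -/
noncomputable def completedHom (h : IsGradedComparison I e u θ ℓ) :
    (DegreeCompletion fun k => monomialDegree u k) →ₐ[ℚ] DegreeCompletion (GradedPiece I) :=
  AlgHom.ofLinearMap
    { toFun := fun f k => θ (f k : A) k
      map_add' := fun f g => funext fun k => congrFun (map_add θ (f k : A) (g k : A)) k
      map_smul' := fun c f => funext fun k => congrFun (map_smul θ c (f k : A)) k }
    (by
      have h1 : ((1 : DegreeCompletion fun k => monomialDegree u k) 0 : A) = 1 := rfl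
      funext k
      change θ ((1 : DegreeCompletion fun k => monomialDegree u k) k : A) k = _
      rcases Nat.eq_zero_or_pos k with rfl | hk
      · rw [h1, map_one]
      · have h0 : (1 : DegreeCompletion fun k => monomialDegree u k) k = 0 :=
          single_of_ne hk.ne' _
        have h0' : (1 : DegreeCompletion (GradedPiece I)) k = 0 := single_of_ne hk.ne' _
        rw [h0, h0', Submodule.coe_zero, map_zero]
        rfl)
    (fun f g => funext fun k => by
      have key : θ ((f * g) k : A) = ∑ p ∈ Finset.HasAntidiagonal.antidiagonal k,
          single p.1 (θ (f p.1 : A) p.1) * single p.2 (θ (g p.2 : A) p.2) := by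
        rw [coe_mul_apply, map_sum]
        refine Finset.sum_congr rfl fun p _ => ?_
        rw [map_mul, ← h.eq_single (f p.1).2, ← h.eq_single (g p.2).2]
      exact (congrFun key k).trans (sum_single_mul_single_apply
        (B := GradedPiece I) (fun k => θ (f k : A) k) (fun k => θ (g k : A) k) k))

theorem completedHom_apply (h : IsGradedComparison I e u θ ℓ)
    (f : DegreeCompletion fun k => monomialDegree u k) (k : ℕ) :
    h.completedHom f k = θ (f k : A) k := rfl

theorem completedHom_single (h : IsGradedComparison I e u θ ℓ) {k : ℕ} (y : monomialDegree u k) :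
    h.completedHom (single k y) = θ (y : A) := by
  rw [h.eq_single y.2]
  funext j
  rw [completedHom_apply]
  by_cases hj : j = k
  · subst hj; rw [single_same, single_same]
  · rw [single_of_ne hj, single_of_ne hj, Submodule.coe_zero, map_zero]
    rfl

theorem completedHom_injective_apply (h : IsGradedComparison I e u θ ℓ)
    {f g : DegreeCompletion fun k => monomialDegree u k} {k : ℕ}
    (hfg : h.completedHom f k = h.completedHom g k) : f k = g k := by
  rw [completedHom_apply, completedHom_apply] at hfg
  refine Subtype.ext (sub_eq_zero.1 (h.eq_zero_of_apply_eq_zero (sub_mem (f k).2 (g k).2) ?_))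
  rw [map_sub]
  exact sub_eq_zero.2 hfg

theorem completedHom_bijective (h : IsGradedComparison I e u θ ℓ) :
    Function.Bijective h.completedHom := by
  refine ⟨fun f g hfg => funext fun k => h.completedHom_injective_apply (congrFun hfg k),
    fun f => ?_⟩
  have hk (k : ℕ) : ∃ y : monomialDegree u k, θ (y : A) k = f k := by
    obtain ⟨⟨z, hz⟩, hz'⟩ := GradedPiece.mk_surjective k (f k)
    obtain ⟨y, hy, hy'⟩ := h.exists_mem_monomialDegree hz
    exact ⟨⟨y, hy⟩, by rw [hy', single_same, hz']⟩
  choose g hg using hk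
  exact ⟨g, funext hg⟩

/-- The isomorphism of completions. -/
noncomputable def completedEquiv (h : IsGradedComparison I e u θ ℓ) :
    DegreeCompletion (GradedPiece I) ≃ₐ[ℚ] DegreeCompletion fun k => monomialDegree u k :=
  (AlgEquiv.ofBijective h.completedHom h.completedHom_bijective).symm

theorem completedHom_completedEquiv (h : IsGradedComparison I e u θ ℓ)
    (f : DegreeCompletion (GradedPiece I)) : h.completedHom (h.completedEquiv f) = f :=
  (AlgEquiv.ofBijective h.completedHom h.completedHom_bijective).apply_symm_apply f

/-- Surjectivity in each degree comes from `exists_mem_monomialDegree` and injectivity from `ℓ`;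
both pass to the product over all degrees. For uniqueness, two candidates agree on the image of `θ`,
since `u` generates `A`. -/
theorem existsUnique_equiv (h : IsGradedComparison I e u θ ℓ) :
    ∃! Φ : DegreeCompletion (GradedPiece I) ≃ₐ[ℚ] DegreeCompletion fun k => monomialDegree u k,
      IsDegreewise Φ ∧ ∀ x, Φ (single 1 (GradedPiece.mk 1 ⟨e x, h.mem x⟩)) =
        single 1 (degreeOne u x) := by
  refine existsUnique_of_exists_of_unique ⟨h.completedEquiv, fun k x y hxy => ?_, fun x => ?_⟩ ?_
  · refine h.completedHom_injective_apply ?_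
    rw [completedHom_completedEquiv, completedHom_completedEquiv, hxy]
  · refine h.completedHom_bijective.1 ?_
    rw [completedHom_completedEquiv, completedHom_single]
    exact (h.map_gen x).symm
  · rintro Φ Ψ ⟨hΦ, hΦ'⟩ ⟨hΨ, hΨ'⟩
    have key : Φ.toAlgHom.comp θ =
        Ψ.toAlgHom.comp θ := by
      refine AlgHom.ext_of_adjoin_eq_top h.adjoin ?_
      rintro _ ⟨x, rfl⟩
      change Φ (θ (u x)) = Ψ (θ (u x))
      rw [h.map_gen, hΦ', hΨ']
    -- The image of `θ` need not be the whole completion. In each single degree, however, every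
    -- element is matched by some `θ y`, and degreewise maps only see that component.
    refine AlgEquiv.ext fun f => funext fun k => ?_
    obtain ⟨⟨z, hz⟩, hz'⟩ := GradedPiece.mk_surjective k (f k)
    obtain ⟨y, -, hy⟩ := h.exists_mem_monomialDegree hz
    have hf : f k = θ y k := by rw [hy, single_same, hz']
    rw [hΦ k _ _ hf, hΨ k _ _ hf]
    exact congrFun (DFunLike.congr_fun key y) k

end IsGradedComparison

end Comparison

end MixedBraid

namespace MixedBraid

open DegreeCompletion

/-! ### Monomials with two strand chords -/

section DoubleStrand

variable {m n : ℕ} {A : Type*} [Ring A] {u : Chord m n → A}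

theorem strandChordIdeal_le {K : Ideal A} [K.IsTwoSided] (h : ∀ x, x.IsStrandChord → u x ∈ K) :
    strandChordIdeal u ≤ K :=
  fun _ hx => map_strandChordIdeal_mem (RingHom.id A) h hx

theorem monomial_mem_doubleStrandIdeal (w₁ w₂ w₃ : List (Chord m n)) {x₁ x₂ : Chord m n}
    (h₁ : x₁.IsStrandChord) (h₂ : x₂.IsStrandChord) :
    ((w₁ ++ x₁ :: w₂ ++ x₂ :: w₃).map u).prod ∈ doubleStrandIdeal u :=
  TwoSidedIdeal.mem_asIdeal.2 (TwoSidedIdeal.subset_span ⟨w₁, w₂, w₃, x₁, x₂, h₁, h₂, rfl⟩)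

theorem map_eq_zero_of_mem_doubleStrandIdeal {B : Type*} [Ring B] (f : A →+* B)
    (hf : ∀ (w₁ w₂ w₃ : List (Chord m n)) (x₁ x₂ : Chord m n),
      x₁.IsStrandChord → x₂.IsStrandChord →
        ((w₁ ++ x₁ :: w₂ ++ x₂ :: w₃).map fun x => f (u x)).prod = 0)
    {y : A} (hy : y ∈ doubleStrandIdeal u) : f y = 0 := by
  rw [doubleStrandIdeal, TwoSidedIdeal.mem_asIdeal] at hy
  refine (TwoSidedIdeal.mem_ker _).1
    ((TwoSidedIdeal.span_le (I := TwoSidedIdeal.ker f)).2 ?_ hy)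
  rintro _ ⟨w₁, w₂, w₃, x₁, x₂, h₁, h₂, rfl⟩
  rw [SetLike.mem_coe, TwoSidedIdeal.mem_ker, map_list_prod, List.map_map]
  exact hf w₁ w₂ w₃ x₁ x₂ h₁ h₂

/-- Generation of the algebra is needed because an arbitrary element may stand between two strand
chords; it is a combination of monomials, and each of these gives a monomial with two strand chords.
-/
theorem mul_mem_doubleStrandIdeal [Algebra ℚ A] (hu : Algebra.adjoin ℚ (Set.range u) = ⊤)
    {x y : A} (hx : x ∈ strandChordIdeal u) (hy : y ∈ strandChordIdeal u) :
    x * y ∈ doubleStrandIdeal u := by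
  have h1 (x₁ x₂ : Chord m n) (h₁ : x₁.IsStrandChord) (h₂ : x₂.IsStrandChord) (a : A) :
      u x₁ * a * u x₂ ∈ doubleStrandIdeal u := by
    have ha : a ∈ Submodule.span ℚ (Submonoid.closure (Set.range u) : Set A) := by
      rw [← Algebra.adjoin_eq_span, hu]
      trivial
    induction ha using Submodule.span_induction with
    | mem a ha =>
      obtain ⟨l, hl, rfl⟩ := Submonoid.exists_list_of_mem_closure ha
      obtain ⟨w, rfl⟩ : ∃ w : List (Chord m n), w.map u = l := by
        have : l ∈ Set.range (List.map u) := by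
          rw [Set.range_list_map]
          exact hl
        exact this
      have := monomial_mem_doubleStrandIdeal (u := u) [] w [] h₁ h₂
      simpa [mul_assoc] using this
    | zero => rw [mul_zero, zero_mul]; exact zero_mem _
    | add a b _ _ ha hb => rw [mul_add, add_mul]; exact add_mem ha hb
    | smul c a _ ha =>
      rw [mul_smul_comm, smul_mul_assoc, Algebra.smul_def]
      exact Ideal.mul_mem_left _ _ ha
  have h2 (x₁ : Chord m n) (h₁ : x₁.IsStrandChord) {y : A} (hy : y ∈ strandChordIdeal u) (a : A) :
      u x₁ * a * y ∈ doubleStrandIdeal u := by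
    -- The quantifier over the middle factor `a` is what makes this set a left ideal.
    let K : Ideal A :=
      { carrier := {y | ∀ a, u x₁ * a * y ∈ doubleStrandIdeal u}
        add_mem' := fun hx hy a => by rw [mul_add]; exact add_mem (hx a) (hy a)
        zero_mem' := fun a => by rw [mul_zero]; exact zero_mem _
        smul_mem' := fun b y hy a => by
          rw [smul_eq_mul, ← mul_assoc, mul_assoc (u x₁)]; exact hy _ }
    have : K.IsTwoSided := ⟨fun {y} b hy a => by
      rw [← mul_assoc]; exact Ideal.mul_mem_right _ _ (hy a)⟩
    exact strandChordIdeal_le (K := K) (fun x₂ h₂ a => h1 x₁ x₂ h₁ h₂ a) hy a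
  let K : Ideal A :=
    { carrier := {x | ∀ a, x * a * y ∈ doubleStrandIdeal u}
      add_mem' := fun hx hy a => by rw [add_mul, add_mul]; exact add_mem (hx a) (hy a)
      zero_mem' := fun a => by rw [zero_mul, zero_mul]; exact zero_mem _
      smul_mem' := fun b x hx a => by
        rw [smul_eq_mul, mul_assoc b, mul_assoc b]
        exact Ideal.mul_mem_left _ _ (hx a) }
  have : K.IsTwoSided := ⟨by
    intro x b hx a
    rw [mul_assoc x]
    exact hx _⟩
  have := strandChordIdeal_le (K := K) (fun x₁ h₁ a => h2 x₁ h₁ hy a) hx 1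
  rwa [mul_one] at this

theorem strandChordIdeal_sq_le [Algebra ℚ A] (hu : Algebra.adjoin ℚ (Set.range u) = ⊤)
    {x : A} (hx : x ∈ strandChordIdeal u ^ 2) : x ∈ doubleStrandIdeal u :=
  pow_succ_induction (k := 1) (p := fun x => x ∈ doubleStrandIdeal u) (fun _ _ => add_mem)
    (fun _ hx _ hy => mul_mem_doubleStrandIdeal hu hx (mem_pow_one.1 hy)) hx

end DoubleStrand

/-! ### The associated graded algebra of the mixed pure braid group -/

section Mixed

variable {m n : ℕ}

theorem satisfiesDK_groupClass (m n : ℕ) : SatisfiesDK fun x : Chord m n =>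
    (single 1 (groupClass (chordBraid x)) : GrMixed m n) :=
  satisfiesDK_single (fun x : Chord m n => MonoidAlgebra.of ℚ _ (chordBraid x) - 1)
    (fun _ => of_sub_one_mem _) (satisfiesDK_mk_cube m n) fun i j h => by rw [chordBraid_symm]

/-- The coefficients of an expansion provide the maps `ℓ k`, and its defining properties are the
conditions on them. -/
theorem isGradedComparison_mixed {L : MixedGroupAlgebra m n →ₗ[ℚ] PowerSeries (ChordAlgebra m n)}
    (hL : IsExpansion L) :
    IsGradedComparison (mixedI m n)
      (fun x : Chord m n => MonoidAlgebra.of ℚ _ (chordBraid x) - 1) chord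
      (chordLift _ (satisfiesDK_groupClass m n))
      (fun k => ((PowerSeries.coeff k).restrictScalars ℚ).comp L) where
  mem x := of_sub_one_mem _
  adjoin := adjoin_chord
  exists_scalar z := ⟨augmentation _ z, by
    rw [mixedI_eq]
    exact sub_algebraMap_augmentation_mem (closure_chordBraid m n) z⟩
  pow_induction k p h0 hadd hneg hmul z hz := by
    refine augmentation_pow_induction (closure_chordBraid m n) h0 hadd hneg ?_ hz
    rintro _ ⟨x, rfl⟩
    exact hmul x
  map_gen x := chordLift_chord _ _ x
  ℓ_one := by
    rw [LinearMap.comp_apply, hL.map_one]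
    exact PowerSeries.coeff_zero_one
  ℓ_eq_zero k z hz := hL.mem_order (k + 1) z hz k (Nat.lt_succ_self k)
  ℓ_mul k x z hz := hL.coeff_mul x k z hz

end Mixed

/-! ### The associated graded algebra of emergent braids -/

section Emergent

variable {m n : ℕ}

/-- Products in the quotient lift factor by factor, so computations with powers of the image ideal
can be made upstairs. -/
theorem exists_of_mem_map_pow {R : Type*} [Ring R] {I K : Ideal R} [I.IsTwoSided] [K.IsTwoSided]
    (k : ℕ) {z : R ⧸ K} (hz : z ∈ I.map (Ideal.Quotient.mk K) ^ k) :
    ∃ y ∈ I ^ k, Ideal.Quotient.mk K y = z := by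
  induction k generalizing z with
  | zero =>
    obtain ⟨y, rfl⟩ := Ideal.Quotient.mk_surjective z
    exact ⟨y, mem_pow_zero _, rfl⟩
  | succ k ih =>
    refine pow_succ_induction (p := fun z => ∃ y ∈ I ^ (k + 1), Ideal.Quotient.mk K y = z) ?_ ?_ hz
    · rintro _ _ ⟨x, hx, rfl⟩ ⟨y, hy, rfl⟩
      exact ⟨x + y, add_mem hx hy, map_add _ _ _⟩
    · intro x hx y hy
      obtain ⟨x, hx', rfl⟩ := (Ideal.mem_map_iff_of_surjective _ Ideal.Quotient.mk_surjective).1 hx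
      obtain ⟨y, hy', rfl⟩ := ih hy
      refine ⟨x * y, ?_, map_mul _ _ _⟩
      rw [add_comm]
      exact mul_mem_pow_add (mem_pow_one.2 hx') hy'

theorem mk_mem_emergentI_pow (k : ℕ) {z : MixedGroupAlgebra m n} (hz : z ∈ mixedI m n ^ k) :
    Ideal.Quotient.mk (mixedJ m n ^ 2) z ∈ emergentI m n ^ k :=
  map_mem_pow (Ideal.Quotient.mk (mixedJ m n ^ 2)) (fun _ h => Ideal.mem_map_of_mem _ h) k hz

theorem satisfiesDK_emergentClass (m n : ℕ) : SatisfiesDK fun x : Chord m n =>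
    (single 1 (emergentClass (chordBraid x)) : GrEmergent m n) := by
  refine satisfiesDK_single (fun x : Chord m n => Ideal.Quotient.mk (mixedJ m n ^ 2)
    (MonoidAlgebra.of ℚ _ (chordBraid x) - 1)) (fun _ => emergent_of_sub_one_mem _) ?_
    fun i j h => by rw [chordBraid_symm]
  exact (satisfiesDK_mk_cube m n).map (Ideal.quotientMap (emergentI m n ^ 3)
    (Ideal.Quotient.mk (mixedJ m n ^ 2)) fun z hz => Ideal.mem_comap.2 (mk_mem_emergentI_pow 3 hz))

theorem chordBraid_sub_one_mem_mixedJ {x : Chord m n} (hx : x.IsStrandChord) :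
    MonoidAlgebra.of ℚ _ (chordBraid x) - 1 ∈ mixedJ m n := by
  rw [mixedJ_eq]
  refine sub_one_mem_groupIdeal ?_
  cases x with
  | a i j => exact hx.elim
  | c i j h =>
    rcases lt_or_gt_of_ne h with h' | h'
    · exact ⟨i, j, h', chordBraid_c_of_lt h' h⟩
    · exact ⟨j, i, h', chordBraid_c_of_gt h' h⟩

theorem monomial_mem_mixedJ_sq (w₁ w₂ w₃ : List (Chord m n)) {x₁ x₂ : Chord m n}
    (h₁ : x₁.IsStrandChord) (h₂ : x₂.IsStrandChord) :
    ((w₁ ++ x₁ :: w₂ ++ x₂ :: w₃).map fun x =>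
      MonoidAlgebra.of ℚ (MixedPureBraidGroup m n) (chordBraid x) - 1).prod ∈ mixedJ m n ^ 2 := by
  rw [List.map_append, List.map_append, List.prod_append, List.prod_append, List.map_cons,
    List.map_cons, List.prod_cons, List.prod_cons]
  refine mul_mem_pow_add (i := 1) (j := 1) (mem_pow_one.2 ?_) (mem_pow_one.2 ?_)
  · exact Ideal.mul_mem_left _ _ (Ideal.mul_mem_right _ _ (chordBraid_sub_one_mem_mixedJ h₁))
  · exact Ideal.mul_mem_right _ _ (chordBraid_sub_one_mem_mixedJ h₂)

/-- A monomial in degree-one classes is the class of the product of representatives, which shows the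
vanishing of a monomial by that of one element. -/
theorem prod_single_mk {X R : Type*} [Ring R] {I : Ideal R} [I.IsTwoSided] (e : X → R)
    (he : ∀ x, e x ∈ I ^ 1) (w : List X) :
    ∃ h : (w.map e).prod ∈ I ^ w.length,
      (w.map fun x => (single 1 (GradedPiece.mk 1 ⟨e x, he x⟩) :
        DegreeCompletion (GradedPiece I))).prod =
      single w.length (GradedPiece.mk w.length ⟨(w.map e).prod, h⟩) := by
  induction w with
  | nil => exact ⟨mem_pow_zero _, rfl⟩
  | cons x w ih =>
    obtain ⟨h, ih⟩ := ih
    have key (j : ℕ) (hj : 1 + w.length = j) (h' : ((x :: w).map e).prod ∈ I ^ j) :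
        (single (1 + w.length) (GradedPiece.mk (1 + w.length)
          ⟨e x * (w.map e).prod, mul_mem_pow_add (he x) h⟩) : DegreeCompletion (GradedPiece I)) =
          single j (GradedPiece.mk j ⟨((x :: w).map e).prod, h'⟩) := by
      subst hj; rfl
    have h' : ((x :: w).map e).prod ∈ I ^ (x :: w).length := by
      rw [List.map_cons, List.prod_cons, List.length_cons, add_comm]
      exact mul_mem_pow_add (he x) h
    refine ⟨h', ?_⟩
    rw [List.map_cons, List.prod_cons, ih, single_mk_mul_single_mk]
    exact key _ (add_comm _ _) h'

/-- The homomorphism from emergent chord diagrams to the associated graded algebra of emergent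
braids. -/
noncomputable def emergentHom (m n : ℕ) : EmergentChordAlgebra m n →ₐ[ℚ] GrEmergent m n :=
  Ideal.Quotient.liftₐ (doubleStrandIdeal (chord (m := m) (n := n)))
    (chordLift _ (satisfiesDK_emergentClass m n))
    (doubleStrandIdeal_le _ fun w₁ w₂ w₃ x₁ x₂ h₁ h₂ => by
      simp only [chordLift_chord]
      obtain ⟨h, h'⟩ := prod_single_mk (I := emergentI m n)
        (fun x : Chord m n => Ideal.Quotient.mk (mixedJ m n ^ 2)
          (MonoidAlgebra.of ℚ _ (chordBraid x) - 1)) (fun _ => emergent_of_sub_one_mem _)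
        (w₁ ++ x₁ :: w₂ ++ x₂ :: w₃)
      refine h'.trans ?_
      -- Each of the two strand chords contributes a factor in `J`, so the product of
      -- representatives already vanishes in the quotient by `J ^ 2`.
      have h0 : ((w₁ ++ x₁ :: w₂ ++ x₂ :: w₃).map fun x : Chord m n =>
          Ideal.Quotient.mk (mixedJ m n ^ 2) (MonoidAlgebra.of ℚ _ (chordBraid x) - 1)).prod =
            0 := by
        have := Ideal.Quotient.eq_zero_iff_mem.2 (monomial_mem_mixedJ_sq w₁ w₂ w₃ h₁ h₂)
        rwa [map_list_prod, List.map_map] at this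
      have h1 : (⟨_, h⟩ : ↥(emergentI m n ^ (w₁ ++ x₁ :: w₂ ++ x₂ :: w₃).length)) = 0 :=
        Subtype.ext h0
      rw [h1, GradedPiece.mk_zero, single_zero])

theorem emergentHom_emChord (x : Chord m n) :
    emergentHom m n (emChord x) = single 1 (emergentClass (chordBraid x)) :=
  chordLift_chord _ (satisfiesDK_emergentClass m n) x

variable {L : MixedGroupAlgebra m n →ₗ[ℚ] PowerSeries (ChordAlgebra m n)}

/-- The coefficients of an expansion, modulo the monomials with two strand chords. -/
noncomputable def emergentCoeff (hL : IsExpansion L) (k : ℕ) :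
    EmergentGroupAlgebra m n →ₗ[ℚ] EmergentChordAlgebra m n :=
  (((mixedJ m n ^ 2).restrictScalars ℚ).liftQ
    ((Ideal.Quotient.mkₐ ℚ (doubleStrandIdeal (chord (m := m) (n := n)))).toLinearMap.comp
      (((PowerSeries.coeff k).restrictScalars ℚ).comp L))
    -- On `J ^ 2` all coefficients lie in the square of the ideal of strand chords, hence among the
    -- monomials with two of them.
    (fun z hz => Ideal.Quotient.eq_zero_iff_mem.2
      (strandChordIdeal_sq_le adjoin_chord
        (hL.mem_coeff 2 z ((Submodule.restrictScalars_mem ℚ _ _).1 hz) k)))).comp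
    (Submodule.Quotient.restrictScalarsEquiv ℚ (mixedJ m n ^ 2)).symm.toLinearMap

theorem emergentCoeff_mk (hL : IsExpansion L) (k : ℕ) (z : MixedGroupAlgebra m n) :
    emergentCoeff hL k (Ideal.Quotient.mk (mixedJ m n ^ 2) z) =
      Ideal.Quotient.mk (doubleStrandIdeal chord) (PowerSeries.coeff k (L z)) := rfl

/-- Everything is inherited from the mixed case by lifting elements of powers of the image ideal to
powers of `I`. -/
theorem isGradedComparison_emergent (hL : IsExpansion L) :
    IsGradedComparison (emergentI m n)
      (fun x : Chord m n => Ideal.Quotient.mk (mixedJ m n ^ 2)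
        (MonoidAlgebra.of ℚ _ (chordBraid x) - 1)) emChord
      (emergentHom m n) (emergentCoeff hL) where
  mem x := emergent_of_sub_one_mem _
  adjoin := adjoin_emChord
  exists_scalar z := by
    obtain ⟨z, rfl⟩ := Ideal.Quotient.mk_surjective z
    obtain ⟨c, hc⟩ := (isGradedComparison_mixed hL).exists_scalar z
    refine ⟨c, ?_⟩
    have := Ideal.mem_map_of_mem (Ideal.Quotient.mk (mixedJ m n ^ 2)) hc
    rwa [map_sub] at this
  pow_induction k p h0 hadd hneg hmul z hz := by
    obtain ⟨z, hz', rfl⟩ := exists_of_mem_map_pow _ hz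
    refine (isGradedComparison_mixed hL).pow_induction k
      (fun z => p (Ideal.Quotient.mk (mixedJ m n ^ 2) z)) ?_ ?_ ?_ ?_ z hz'
    · rwa [map_zero]
    · intro x y hx hy; rw [map_add]; exact hadd _ _ hx hy
    · intro x hx; rw [map_neg]; exact hneg _ hx
    · intro x y hy; rw [map_mul]; exact hmul x _ (mk_mem_emergentI_pow k hy)
  map_gen x := emergentHom_emChord x
  ℓ_one := by
    have := emergentCoeff_mk hL 0 1
    rw [hL.map_one, PowerSeries.coeff_zero_one] at this
    exact this
  ℓ_eq_zero k z hz := by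
    obtain ⟨z, hz', rfl⟩ := exists_of_mem_map_pow _ hz
    rw [emergentCoeff_mk, hL.mem_order (k + 1) z hz' k (Nat.lt_succ_self k), map_zero]
  ℓ_mul k x z hz := by
    obtain ⟨z, hz', rfl⟩ := exists_of_mem_map_pow _ hz
    rw [← map_mul, emergentCoeff_mk, hL.coeff_mul x k z hz', map_mul, emergentCoeff_mk]
    rfl

end Emergent

/-! ### The enveloping algebra of the emergent Drinfeld–Kohno Lie algebra -/

section Enveloping

attribute [local instance] LieRing.ofAssociativeRing LieAlgebra.ofAssociativeAlgebra

variable {m n : ℕ}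

/-- The preimage of a two-sided ideal under `ι` is a Lie ideal, as brackets become commutators. -/
theorem ι_mem_strandChordIdeal {x : DK m n} (hx : x ∈ strandIdeal m n) :
    UniversalEnvelopingAlgebra.ι ℚ x ∈ strandChordIdeal (chord (m := m) (n := n)) := by
  let K : LieIdeal ℚ (DK m n) :=
    { carrier := {x | UniversalEnvelopingAlgebra.ι ℚ x ∈ strandChordIdeal (chord (m := m) (n := n))}
      add_mem' := fun {x y} hx hy => by
        change UniversalEnvelopingAlgebra.ι ℚ (x + y) ∈ strandChordIdeal chord
        rw [map_add]; exact add_mem hx hy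
      zero_mem' := by
        change UniversalEnvelopingAlgebra.ι ℚ (0 : DK m n) ∈ strandChordIdeal chord
        rw [map_zero]; exact zero_mem _
      smul_mem' := fun c x hx => by
        change UniversalEnvelopingAlgebra.ι ℚ (c • x) ∈ strandChordIdeal chord
        rw [map_smul, Algebra.smul_def]; exact Ideal.mul_mem_left _ _ hx
      lie_mem := fun {x y} hy => by
        change UniversalEnvelopingAlgebra.ι ℚ ⁅x, y⁆ ∈ strandChordIdeal chord
        rw [LieHom.map_lie, Ring.lie_def]
        exact sub_mem (Ideal.mul_mem_left _ _ hy) (Ideal.mul_mem_right _ _ hy) }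
  have : strandIdeal m n ≤ K := by
    rw [strandIdeal, LieSubmodule.lieSpan_le]
    rintro _ ⟨x, hx, rfl⟩
    exact mem_strandChordIdeal chord hx
  exact this hx

/-- The homomorphism of Lie algebras from `dk_{m,n}` to emergent chord diagrams. -/
noncomputable def dkToEmergent (m n : ℕ) : DK m n →ₗ⁅ℚ⁆ EmergentChordAlgebra m n :=
  (Ideal.Quotient.mkₐ ℚ (doubleStrandIdeal (chord (m := m) (n := n)))).toLieHom.comp
    (UniversalEnvelopingAlgebra.ι ℚ)

/-- Both terms of the commutator are products of two elements of the ideal of strand chords. -/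
theorem lie_strandIdeal_le_ker (m n : ℕ) :
    ⁅strandIdeal m n, strandIdeal m n⁆ ≤ (dkToEmergent m n).ker := by
  rw [LieSubmodule.lie_le_iff]
  intro x hx y hy
  rw [LieHom.mem_ker]
  refine Ideal.Quotient.eq_zero_iff_mem.2 ?_
  change UniversalEnvelopingAlgebra.ι ℚ ⁅x, y⁆ ∈ _
  rw [LieHom.map_lie, Ring.lie_def]
  exact sub_mem
    (mul_mem_doubleStrandIdeal adjoin_chord (ι_mem_strandChordIdeal hx) (ι_mem_strandChordIdeal hy))
    (mul_mem_doubleStrandIdeal adjoin_chord (ι_mem_strandChordIdeal hy) (ι_mem_strandChordIdeal hx))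

/-- The homomorphism from `U(edk_{m,n})` to emergent chord diagrams. -/
noncomputable def edkToEmergent (m n : ℕ) :
    UniversalEnvelopingAlgebra ℚ (EDK m n) →ₐ[ℚ] EmergentChordAlgebra m n :=
  UniversalEnvelopingAlgebra.lift ℚ
    (lieQuotientLift _ (dkToEmergent m n) (lie_strandIdeal_le_ker m n))

theorem edkToEmergent_edkChord (x : Chord m n) : edkToEmergent m n (edkChord x) = emChord x := by
  rw [edkToEmergent, edkChord, UniversalEnvelopingAlgebra.lift_ι_apply]
  rfl

/-- The homomorphism of enveloping algebras that is induced by the projection from `dk_{m,n}` to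
`edk_{m,n}`. -/
noncomputable def chordToEDK (m n : ℕ) :
    ChordAlgebra m n →ₐ[ℚ] UniversalEnvelopingAlgebra ℚ (EDK m n) :=
  UniversalEnvelopingAlgebra.lift ℚ ((UniversalEnvelopingAlgebra.ι ℚ).comp
    (lieQuotientMk ⁅strandIdeal m n, strandIdeal m n⁆))

theorem chordToEDK_ι (y : DK m n) :
    chordToEDK m n (UniversalEnvelopingAlgebra.ι ℚ y) =
      UniversalEnvelopingAlgebra.ι ℚ (LieSubmodule.Quotient.mk y : EDK m n) := by
  rw [chordToEDK, UniversalEnvelopingAlgebra.lift_ι_apply]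
  rfl

theorem chordToEDK_chord (x : Chord m n) : chordToEDK m n (chord x) = edkChord x :=
  chordToEDK_ι _

/-- Every element of `edk_{m,n}` comes from `dk_{m,n}`, so the claim reduces to homomorphisms out of
the chord algebra. -/
theorem edk_hom_ext {B : Type*} [Ring B] [Algebra ℚ B]
    {f g : UniversalEnvelopingAlgebra ℚ (EDK m n) →ₐ[ℚ] B}
    (h : ∀ x, f (edkChord x) = g (edkChord x)) : f = g := by
  have key : f.comp (chordToEDK m n) = g.comp (chordToEDK m n) :=
    chordAlgebra_hom_ext fun x => by
      rw [AlgHom.comp_apply, AlgHom.comp_apply, chordToEDK_chord, h]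
  apply UniversalEnvelopingAlgebra.hom_ext
  refine LieHom.ext fun y => ?_
  obtain ⟨y, rfl⟩ := LieSubmodule.Quotient.surjective_mk' _ y
  have := DFunLike.congr_fun key (UniversalEnvelopingAlgebra.ι ℚ y)
  rw [AlgHom.comp_apply, AlgHom.comp_apply, chordToEDK_ι] at this
  exact this

/-- The quotient of `U(edk_{m,n})` by the monomials with two strand chords. -/
abbrev EmergentEnveloping (m n : ℕ) : Type :=
  UniversalEnvelopingAlgebra ℚ (EDK m n) ⧸ doubleStrandIdeal (edkChord (m := m) (n := n))

theorem emergentEnveloping_hom_ext {B : Type*} [Ring B] [Algebra ℚ B]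
    {f g : EmergentEnveloping m n →ₐ[ℚ] B}
    (h : ∀ x : Chord m n, f (Ideal.Quotient.mk _ (edkChord x)) =
      g (Ideal.Quotient.mk _ (edkChord x))) : f = g := by
  have key : f.comp (Ideal.Quotient.mkₐ ℚ _) = g.comp (Ideal.Quotient.mkₐ ℚ _) := edk_hom_ext h
  refine AlgHom.ext fun y => ?_
  obtain ⟨y, rfl⟩ := Ideal.Quotient.mk_surjective y
  exact DFunLike.congr_fun key y

theorem emergentChord_hom_ext {B : Type*} [Ring B] [Algebra ℚ B]
    {f g : EmergentChordAlgebra m n →ₐ[ℚ] B} (h : ∀ x, f (emChord x) = g (emChord x)) : f = g := by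
  refine AlgHom.ext_of_adjoin_eq_top adjoin_emChord ?_
  rintro _ ⟨x, rfl⟩
  exact h x

/-- The homomorphism from the quotient of `U(edk_{m,n})` to emergent chord diagrams. -/
noncomputable def envelopingToEmergent (m n : ℕ) :
    EmergentEnveloping m n →ₐ[ℚ] EmergentChordAlgebra m n :=
  Ideal.Quotient.liftₐ (doubleStrandIdeal (edkChord (m := m) (n := n))) (edkToEmergent m n)
    fun y hy => by
      refine map_eq_zero_of_mem_doubleStrandIdeal
        (edkToEmergent m n : _ →+* EmergentChordAlgebra m n) (fun w₁ w₂ w₃ x₁ x₂ h₁ h₂ => ?_) hy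
      rw [← prod_emChord_eq_zero w₁ w₂ w₃ x₁ x₂ h₁ h₂]
      congr 2
      funext x
      exact edkToEmergent_edkChord x

theorem envelopingToEmergent_mk (x : Chord m n) :
    envelopingToEmergent m n (Ideal.Quotient.mk _ (edkChord x)) = emChord x :=
  edkToEmergent_edkChord x

/-- The homomorphism from emergent chord diagrams to the quotient of `U(edk_{m,n})`. -/
noncomputable def emergentToEnveloping (m n : ℕ) :
    EmergentChordAlgebra m n →ₐ[ℚ] EmergentEnveloping m n :=
  Ideal.Quotient.liftₐ (doubleStrandIdeal (chord (m := m) (n := n)))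
    ((Ideal.Quotient.mkₐ ℚ (doubleStrandIdeal (edkChord (m := m) (n := n)))).comp (chordToEDK m n))
    (doubleStrandIdeal_le _ fun w₁ w₂ w₃ x₁ x₂ h₁ h₂ => by
      have := Ideal.Quotient.eq_zero_iff_mem.2
        (monomial_mem_doubleStrandIdeal (u := edkChord (m := m) (n := n)) w₁ w₂ w₃ h₁ h₂)
      rw [map_list_prod, List.map_map] at this
      rw [← this]
      congr 2
      funext x
      exact congrArg (Ideal.Quotient.mk _) (chordToEDK_chord x))

theorem emergentToEnveloping_emChord (x : Chord m n) :
    emergentToEnveloping m n (emChord x) = Ideal.Quotient.mk _ (edkChord x) :=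
  congrArg (Ideal.Quotient.mk _) (chordToEDK_chord x)

/-- The two homomorphisms exchange the generators, so both composites are identities by the
extensionality lemmas, which also give uniqueness. -/
theorem existsUnique_envelopingEquiv (m n : ℕ) :
    ∃! Ψ : EmergentEnveloping m n ≃ₐ[ℚ] EmergentChordAlgebra m n,
      ∀ x : Chord m n, Ψ (Ideal.Quotient.mk _ (edkChord x)) = emChord x := by
  refine ⟨AlgEquiv.ofAlgHom (envelopingToEmergent m n) (emergentToEnveloping m n) ?_ ?_,
    envelopingToEmergent_mk, fun Ψ hΨ => ?_⟩
  · refine emergentChord_hom_ext fun x => ?_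
    rw [AlgHom.comp_apply, emergentToEnveloping_emChord, envelopingToEmergent_mk]
    rfl
  · refine emergentEnveloping_hom_ext fun x => ?_
    rw [AlgHom.comp_apply, envelopingToEmergent_mk, emergentToEnveloping_emChord]
    rfl
  · have : Ψ.toAlgHom = envelopingToEmergent m n := emergentEnveloping_hom_ext fun x =>
      (hΨ x).trans (envelopingToEmergent_mk x).symm
    exact AlgEquiv.ext fun y => DFunLike.congr_fun this y

end Enveloping

/-! ### The proof of the proposition -/

/-- Bridges two indexings: strand chords carry ordered pairs of distinct strands, whereas the
`τ_{ij}` exist only for `i < j`. -/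
theorem forall_chord_iff {m n : ℕ} {p : Chord m n → Prop}
    (hsymm : ∀ i j h, p (.c i j h) → p (.c j i h.symm)) :
    (∀ x, p x) ↔ (∀ i j, p (.a i j)) ∧ ∀ (i j : Fin n) (h : i < j), p (.c i j h.ne) := by
  refine ⟨fun h => ⟨fun _ _ => h _, fun _ _ _ => h _⟩, fun ⟨ha, hc⟩ x => ?_⟩
  cases x with
  | a i j => exact ha i j
  | c i j h =>
    rcases lt_or_gt_of_ne h with h' | h'
    · exact hc i j h'
    · exact hsymm j i h.symm (hc j i h')

end MixedBraid

open MixedBraid DegreeCompletion in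
theorem proposition2p3 (m n : ℕ) :
    (∃! Φ : GrMixed m n ≃ₐ[ℚ] CompletedChord m n,
      IsDegreewise Φ ∧
      (∀ (i : Fin m) (j : Fin n),
        Φ (single 1 (groupClass (alpha i j))) = single 1 (degreeOne chord (.a i j))) ∧
      (∀ (i j : Fin n) (h : i < j),
        Φ (single 1 (groupClass (tau i j h))) = single 1 (degreeOne chord (.c i j h.ne)))) ∧
    (∃! Φ : GrEmergent m n ≃ₐ[ℚ] CompletedEmergentChord m n,
      IsDegreewise Φ ∧
      (∀ (i : Fin m) (j : Fin n),
        Φ (single 1 (emergentClass (alpha i j))) = single 1 (degreeOne emChord (.a i j))) ∧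
      (∀ (i j : Fin n) (h : i < j),
        Φ (single 1 (emergentClass (tau i j h))) = single 1 (degreeOne emChord (.c i j h.ne)))) ∧
    (∃! Ψ : (UniversalEnvelopingAlgebra ℚ (EDK m n) ⧸
          doubleStrandIdeal (edkChord (m := m) (n := n))) ≃ₐ[ℚ] EmergentChordAlgebra m n,
      ∀ x : Chord m n, Ψ (Ideal.Quotient.mk _ (edkChord x)) = emChord x) := by
  obtain ⟨L, hL⟩ := exists_isExpansion m n
  refine ⟨?_, ?_, existsUnique_envelopingEquiv m n⟩
  · refine (existsUnique_congr fun Φ => and_congr_right fun _ => ?_).1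
      (isGradedComparison_mixed hL).existsUnique_equiv
    refine (forall_chord_iff (p := fun x => Φ (single 1 (groupClass (chordBraid x))) =
      single 1 (degreeOne chord x)) ?_).trans (and_congr_right fun _ => ?_)
    · intro i j h e
      have hd : degreeOne (chord (m := m)) (.c i j h) = degreeOne chord (.c j i h.symm) :=
        Subtype.ext (satisfiesDK_chord.symm i j h)
      rwa [chordBraid_symm, hd] at e
    · refine forall_congr' fun i => forall_congr' fun j => forall_congr' fun h => ?_
      rw [chordBraid_c_of_lt h]
  · refine (existsUnique_congr fun Φ => and_congr_right fun _ => ?_).1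
      (isGradedComparison_emergent hL).existsUnique_equiv
    refine (forall_chord_iff (p := fun x => Φ (single 1 (emergentClass (chordBraid x))) =
      single 1 (degreeOne emChord x)) ?_).trans (and_congr_right fun _ => ?_)
    · intro i j h e
      have hd : degreeOne (emChord (m := m)) (.c i j h) = degreeOne emChord (.c j i h.symm) :=
        Subtype.ext (satisfiesDK_emChord.symm i j h)
      rwa [chordBraid_symm, hd] at e
    · refine forall_congr' fun i => forall_congr' fun j => forall_congr' fun h => ?_
      rw [chordBraid_c_of_lt h]
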